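/- **Model.** For each state $i\in\{0,1\}$ let real numbers $c^{(i)}(n)$, rates $\lambda^{(i)}_n>0$, $\mu^{(i)}_n>0$ and probability laws on $\mathbb R$ with finite first absolute moment, those of the jump amplitudes $r^{(i)}(n)$ and $R^{(i)}(n)$, be given for all $n\ge 0$, with means $\overline{r^{(i)}(n)}$, $\overline{R^{(i)}(n)}$, and assume $\sum_n 1/\lambda_n^{(i)}=\infty$. Fix an initial state $\varepsilon_0\in\{0,1\}$ and let $\varepsilon_0,\varepsilon_1,\varepsilon_2,\dots$ alternate between $0$ and $1$. Take independent random variables $\tau_{m,n}\sim\mathrm{Exp}(\lambda_n^{(\varepsilon_m)})$, $e_m\sim\mathrm{Exp}(1)$, $r_m(n)$ distributed as $r^{(\varepsilon_m)}(n)$ and $R_m(n)$ distributed as $R^{(\varepsilon_m)}(n)$ ($m,n\ge0$). Put $N_m(t)=\max\{n:\tau_{m,0}+\dots+\tau_{m,n-1}\le t\}$ and $\xi_m(t)=\int_0^t\mu^{(\varepsilon_m)}_{N_m(s)}\,ds$, and let $T_{m+1}=\inf\{t\ge 0:\xi_m(t)\ge e_m\}\in(0,\infty]$, so that $P(T_{m+1}>t\mid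 N_m)=e^{-\xi_m(t)}$. Let $T^{(+,m)}=T_1+\dots+T_m$ and $M(t)=\max\{m:T^{(+,m)}\le t\}$. With $l_m(t)=\int_0^tc^{(\varepsilon_m)}(N_m(s))\,ds$ and $j_m(t)=\sum_{n=1}^{N_m(t)}r_m(n-1)$ put $$\mathbb L(t)=\sum_{m=1}^{M(t)}l_{m-1}(T_m)+l_{M(t)}\bigl(t-T^{(+,M(t))}\bigr),$$ $$\mathbb J(t)=\sum_{m=1}^{M(t)}\bigl[R_{m-1}(N_{m-1}(T_m))+j_{m-1}(T_m)\bigr]+j_{M(t)}\bigl(t-T^{(+,M(t))}\bigr),$$ $X=\mathbb L+\mathbb J$, and let $(\mathcal F_t)_{t\ge0}$ be the filtration generated by $M(t)$, $N_{M(t)}(t-T^{(+,M(t))})$ and $X(t)$. Put $\Lambda_n^{(i)}=\prod_{k=0}^{n-1}\lambda^{(i)}_k$ and $\kappa_{n,k}(\vec\nu)=\prod_{0\le j\le n,\,j\ne k}(\nu_j-\nu_k)^{-1}$. **Convergence condition (C).** For each $i\in\{0,1\}$, for $\vec\nu=\vec\lambda^{(i)}+\vec\mu^{(i)}$ or for $\vec\nu=\vec\mu^{(i)}$,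 the terms of $\vec\nu$ are pairwise distinct and $$\sum_{n=k}^\infty\Bigl(|c^{(i)}(n)|+\lambda^{(i)}_n\,\mathbb E|r^{(i)}(n)|+\mu^{(i)}_n\,\mathbb E|R^{(i)}(n)|\Bigr)\Lambda^{(i)}_n\,|\kappa_{n,k}(\vec\nu)|<\infty\qquad\text{for all }k\ge0 .$$ **Theorem.** Assume (C). Then $X$ is a martingale with respect to $(\mathcal F_t)_{t\ge0}$ if and only if, for both states $i\in\{0,1\}$, $$\Delta^{(i)}(n):=c^{(i)}(n)+\lambda^{(i)}_n\,\overline{r^{(i)}(n)}+\mu^{(i)}_n\,\overline{R^{(i)}(n)}=0\qquad\text{for all }n\ge0 .$$ Moreover, the "only if" part holds without (C). -/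

import Mathlib

open MeasureTheory ProbabilityTheory
open scoped NNReal ENNReal

namespace PiecewiseLinear

noncomputable section

/-- The parameters of one pattern: the tendencies `c n`, the shock rates `lam n`, the
pattern-switching rates `mu n`, and the laws of the jump amplitudes `r(n)` (at shocks) and `R(n)`
(at pattern switchings). -/
structure Pattern where
  c : ℕ → ℝ
  lam : ℕ → ℝ
  mu : ℕ → ℝ
  rLaw : ℕ → Measure ℝ
  RLaw : ℕ → Measure ℝ

namespace Pattern

variable (p : Pattern)

/-- Positive rates, non-explosive shocks, and jump amplitudes with finite expectations. -/
structure Admissible : Prop where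
  lam_pos : ∀ n, 0 < p.lam n
  mu_pos : ∀ n, 0 < p.mu n
  nonexplosive : ¬ Summable fun n => (p.lam n)⁻¹
  rLaw_prob : ∀ n, IsProbabilityMeasure (p.rLaw n)
  RLaw_prob : ∀ n, IsProbabilityMeasure (p.RLaw n)
  rLaw_integrable : ∀ n, Integrable (fun x : ℝ => x) (p.rLaw n)
  RLaw_integrable : ∀ n, Integrable (fun x : ℝ => x) (p.RLaw n)

/-- The mean of the jump amplitude `r(n)`. -/
def rMean (n : ℕ) : ℝ := ∫ x, x ∂(p.rLaw n)

/-- The mean of the jump amplitude `R(n)`. -/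
def RMean (n : ℕ) : ℝ := ∫ x, x ∂(p.RLaw n)

/-- The first absolute moment of `r(n)`. -/
def rAbs (n : ℕ) : ℝ := ∫ x, |x| ∂(p.rLaw n)

/-- The first absolute moment of `R(n)`. -/
def RAbs (n : ℕ) : ℝ := ∫ x, |x| ∂(p.RLaw n)

/-- `Δ(n) = c(n) + λ_n r̄(n) + μ_n R̄(n)`. -/
def Delta (n : ℕ) : ℝ := p.c n + p.lam n * p.rMean n + p.mu n * p.RMean n

/-- `Λ_n = λ_0 ⋯ λ_{n-1}`, with `Λ_0 = 1`. -/
def Lam (n : ℕ) : ℝ := ∏ k ∈ Finset.range n, p.lam k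

end Pattern

/-- `κ_{n,k}(ν) = ∏_{0 ≤ j ≤ n, j ≠ k} (ν_j - ν_k)⁻¹`. -/
def kappa (nu : ℕ → ℝ) (n k : ℕ) : ℝ :=
  ∏ j ∈ (Finset.range (n + 1)).erase k, (nu j - nu k)⁻¹

namespace Pattern

variable (p : Pattern)

/-- The convergence condition relative to a sequence `ν` with distinct terms: for each `k`, the
series `∑_{n ≥ k} (|c(n)| + λ_n E|r(n)| + μ_n E|R(n)|) Λ_n |κ_{n,k}(ν)|` converges. -/
def ConvergesWith (nu : ℕ → ℝ) : Prop :=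
  Function.Injective nu ∧ ∀ k, Summable fun n : {n : ℕ // k ≤ n} =>
    (|p.c n| + p.lam n * p.rAbs n + p.mu n * p.RAbs n) * p.Lam n * |kappa nu n k|

/-- The convergence condition, with `ν = λ + μ` or `ν = μ`. -/
def Converges : Prop :=
  p.ConvergesWith (fun n => p.lam n + p.mu n) ∨ p.ConvergesWith p.mu

end Pattern

/-- The alternating sequence of states, starting from `i₀`. -/
def eps (i₀ : Bool) (m : ℕ) : Bool := if Even m then i₀ else !i₀

/-- Labels of the independent random variables which drive the process during its `m`-th holding
period, `m ≥ 0`. -/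
inductive Source where
  | shock (m n : ℕ)
  | clock (m : ℕ)
  | inner (m n : ℕ)
  | outer (m n : ℕ)

/-- The laws of the driving variables. In the period `m`, with state `i = eps i₀ m`:
`shock m n` is the time spent between the `n`-th and the `(n+1)`-st shock, exponential with rate
`λ_n^{(i)}`; `clock m` is the standard exponential threshold which the accumulated intensity has
to reach for the pattern to be switched; `inner m n` and `outer m n` are the jump amplitudes
`r_m(n)` and `R_m(n)`. -/
def sourceLaw (σ : Bool → Pattern) (i₀ : Bool) : Source → Measure ℝ
  | .shock m n => expMeasure ((σ (eps i₀ m)).lam n)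
  | .clock _ => expMeasure 1
  | .inner m n => (σ (eps i₀ m)).rLaw n
  | .outer m n => (σ (eps i₀ m)).RLaw n

/-- A family of independent random variables with the prescribed laws, on an arbitrary
probability space. -/
structure Driving {Ω : Type*} [MeasurableSpace Ω] (P : Measure Ω) (σ : Bool → Pattern)
    (i₀ : Bool) where
  noise : Source → Ω → ℝ
  measurable_noise : ∀ s, Measurable (noise s)
  law_noise : ∀ s, P.map (noise s) = sourceLaw σ i₀ s
  indep_noise : iIndepFun noise P

namespace Driving

variable {Ω : Type*} [MeasurableSpace Ω] {P : Measure Ω} {σ : Bool → Pattern} {i₀ : Bool}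
variable (D : Driving P σ i₀)

/-- The number `N_m(t)` of shocks in the period `m`, at the time `t` after its beginning. -/
def N (m : ℕ) (t : ℝ) (ω : Ω) : ℕ :=
  sSup {n : ℕ | ∑ k ∈ Finset.range n, D.noise (.shock m k) ω ≤ t}

/-- The accumulated intensity `ξ_m(t) = ∫_0^t μ^{(ε_m)}_{N_m(s)} ds`. -/
def xi (m : ℕ) (t : ℝ) (ω : Ω) : ℝ≥0∞ :=
  ∫⁻ s in Set.Ioc 0 t, ENNReal.ofReal ((σ (eps i₀ m)).mu (D.N m s ω))

/-- The holding time of the `m`-th period, `m ≥ 0` (usually written `T_{m+1}`): the first time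
at which the accumulated intensity `ξ_m` reaches the independent standard exponential threshold
`clock m`, so that its survivor function given the shocks is `P(T > t | N_m) = exp (-ξ_m(t))`, and
`P(T > t) = E exp (-ξ_m(t))`. The value is `∞` if the threshold is never reached. -/
def hold (m : ℕ) (ω : Ω) : ℝ≥0∞ :=
  ⨅ (t : ℝ≥0) (_ : ENNReal.ofReal (D.noise (.clock m) ω) ≤ D.xi m t ω), (t : ℝ≥0∞)

/-- The time `T^{(+,m)} = T_1 + ⋯ + T_m` of the `m`-th switching, `T^{(+,0)} = 0`. -/
def switchTime (m : ℕ) (ω : Ω) : ℝ≥0∞ := ∑ k ∈ Finset.range m, D.hold k ω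

/-- The number of switchings, `M(t) = max {m | T^{(+,m)} ≤ t}`. -/
def M (t : ℝ≥0) (ω : Ω) : ℕ := sSup {m : ℕ | D.switchTime m ω ≤ t}

/-- The time `t - T^{(+,M(t))}` elapsed since the last switching. -/
def elapsed (t : ℝ≥0) (ω : Ω) : ℝ := (t : ℝ) - (D.switchTime (D.M t ω) ω).toReal

/-- `l_m(t) = ∫_0^t c^{(ε_m)}(N_m(s)) ds`. -/
def l (m : ℕ) (t : ℝ) (ω : Ω) : ℝ := ∫ s in 0..t, (σ (eps i₀ m)).c (D.N m s ω)

/-- `j_m(t) = ∑_{n=1}^{N_m(t)} r_m(n-1)`. -/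
def jump (m : ℕ) (t : ℝ) (ω : Ω) : ℝ :=
  ∑ n ∈ Finset.range (D.N m t ω), D.noise (.inner m n) ω

/-- The piecewise linear process `𝕃`. -/
def LL (t : ℝ≥0) (ω : Ω) : ℝ :=
  ∑ m ∈ Finset.range (D.M t ω), D.l m (D.hold m ω).toReal ω + D.l (D.M t ω) (D.elapsed t ω) ω

/-- The jump process `𝕁`. -/
def JJ (t : ℝ≥0) (ω : Ω) : ℝ :=
  ∑ m ∈ Finset.range (D.M t ω),
      (D.noise (.outer m (D.N m (D.hold m ω).toReal ω)) ω + D.jump m (D.hold m ω).toReal ω)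
    + D.jump (D.M t ω) (D.elapsed t ω) ω

/-- The process `X = 𝕃 + 𝕁`. -/
def X (t : ℝ≥0) (ω : Ω) : ℝ := D.LL t ω + D.JJ t ω

/-- The number of pattern switchings up to time `t`, the number of shocks since the last one,
and the value of `X`. -/
def obs (t : ℝ≥0) (ω : Ω) : ℕ × ℕ × ℝ :=
  (D.M t ω, D.N (D.M t ω) (D.elapsed t ω) ω, D.X t ω)

/-! ### Measurability -/

lemma measurable_sSup_nat {α : Type*} [MeasurableSpace α] (A : α → Set ℕ)
    (hA : ∀ k, MeasurableSet {a | k ∈ A a}) : Measurable fun a => sSup (A a) := by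
  refine measurable_to_countable' fun n => ?_
  have key : (fun a => sSup (A a)) ⁻¹' {n} =
      ({a | n ∈ A a} ∩ ⋂ k, ({a | k ∈ A a}ᶜ ∪ {_a | k ≤ n})) ∪
      ((⋂ b, ⋃ k, ({a | k ∈ A a} ∩ {_a | b < k})) ∩ {_a | n = 0}) ∪
      ((⋂ k, {a | k ∈ A a}ᶜ) ∩ {_a | n = 0}) := by
    ext a
    simp only [Set.mem_preimage, Set.mem_singleton_iff, Set.mem_union, Set.mem_inter_iff,
      Set.mem_ofPred_eq, Set.mem_iInter, Set.mem_iUnion, Set.mem_compl_iff]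
    by_cases hb : BddAbove (A a)
    · rcases (A a).eq_empty_or_nonempty with he | hne
      · simp [he, eq_comm]
      · constructor
        · rintro rfl
          refine Or.inl (Or.inl ⟨Nat.sSup_mem hne hb, fun k => ?_⟩)
          by_cases hk : k ∈ A a
          · exact Or.inr (le_csSup hb hk)
          · exact Or.inl hk
        · rintro ((⟨h1, h2⟩ | ⟨h1, -⟩) | ⟨h1, -⟩)
          · refine IsGreatest.csSup_eq ⟨h1, fun k hk => ?_⟩
            exact (h2 k).resolve_left (fun h => h hk)
          · obtain ⟨b, hb⟩ := hb
            obtain ⟨k, hk, hbk⟩ := h1 b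
            exact absurd (hb hk) (not_le.mpr hbk)
          · obtain ⟨k, hk⟩ := hne
            exact absurd hk (h1 k)
    · have h0 : sSup (A a) = 0 := Nat.sSup_of_not_bddAbove hb
      have hun : ∀ b, ∃ k, k ∈ A a ∧ b < k := by
        intro b
        by_contra hcon
        push Not at hcon
        exact hb ⟨b, fun k hk => hcon k hk⟩
      constructor
      · intro h
        exact Or.inl (Or.inr ⟨hun, by omega⟩)
      · rintro ((⟨h1, h2⟩ | ⟨-, h1⟩) | ⟨-, h1⟩)
        · obtain ⟨k, hk, hnk⟩ := hun n
          exact absurd ((h2 k).resolve_left (fun h => h hk)) (not_le.mpr hnk)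
        · omega
        · omega
  rw [key]
  refine ((?_ : MeasurableSet _).union ?_).union ?_
  · exact (hA n).inter (MeasurableSet.iInter fun k => (hA k).compl.union (MeasurableSet.const _))
  · exact (MeasurableSet.iInter fun b => MeasurableSet.iUnion fun k =>
      (hA k).inter (MeasurableSet.const _)).inter (MeasurableSet.const _)
  · exact (MeasurableSet.iInter fun k => (hA k).compl).inter (MeasurableSet.const _)

lemma measurable_apply_nat {α β : Type*} [MeasurableSpace α] [MeasurableSpace β]
    {f : ℕ → α → β} (hf : ∀ n, Measurable (f n)) {g : α → ℕ} (hg : Measurable g) :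
    Measurable fun a => f (g a) a := by
  have h : Measurable fun q : α × ℕ => f q.2 q.1 := measurable_from_prod_countable_left hf
  exact h.comp (measurable_id.prodMk hg)

lemma measurable_N (m : ℕ) : Measurable fun q : ℝ × Ω => D.N m q.1 q.2 := by
  refine measurable_sSup_nat _ fun n => ?_
  refine measurableSet_le ?_ measurable_fst
  exact Finset.measurable_sum _ fun k _ => (D.measurable_noise _).comp measurable_snd

lemma measurable_N_comp (m : ℕ) {u : Ω → ℝ} (hu : Measurable u) :
    Measurable fun ω => D.N m (u ω) ω :=
  (D.measurable_N m).comp (hu.prodMk measurable_id)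

lemma measurable_xi (m : ℕ) (t : ℝ) : Measurable (D.xi m t) := by
  have h : Measurable fun q : Ω × ℝ =>
      ENNReal.ofReal ((σ (eps i₀ m)).mu (D.N m q.2 q.1)) :=
    ENNReal.measurable_ofReal.comp
      (Measurable.of_discrete.comp ((D.measurable_N m).comp measurable_swap))
  exact h.lintegral_prod_right'

lemma measurable_hold (m : ℕ) : Measurable (D.hold m) := by
  refine measurable_of_Iio fun b => ?_
  have key : D.hold m ⁻¹' Set.Iio b =
      ⋃ q : ℚ, ({ω | ENNReal.ofReal (D.noise (.clock m) ω) ≤ D.xi m ((q : ℝ).toNNReal) ω} ∩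
        {_ω | (((q : ℝ).toNNReal : ℝ≥0) : ℝ≥0∞) < b}) := by
    ext ω
    simp only [hold, Set.mem_preimage, Set.mem_Iio, Set.mem_iUnion, Set.mem_inter_iff,
      Set.mem_ofPred_eq, iInf_lt_iff]
    constructor
    · rintro ⟨t, ht, htb⟩
      obtain ⟨c, hc1, hc2⟩ := ENNReal.lt_iff_exists_nnreal_btwn.1 htb
      have hc1' : (t : ℝ) < c := by exact_mod_cast hc1
      obtain ⟨q, hq1, hq2⟩ := exists_rat_btwn hc1'
      have hq0 : (0 : ℝ) ≤ q := t.2.trans hq1.le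
      refine ⟨q, ht.trans ?_, lt_of_le_of_lt ?_ hc2⟩
      · refine lintegral_mono_set (Set.Ioc_subset_Ioc le_rfl ?_)
        rw [Real.coe_toNNReal _ hq0]
        exact hq1.le
      · have : (q : ℝ).toNNReal ≤ c := Real.toNNReal_le_iff_le_coe.2 hq2.le
        exact_mod_cast this
    · rintro ⟨q, hq, hqb⟩
      exact ⟨_, hq, hqb⟩
  rw [key]
  refine MeasurableSet.iUnion fun q => MeasurableSet.inter ?_ (MeasurableSet.const _)
  exact measurableSet_le (ENNReal.measurable_ofReal.comp (D.measurable_noise _))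
    (D.measurable_xi m _)

lemma measurable_switchTime (m : ℕ) : Measurable (D.switchTime m) :=
  Finset.measurable_sum _ fun k _ => D.measurable_hold k

lemma measurable_M (t : ℝ≥0) : Measurable (D.M t) :=
  measurable_sSup_nat _ fun m => measurableSet_le (D.measurable_switchTime m) measurable_const

lemma measurable_elapsed (t : ℝ≥0) : Measurable (D.elapsed t) :=
  measurable_const.sub
    (measurable_apply_nat (fun m => D.measurable_switchTime m) (D.measurable_M t)).ennreal_toReal

lemma measurable_l_comp (m : ℕ) {u : Ω → ℝ} (hu : Measurable u) :
    Measurable fun ω => D.l m (u ω) ω := by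
  have hc : Measurable fun q : Ω × ℝ => (σ (eps i₀ m)).c (D.N m q.2 q.1) :=
    Measurable.of_discrete.comp ((D.measurable_N m).comp measurable_swap)
  have aux : ∀ a b : Ω → ℝ, Measurable a → Measurable b →
      Measurable fun ω => ∫ s in Set.Ioc (a ω) (b ω), (σ (eps i₀ m)).c (D.N m s ω) := by
    intro a b ha hb
    have hS : MeasurableSet {q : Ω × ℝ | q.2 ∈ Set.Ioc (a q.1) (b q.1)} :=
      (measurableSet_lt (ha.comp measurable_fst) measurable_snd).inter
        (measurableSet_le measurable_snd (hb.comp measurable_fst))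
    have h := ((hc.indicator hS).stronglyMeasurable.integral_prod_right'
      (ν := (volume : Measure ℝ))).measurable
    convert h using 2 with ω
    rw [← integral_indicator measurableSet_Ioc]
    rfl
  exact (aux _ _ measurable_const hu).sub (aux _ _ hu measurable_const)

lemma measurable_jump_comp (m : ℕ) {u : Ω → ℝ} (hu : Measurable u) :
    Measurable fun ω => D.jump m (u ω) ω :=
  measurable_apply_nat
    (f := fun k ω => ∑ n ∈ Finset.range k, D.noise (.inner m n) ω)
    (fun _ => Finset.measurable_sum _ fun _ _ => D.measurable_noise _)
    (D.measurable_N_comp m hu)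

lemma measurable_LL (t : ℝ≥0) : Measurable (D.LL t) := by
  refine Measurable.add ?_ ?_
  · exact measurable_apply_nat
      (f := fun k ω => ∑ m ∈ Finset.range k, D.l m (D.hold m ω).toReal ω)
      (fun _ => Finset.measurable_sum _ fun m _ =>
        D.measurable_l_comp m (D.measurable_hold m).ennreal_toReal)
      (D.measurable_M t)
  · exact measurable_apply_nat (f := fun k ω => D.l k (D.elapsed t ω) ω)
      (fun k => D.measurable_l_comp k (D.measurable_elapsed t)) (D.measurable_M t)

lemma measurable_JJ (t : ℝ≥0) : Measurable (D.JJ t) := by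
  refine Measurable.add ?_ ?_
  · refine measurable_apply_nat
      (f := fun k ω => ∑ m ∈ Finset.range k,
        (D.noise (.outer m (D.N m (D.hold m ω).toReal ω)) ω + D.jump m (D.hold m ω).toReal ω))
      (fun _ => Finset.measurable_sum _ fun m _ => Measurable.add ?_ ?_) (D.measurable_M t)
    · exact measurable_apply_nat (f := fun n ω => D.noise (.outer m n) ω)
        (fun _ => D.measurable_noise _)
        (D.measurable_N_comp m (D.measurable_hold m).ennreal_toReal)
    · exact D.measurable_jump_comp m (D.measurable_hold m).ennreal_toReal
  · exact measurable_apply_nat (f := fun k ω => D.jump k (D.elapsed t ω) ω)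
      (fun k => D.measurable_jump_comp k (D.measurable_elapsed t)) (D.measurable_M t)

lemma measurable_obs (t : ℝ≥0) : Measurable (D.obs t) := by
  refine (D.measurable_M t).prodMk (Measurable.prodMk ?_ ?_)
  · exact measurable_apply_nat (f := fun k ω => D.N k (D.elapsed t ω) ω)
      (fun k => D.measurable_N_comp k (D.measurable_elapsed t)) (D.measurable_M t)
  · exact (D.measurable_LL t).add (D.measurable_JJ t)

/-- The filtration generated by the pattern switchings, the shocks and the process `X`. -/
def filtration : Filtration ℝ≥0 (inferInstance : MeasurableSpace Ω) :=
  Filtration.natural (fun t => D.obs t) fun t => (D.measurable_obs t).stronglyMeasurable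

end Driving

end

end PiecewiseLinear

/-! Call a pair (m, n), period m after n shocks, a state. Off a null set (`Good`: no ties, no
explosion) X(t) is a finite sum of contributions `inc m n t` of states (`Good.X_eq_sum`). Each
consists of c(n) times the occupation time `dur m n t`, plus r or R once the sojourn has been ended
by a shock or by a switching.

An exponential time is compensated by its rate times the time spent waiting, and the amplitudes are
independent of when the jumps occur. Hence the increment of `inc` over [s, t], integrated over an
event that depends only on the sources preceding the state, equals Δ(n) times the integrated
increment of `dur`. While (m, n) has not been left, all observations are functions of those sources,
and once it has been left both increments vanish. So the identity holds on every event of the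
filtration at time s (`setIntegral_inc_sub`).

Sufficiency: if Δ = 0, every contribution has zero mean increment, and summing over states needs
only summability of E|inc|. This expectation is at most the total rate of the state times E dur.
Discounting by exp(-θt) bounds E dur by a product weight in n and a geometric factor in m
(`integral_dur_le`), and for large θ the weight is dominated by Λ_n |κ_{n,0}| (`weight_le`), so (C)
applies.

Necessity: stop the martingale when the state occupied at time s is left. Up to that moment only
this state contributes, so its mean increment on the event that it is occupied at s is zero
(`setIntegral_stateSet_inc_sub`). By the compensator identity this mean is Δ(n) times an occupation
time, which is positive as soon as the state is occupied at s with positive probability. Every state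
is so occupied at some time. Uniform integrability comes from the martingale itself, so (C) plays no
role here. -/

namespace PiecewiseLinear

noncomputable section

namespace Driving

variable {Ω : Type*} [MeasurableSpace Ω] {P : Measure Ω} {σ : Bool → Pattern} {i₀ : Bool}
variable (D : Driving P σ i₀)

/-! ### States, their sojourns, and their contributions to X. -/

/-- The pattern in force during the period `m`. -/
abbrev pat (_D : Driving P σ i₀) (m : ℕ) : Pattern := σ (eps i₀ m)

/-- The time of the `n`-th shock, measured from the beginning of the period `m`, provided that the
pattern is not switched before. -/
def shockTime (m n : ℕ) (ω : Ω) : ℝ := ∑ k ∈ Finset.range n, D.noise (.shock m k) ω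

/-- The intensity accumulated in the period `m` up to the `n`-th shock. -/
def expo (m n : ℕ) (ω : Ω) : ℝ :=
  ∑ k ∈ Finset.range n, (D.pat m).mu k * D.noise (.shock m k) ω

/-- The time at which the state `(m, n)` is entered, if it is ever entered. -/
def entry (m n : ℕ) (ω : Ω) : ℝ≥0∞ := D.switchTime m ω + ENNReal.ofReal (D.shockTime m n ω)

/-- The time elapsed since the entrance to the state `(m, n)`. -/
def age (m n : ℕ) (t : ℝ≥0) (ω : Ω) : ℝ := ((t : ℝ≥0∞) - D.entry m n ω).toReal

/-- The time which remains until the switching, at the moment of entrance to `(m, n)`, when no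
other shock occurs. It is negative if the state is never entered. -/
def zeta (m n : ℕ) (ω : Ω) : ℝ := (D.noise (.clock m) ω - D.expo m n ω) / (D.pat m).mu n

/-- The time spent in the state `(m, n)`. -/
def soj (m n : ℕ) (ω : Ω) : ℝ := min (D.noise (.shock m n) ω) (max 0 (D.zeta m n ω))

open Classical in
/-- The contribution of the state `(m, n)` to `X` at the moment when `a` units of time elapsed
since the entrance to the state. -/
def contrib (m n : ℕ) (a : ℝ) (ω : Ω) : ℝ :=
  (D.pat m).c n * min a (D.soj m n ω) +
  D.noise (.inner m n) ω *
    (if D.noise (.shock m n) ω ≤ min a (max 0 (D.zeta m n ω)) then 1 else 0) +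
  D.noise (.outer m n) ω *
    (if 0 < D.zeta m n ω ∧ D.zeta m n ω ≤ min a (D.noise (.shock m n) ω) then 1 else 0)

/-- The contribution of the state `(m, n)` to `X t`. -/
def inc (m n : ℕ) (t : ℝ≥0) (ω : Ω) : ℝ := D.contrib m n (D.age m n t ω) ω

/-- The time spent in the state `(m, n)` up to `t`. -/
def dur (m n : ℕ) (t : ℝ≥0) (ω : Ω) : ℝ := min (D.age m n t ω) (D.soj m n ω)

/-- The paths without ties and explosions. -/
structure Good (ω : Ω) : Prop where
  shock_pos : ∀ m k, 0 < D.noise (.shock m k) ω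
  clock_pos : ∀ m, 0 < D.noise (.clock m) ω
  no_tie : ∀ m n, D.noise (.clock m) ω ≠ D.expo m n ω
  shock_unbounded : ∀ m (C : ℝ), ∃ n, C < D.shockTime m n ω
  switch_unbounded : ∀ C : ℝ≥0, ∃ m, (C : ℝ≥0∞) < D.switchTime m ω

/-! ### One period -/

@[simp] lemma shockTime_zero (m : ℕ) (ω : Ω) : D.shockTime m 0 ω = 0 := by simp [shockTime]

@[simp] lemma expo_zero (m : ℕ) (ω : Ω) : D.expo m 0 ω = 0 := by simp [expo]

lemma shockTime_succ (m n : ℕ) (ω : Ω) :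
    D.shockTime m (n + 1) ω = D.shockTime m n ω + D.noise (.shock m n) ω :=
  Finset.sum_range_succ _ _

lemma expo_succ (m n : ℕ) (ω : Ω) :
    D.expo m (n + 1) ω = D.expo m n ω + (D.pat m).mu n * D.noise (.shock m n) ω :=
  Finset.sum_range_succ _ _

variable {D} {m : ℕ} {ω : Ω}

lemma shockTime_mono (h : ∀ k, 0 ≤ D.noise (.shock m k) ω) :
    Monotone fun n => D.shockTime m n ω :=
  monotone_nat_of_le_succ fun n => by rw [shockTime_succ]; linarith [h n]

lemma shockTime_nonneg (h : ∀ k, 0 ≤ D.noise (.shock m k) ω) (n : ℕ) :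
    0 ≤ D.shockTime m n ω := Finset.sum_nonneg fun k _ => h k

lemma expo_mono (hσ : ∀ i, (σ i).Admissible) (h : ∀ k, 0 ≤ D.noise (.shock m k) ω) :
    Monotone fun n => D.expo m n ω :=
  monotone_nat_of_le_succ fun n => by
    rw [expo_succ]
    linarith [mul_nonneg ((hσ (eps i₀ m)).mu_pos n).le (h n)]

lemma expo_nonneg (hσ : ∀ i, (σ i).Admissible) (h : ∀ k, 0 ≤ D.noise (.shock m k) ω) (n : ℕ) :
    0 ≤ D.expo m n ω :=
  Finset.sum_nonneg fun k _ => mul_nonneg ((hσ (eps i₀ m)).mu_pos k).le (h k)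

lemma N_eq (h : ∀ k, 0 ≤ D.noise (.shock m k) ω) {n : ℕ} {v : ℝ}
    (h1 : D.shockTime m n ω ≤ v) (h2 : v < D.shockTime m (n + 1) ω) : D.N m v ω = n := by
  refine IsGreatest.csSup_eq ⟨h1, fun k hk => ?_⟩
  by_contra hcon
  exact absurd (hk : D.shockTime m k ω ≤ v)
    (not_le.2 (h2.trans_le (shockTime_mono h (by omega : n + 1 ≤ k))))

lemma exists_shock_interval (hu : ∀ C : ℝ, ∃ n, C < D.shockTime m n ω) {v : ℝ} (hv : 0 ≤ v) :
    ∃ n, D.shockTime m n ω ≤ v ∧ v < D.shockTime m (n + 1) ω := by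
  classical
  have hne : Nat.find (hu v) ≠ 0 := by
    intro h0
    have := Nat.find_spec (hu v)
    rw [h0, shockTime_zero] at this
    linarith
  obtain ⟨k, hk⟩ := Nat.exists_eq_succ_of_ne_zero hne
  refine ⟨k, not_lt.1 (Nat.find_min (hu v) (by omega)), ?_⟩
  have := Nat.find_spec (hu v)
  rwa [hk] at this

lemma integral_N_piece (h : ∀ k, 0 ≤ D.noise (.shock m k) ω) (f : ℕ → ℝ) {n : ℕ} {v : ℝ}
    (h1 : D.shockTime m n ω ≤ v) (h2 : v ≤ D.shockTime m (n + 1) ω) :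
    IntervalIntegrable (fun s => f (D.N m s ω)) volume (D.shockTime m n ω) v ∧
    ∫ s in (D.shockTime m n ω)..v, f (D.N m s ω) = f n * (v - D.shockTime m n ω) := by
  -- `N` may already have jumped at the right endpoint, which is a null set; hence the passage to
  -- the open interval.
  have hae : ∀ᵐ s ∂volume.restrict (Set.Ioc (D.shockTime m n ω) v), f n = f (D.N m s ω) := by
    rw [← restrict_Ioo_eq_restrict_Ioc]
    filter_upwards [ae_restrict_mem measurableSet_Ioo] with s hs
    rw [N_eq h hs.1.le (hs.2.trans_le h2)]
  constructor
  · rw [intervalIntegrable_iff_integrableOn_Ioc_of_le h1]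
    exact (integrableOn_const (by simp)).congr hae
  · rw [intervalIntegral.integral_of_le h1, ← integral_congr_ae hae,
      ← intervalIntegral.integral_of_le h1, intervalIntegral.integral_const, smul_eq_mul, mul_comm]

lemma integral_N_shockTime (h : ∀ k, 0 ≤ D.noise (.shock m k) ω) (f : ℕ → ℝ) (n : ℕ) :
    IntervalIntegrable (fun s => f (D.N m s ω)) volume 0 (D.shockTime m n ω) ∧
    ∫ s in 0..(D.shockTime m n ω), f (D.N m s ω) =
      ∑ k ∈ Finset.range n, f k * D.noise (.shock m k) ω := by
  induction n with
  | zero => simp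
  | succ n ih =>
    have hp := integral_N_piece h f (shockTime_mono h (Nat.le_succ n)) le_rfl
    refine ⟨ih.1.trans hp.1, ?_⟩
    rw [← intervalIntegral.integral_add_adjacent_intervals ih.1 hp.1, ih.2, hp.2,
      Finset.sum_range_succ]
    congr 1
    simp only [Nat.succ_eq_add_one, shockTime_succ]
    ring

lemma integral_N (h : ∀ k, 0 ≤ D.noise (.shock m k) ω) (f : ℕ → ℝ) {n : ℕ} {v : ℝ}
    (h1 : D.shockTime m n ω ≤ v) (h2 : v ≤ D.shockTime m (n + 1) ω) :
    IntervalIntegrable (fun s => f (D.N m s ω)) volume 0 v ∧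
    ∫ s in 0..v, f (D.N m s ω) =
      ∑ k ∈ Finset.range n, f k * D.noise (.shock m k) ω + f n * (v - D.shockTime m n ω) := by
  have hi := integral_N_shockTime h f n
  have hp := integral_N_piece h f h1 h2
  exact ⟨hi.1.trans hp.1, by
    rw [← intervalIntegral.integral_add_adjacent_intervals hi.1 hp.1, hi.2, hp.2]⟩

/-- The intensity is a positive step function of time, so its integral is piecewise linear. This
turns every comparison of `xi` with the clock into a comparison of real numbers. -/
lemma xi_eq (hσ : ∀ i, (σ i).Admissible) (h : ∀ k, 0 ≤ D.noise (.shock m k) ω) {n : ℕ} {v : ℝ}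
    (h1 : D.shockTime m n ω ≤ v) (h2 : v ≤ D.shockTime m (n + 1) ω) :
    D.xi m v ω =
      ENNReal.ofReal (D.expo m n ω + (D.pat m).mu n * (v - D.shockTime m n ω)) := by
  have hv : 0 ≤ v := (shockTime_nonneg h n).trans h1
  have hi := integral_N h (D.pat m).mu h1 h2
  rw [xi, expo, ← hi.2, intervalIntegral.integral_of_le hv, ofReal_integral_eq_lintegral_ofReal]
  · exact (intervalIntegrable_iff_integrableOn_Ioc_of_le hv).1 hi.1
  · exact Filter.Eventually.of_forall fun s => ((hσ _).mu_pos _).le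

lemma xi_mono (D : Driving P σ i₀) (m : ℕ) (ω : Ω) : Monotone fun v => D.xi m v ω :=
  fun _ _ h => lintegral_mono_set (Set.Ioc_subset_Ioc le_rfl h)

lemma zeta_pos_iff (hσ : ∀ i, (σ i).Admissible) {n : ℕ} :
    0 < D.zeta m n ω ↔ D.expo m n ω < D.noise (.clock m) ω := by
  rw [zeta, div_pos_iff_of_pos_right ((hσ _).mu_pos n), sub_pos]

lemma lt_zeta_iff (hσ : ∀ i, (σ i).Admissible) {n : ℕ} {a : ℝ} :
    a < D.zeta m n ω ↔ D.expo m n ω + (D.pat m).mu n * a < D.noise (.clock m) ω := by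
  rw [zeta, lt_div_iff₀ ((hσ _).mu_pos n), lt_sub_iff_add_lt', mul_comm]

lemma lt_soj_iff {n : ℕ} {a : ℝ} (ha : 0 ≤ a) :
    a < D.soj m n ω ↔ a < D.noise (.shock m n) ω ∧ a < D.zeta m n ω := by
  rw [soj, lt_min_iff, lt_max_iff, or_iff_right (not_lt.2 ha)]

lemma soj_nonneg (h : ∀ k, 0 ≤ D.noise (.shock m k) ω) (n : ℕ) : 0 ≤ D.soj m n ω :=
  le_min (h n) (le_max_left _ _)

/-- The switching does not occur before the end of the sojourn in a state that is entered. -/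
lemma le_hold (hσ : ∀ i, (σ i).Admissible) (h : ∀ k, 0 ≤ D.noise (.shock m k) ω) {n : ℕ}
    (hn : 0 < D.soj m n ω) :
    ENNReal.ofReal (D.shockTime m n ω + D.soj m n ω) ≤ D.hold m ω := by
  refine le_iInf₂ fun t ht => ?_
  rw [ENNReal.ofReal_le_coe]
  by_contra! hlt
  -- Raising t to the entrance moment moves it into the n-th interval, where `xi` is explicit,
  -- without reaching the end of the sojourn.
  set u := max (t : ℝ) (D.shockTime m n ω) with hu
  have hu2 : u - D.shockTime m n ω < D.soj m n ω := by
    rw [sub_lt_iff_lt_add']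
    exact max_lt hlt (by linarith)
  have hu0 : 0 ≤ u - D.shockTime m n ω := sub_nonneg.2 (le_max_right _ _)
  obtain ⟨h3, h4⟩ := (lt_soj_iff hu0).1 hu2
  rw [lt_zeta_iff hσ] at h4
  have hx := xi_eq hσ h (sub_nonneg.1 hu0)
    (by rw [shockTime_succ]; linarith : u ≤ D.shockTime m (n + 1) ω)
  have hle : ENNReal.ofReal (D.noise (.clock m) ω) ≤ D.xi m u ω :=
    ht.trans (xi_mono D m ω (le_max_left _ _))
  rw [hx, ENNReal.ofReal_le_ofReal_iff] at hle
  · linarith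
  · exact add_nonneg (expo_nonneg hσ h n) (mul_nonneg ((hσ _).mu_pos n).le hu0)

/-- At age `zeta` the accumulated intensity equals the clock exactly, which gives the upper bound;
the lower bound is `le_hold`. -/
lemma hold_eq (hσ : ∀ i, (σ i).Admissible) (h : ∀ k, 0 ≤ D.noise (.shock m k) ω) {n : ℕ}
    (h1 : 0 < D.zeta m n ω) (h2 : D.zeta m n ω ≤ D.noise (.shock m n) ω) :
    D.hold m ω = ENNReal.ofReal (D.shockTime m n ω + D.zeta m n ω) := by
  have hs : D.soj m n ω = D.zeta m n ω := by rw [soj, max_eq_right h1.le, min_eq_right h2]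
  refine le_antisymm ?_ (by simpa only [hs] using le_hold hσ h (n := n) (hs ▸ h1))
  have h0 : 0 ≤ D.shockTime m n ω + D.zeta m n ω := add_nonneg (shockTime_nonneg h n) h1.le
  refine iInf₂_le (D.shockTime m n ω + D.zeta m n ω).toNNReal ?_ |>.trans (le_of_eq rfl)
  rw [Real.coe_toNNReal _ h0, xi_eq hσ h (n := n) (by linarith) (by rw [shockTime_succ]; linarith),
    add_sub_cancel_left, zeta, mul_div_cancel₀ _ ((hσ _).mu_pos n).ne', add_sub_cancel]

/-- Positivity of `zeta` encodes that a state is entered within its period. The next state is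
entered exactly when the shock strictly precedes the switching. -/
lemma zeta_succ_pos_iff (hσ : ∀ i, (σ i).Admissible) {n : ℕ} :
    0 < D.zeta m (n + 1) ω ↔ D.noise (.shock m n) ω < D.zeta m n ω := by
  rw [zeta_pos_iff hσ, lt_zeta_iff hσ, expo_succ]

/-- This lemma and the next three evaluate the contribution in the four possible phases: sojourn in
progress, state never entered, sojourn ended by a shock, sojourn ended by a switching. -/
lemma contrib_of_lt_soj {n : ℕ} {a : ℝ} (ha : 0 ≤ a) (h : a < D.soj m n ω) :
    D.contrib m n a ω = (D.pat m).c n * a := by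
  obtain ⟨h1, h2⟩ := (lt_soj_iff ha).1 h
  have h3 : ¬ D.noise (.shock m n) ω ≤ min a (max 0 (D.zeta m n ω)) := fun hc =>
    absurd (hc.trans (min_le_left _ _)) (not_le.2 h1)
  have h4 : ¬ (0 < D.zeta m n ω ∧ D.zeta m n ω ≤ min a (D.noise (.shock m n) ω)) := fun hc =>
    absurd (hc.2.trans (min_le_left _ _)) (not_le.2 h2)
  rw [contrib, if_neg h3, if_neg h4, min_eq_left h.le]
  ring

lemma contrib_of_not_entered {n : ℕ} {a : ℝ} (ha : 0 ≤ a) (h0 : 0 < D.noise (.shock m n) ω)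
    (h : D.zeta m n ω ≤ 0) : D.contrib m n a ω = 0 := by
  simp [contrib, soj, max_eq_left h, min_eq_right ha, min_eq_right h0.le, not_le.2 h0, not_lt.2 h]

lemma contrib_of_shock {n : ℕ} {a : ℝ}
    (h : D.noise (.shock m n) ω < D.zeta m n ω) (ha : D.noise (.shock m n) ω ≤ a) :
    D.contrib m n a ω =
      (D.pat m).c n * D.noise (.shock m n) ω + D.noise (.inner m n) ω := by
  have h1 : D.noise (.shock m n) ω ≤ max 0 (D.zeta m n ω) := h.le.trans (le_max_right _ _)
  have h4 : ¬ (0 < D.zeta m n ω ∧ D.zeta m n ω ≤ min a (D.noise (.shock m n) ω)) := fun hc =>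
    absurd (hc.2.trans (min_le_right _ _)) (not_le.2 h)
  rw [contrib, if_pos (le_min ha h1), if_neg h4, soj, min_eq_left h1, min_eq_right ha]
  ring

lemma contrib_of_switch {n : ℕ} {a : ℝ} (h0 : 0 < D.zeta m n ω)
    (h : D.zeta m n ω < D.noise (.shock m n) ω) (ha : D.zeta m n ω ≤ a) :
    D.contrib m n a ω = (D.pat m).c n * D.zeta m n ω + D.noise (.outer m n) ω := by
  have h3 : ¬ D.noise (.shock m n) ω ≤ min a (max 0 (D.zeta m n ω)) := fun hc =>
    absurd (hc.trans (min_le_right _ _)) (by rw [max_eq_right h0.le]; exact not_le.2 h)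
  rw [contrib, if_neg h3, if_pos ⟨h0, le_min ha h.le⟩, soj, max_eq_right h0.le, min_eq_right h.le,
    min_eq_right ha]
  ring

/-- From the end of the sojourn on the contribution is constant. -/
lemma contrib_of_soj_le {n : ℕ} {a b : ℝ}
    (ha : D.soj m n ω ≤ a) (hab : a ≤ b) : D.contrib m n b ω = D.contrib m n a ω := by
  have e1 : (D.noise (.shock m n) ω ≤ min b (max 0 (D.zeta m n ω))) =
      (D.noise (.shock m n) ω ≤ min a (max 0 (D.zeta m n ω))) := by
    refine propext ⟨fun h => ?_, fun h => h.trans (min_le_min_right _ hab)⟩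
    have h2 := h.trans (min_le_right _ _)
    rw [soj, min_eq_left h2] at ha
    exact le_min ha h2
  have e2 : (0 < D.zeta m n ω ∧ D.zeta m n ω ≤ min b (D.noise (.shock m n) ω)) =
      (0 < D.zeta m n ω ∧ D.zeta m n ω ≤ min a (D.noise (.shock m n) ω)) := by
    refine propext ⟨fun h => ⟨h.1, ?_⟩, fun h => ⟨h.1, h.2.trans (min_le_min_right _ hab)⟩⟩
    have h2 := h.2.trans (min_le_right _ _)
    rw [soj, max_eq_right h.1.le, min_eq_right h2] at ha
    exact le_min ha h2
  simp only [contrib, e1, e2, min_eq_right ha, min_eq_right (ha.trans hab)]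

lemma contrib_zero {n : ℕ} (h0 : 0 < D.noise (.shock m n) ω) : D.contrib m n 0 ω = 0 := by
  rcases le_or_gt (D.zeta m n ω) 0 with h | h
  · exact contrib_of_not_entered le_rfl h0 h
  · rw [contrib_of_lt_soj le_rfl ((lt_soj_iff le_rfl).2 ⟨h0, h⟩), mul_zero]

lemma not_le_hold_of_xi {v : ℝ} (hv : 0 ≤ v) (h : ENNReal.ofReal v < D.hold m ω) :
    D.xi m v ω < ENNReal.ofReal (D.noise (.clock m) ω) := by
  by_contra! hcon
  refine absurd h (not_lt.2 (iInf₂_le v.toNNReal ?_))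
  rwa [Real.coe_toNNReal _ hv]

namespace Good

/-- A simultaneous shock and switching would make the clock equal to `expo m (n + 1)`, which
`no_tie` excludes. -/
lemma zeta_ne (hσ : ∀ i, (σ i).Admissible) (g : D.Good ω) (m n : ℕ) :
    D.zeta m n ω ≠ D.noise (.shock m n) ω := by
  intro h
  rw [zeta, div_eq_iff ((hσ _).mu_pos n).ne'] at h
  refine g.no_tie m (n + 1) ?_
  rw [expo_succ]
  linarith

/-- `expo` is monotone in the number of shocks, so if the n-th state is entered, each earlier
sojourn was ended by a shock. -/
lemma zeta_anti_shock (hσ : ∀ i, (σ i).Admissible) (g : D.Good ω) {m n k : ℕ} (hk : k < n)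
    (h : 0 < D.zeta m n ω) : D.noise (.shock m k) ω < D.zeta m k ω := by
  rw [← zeta_succ_pos_iff hσ, zeta_pos_iff hσ]
  exact (expo_mono hσ (fun k => (g.shock_pos m k).le) hk).trans_lt ((zeta_pos_iff hσ).1 h)

/-- Before the switching, the state is `(m, n)` exactly during the sojourn. -/
lemma lt_soj_of_lt_hold (hσ : ∀ i, (σ i).Admissible) (g : D.Good ω) {m n : ℕ} {v : ℝ}
    (h1 : D.shockTime m n ω ≤ v) (h2 : v < D.shockTime m (n + 1) ω)
    (h : ENNReal.ofReal v < D.hold m ω) : v - D.shockTime m n ω < D.soj m n ω := by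
  have hτ : ∀ k, 0 ≤ D.noise (.shock m k) ω := fun k => (g.shock_pos m k).le
  have hx := not_le_hold_of_xi ((shockTime_nonneg hτ n).trans h1) h
  rw [xi_eq hσ hτ h1 h2.le, ENNReal.ofReal_lt_ofReal_iff (g.clock_pos m)] at hx
  rw [shockTime_succ] at h2
  exact (lt_soj_iff (sub_nonneg.2 h1)).2 ⟨by linarith, (lt_zeta_iff hσ).2 hx⟩

/-- The states before the current one ended with shocks, the current one is in progress, and later
ones have age zero. Any cutoff K beyond the shocks so far will do. -/
lemma sum_contrib_before (hσ : ∀ i, (σ i).Admissible) (g : D.Good ω) {m K : ℕ} {v : ℝ}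
    (hv : 0 ≤ v) (h : ENNReal.ofReal v < D.hold m ω)
    (hK : ∀ n, D.shockTime m n ω ≤ v → n < K) :
    ∑ n ∈ Finset.range K, D.contrib m n (max 0 (v - D.shockTime m n ω)) ω =
      D.l m v ω + D.jump m v ω := by
  have hτ : ∀ k, 0 ≤ D.noise (.shock m k) ω := fun k => (g.shock_pos m k).le
  obtain ⟨n, h1, h2⟩ := exists_shock_interval (g.shock_unbounded m) hv
  have hs := g.lt_soj_of_lt_hold hσ h1 h2 h
  have hz := ((lt_soj_iff (sub_nonneg.2 h1)).1 hs).2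
  have hsub : Finset.range (n + 1) ⊆ Finset.range K := Finset.range_mono (hK n h1)
  rw [← Finset.sum_subset hsub, Finset.sum_range_succ, max_eq_right (sub_nonneg.2 h1),
    contrib_of_lt_soj (sub_nonneg.2 h1) hs, l, (integral_N hτ (D.pat m).c h1 h2.le).2, jump,
    N_eq hτ h1 h2, Finset.sum_congr rfl (g := fun k => (D.pat m).c k * D.noise (.shock m k) ω +
      D.noise (.inner m k) ω), Finset.sum_add_distrib]
  · ring
  · intro k hk
    have hk' := Finset.mem_range.1 hk
    refine contrib_of_shock
      (g.zeta_anti_shock hσ hk' ((sub_nonneg.2 h1).trans_lt hz)) (le_max_of_le_right ?_)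
    have := shockTime_mono hτ (Nat.succ_le_of_lt hk')
    simp only [Nat.succ_eq_add_one, shockTime_succ] at this
    linarith
  · intro k _ hk
    have hk' : n + 1 ≤ k := by simpa using hk
    rw [max_eq_left, contrib_zero (g.shock_pos m k)]
    have := shockTime_mono hτ hk'
    simp only at this
    linarith

/-- A finite holding time means that the accumulated intensity reaches the clock. The switching
occurs in the last state whose entrance intensity is still below the clock. -/
lemma exists_switch (hσ : ∀ i, (σ i).Admissible) (g : D.Good ω) {m : ℕ} (h : D.hold m ω ≠ ⊤) :
    ∃ n, 0 < D.zeta m n ω ∧ D.zeta m n ω < D.noise (.shock m n) ω := by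
  classical
  have hτ : ∀ k, 0 ≤ D.noise (.shock m k) ω := fun k => (g.shock_pos m k).le
  have hex : ∃ n, D.noise (.clock m) ω ≤ D.expo m n ω := by
    obtain ⟨t, ht⟩ : ∃ t : ℝ≥0, ENNReal.ofReal (D.noise (.clock m) ω) ≤ D.xi m t ω := by
      by_contra! hcon
      refine h (le_antisymm le_top (le_iInf₂ fun t ht => ?_))
      exact absurd (hcon t) (not_lt.2 ht)
    obtain ⟨n, h1, h2⟩ := exists_shock_interval (v := (t : ℝ)) (g.shock_unbounded m) t.2
    refine ⟨n + 1, ?_⟩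
    rw [xi_eq hσ hτ h1 h2.le, ENNReal.ofReal_le_ofReal_iff] at ht
    · refine ht.trans ?_
      rw [expo_succ]
      have := (hσ (eps i₀ m)).mu_pos n
      rw [shockTime_succ] at h2
      gcongr
      linarith
    · exact add_nonneg (expo_nonneg hσ hτ n)
        (mul_nonneg ((hσ _).mu_pos n).le (sub_nonneg.2 h1))
  have hne : Nat.find hex ≠ 0 := by
    intro h0
    have := Nat.find_spec hex
    rw [h0, expo_zero] at this
    linarith [g.clock_pos m]
  obtain ⟨n, hn⟩ := Nat.exists_eq_succ_of_ne_zero hne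
  refine ⟨n, (zeta_pos_iff hσ).2 (not_le.1 (Nat.find_min hex (by omega))), ?_⟩
  refine lt_of_le_of_ne (not_lt.1 fun hlt => ?_) (g.zeta_ne hσ m n)
  rw [← zeta_succ_pos_iff hσ, zeta_pos_iff hσ] at hlt
  have := Nat.find_spec hex
  rw [hn] at this
  linarith

lemma sum_contrib_after (hσ : ∀ i, (σ i).Admissible) (g : D.Good ω) {m K : ℕ} {v : ℝ}
    (hv : 0 ≤ v) (h : D.hold m ω ≤ ENNReal.ofReal v)
    (hK : ∀ n, D.shockTime m n ω ≤ v → n < K) :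
    ∑ n ∈ Finset.range K, D.contrib m n (max 0 (v - D.shockTime m n ω)) ω =
      D.l m (D.hold m ω).toReal ω +
        (D.noise (.outer m (D.N m (D.hold m ω).toReal ω)) ω + D.jump m (D.hold m ω).toReal ω) := by
  have hτ : ∀ k, 0 ≤ D.noise (.shock m k) ω := fun k => (g.shock_pos m k).le
  obtain ⟨n, h0, hz⟩ := g.exists_switch hσ (h.trans_lt ENNReal.ofReal_lt_top).ne
  have hh := hold_eq hσ hτ h0 hz.le
  have hnn : 0 ≤ D.shockTime m n ω + D.zeta m n ω := add_nonneg (shockTime_nonneg hτ n) h0.le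
  rw [hh, ENNReal.ofReal_le_ofReal_iff hv] at h
  rw [hh, ENNReal.toReal_ofReal hnn]
  have h1 : D.shockTime m n ω ≤ D.shockTime m n ω + D.zeta m n ω := by linarith
  have h2 : D.shockTime m n ω + D.zeta m n ω < D.shockTime m (n + 1) ω := by
    rw [shockTime_succ]; linarith
  have hsub : Finset.range (n + 1) ⊆ Finset.range K := Finset.range_mono (hK n (h1.trans h))
  rw [← Finset.sum_subset hsub, Finset.sum_range_succ, max_eq_right (by linarith),
    contrib_of_switch h0 hz (by linarith), l, (integral_N hτ (D.pat m).c h1 h2.le).2, jump,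
    N_eq hτ h1 h2, Finset.sum_congr rfl (g := fun k => (D.pat m).c k * D.noise (.shock m k) ω +
      D.noise (.inner m k) ω), Finset.sum_add_distrib]
  · ring
  · intro k hk
    have hk' := Finset.mem_range.1 hk
    refine contrib_of_shock (g.zeta_anti_shock hσ hk' h0) (le_max_of_le_right ?_)
    have := shockTime_mono hτ (Nat.succ_le_of_lt hk')
    simp only [Nat.succ_eq_add_one, shockTime_succ] at this
    linarith
  -- Later states may have a positive formal age, since the shocks continue on paper after the
  -- switching, but their `zeta` is not positive and they contribute nothing.
  · intro k _ hk
    have hk' : n + 1 ≤ k := by simpa using hk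
    refine contrib_of_not_entered (le_max_left _ _) (g.shock_pos m k) (not_lt.1 fun hc => ?_)
    exact absurd (g.zeta_anti_shock hσ hk' hc) (not_lt.2 hz.le)

/-! ### All periods -/

end Good

lemma switchTime_succ (D : Driving P σ i₀) (m : ℕ) (ω : Ω) :
    D.switchTime (m + 1) ω = D.switchTime m ω + D.hold m ω := Finset.sum_range_succ _ _

lemma switchTime_mono (D : Driving P σ i₀) (ω : Ω) : Monotone fun m => D.switchTime m ω :=
  monotone_nat_of_le_succ fun m => by rw [switchTime_succ]; exact le_self_add

lemma M_eq {t : ℝ≥0} (h1 : D.switchTime m ω ≤ t) (h2 : (t : ℝ≥0∞) < D.switchTime (m + 1) ω) :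
    D.M t ω = m := by
  refine IsGreatest.csSup_eq ⟨h1, fun k hk => ?_⟩
  by_contra hcon
  exact absurd (hk : D.switchTime k ω ≤ t)
    (not_le.2 (h2.trans_le (switchTime_mono D ω (by omega : m + 1 ≤ k))))

lemma age_nonneg (D : Driving P σ i₀) (m n : ℕ) (t : ℝ≥0) (ω : Ω) : 0 ≤ D.age m n t ω :=
  ENNReal.toReal_nonneg

lemma age_mono (D : Driving P σ i₀) (m n : ℕ) (ω : Ω) : Monotone fun t => D.age m n t ω :=
  fun s t h => ENNReal.toReal_mono (ne_top_of_le_ne_top ENNReal.coe_ne_top tsub_le_self)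
    (tsub_le_tsub_right (by exact_mod_cast h) _)

lemma age_le (D : Driving P σ i₀) (m n : ℕ) (t : ℝ≥0) (ω : Ω) : D.age m n t ω ≤ t :=
  ENNReal.toReal_le_coe_of_le_coe tsub_le_self

lemma age_of_le_entry {n : ℕ} {t : ℝ≥0} (h : (t : ℝ≥0∞) ≤ D.entry m n ω) :
    D.age m n t ω = 0 := by rw [age, tsub_eq_zero_of_le h, ENNReal.toReal_zero]

lemma age_of_switchTime_le (h : ∀ k, 0 ≤ D.noise (.shock m k) ω) {n : ℕ} {t : ℝ≥0}
    (ht : D.switchTime m ω ≤ t) :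
    D.age m n t ω = max 0 ((t : ℝ) - (D.switchTime m ω).toReal - D.shockTime m n ω) := by
  have htop : D.switchTime m ω ≠ ⊤ := ne_top_of_le_ne_top ENNReal.coe_ne_top ht
  obtain ⟨w, hw⟩ : ∃ w : ℝ≥0, (w : ℝ≥0∞) = D.switchTime m ω := ⟨_, ENNReal.coe_toNNReal htop⟩
  rw [age, entry, ← hw, ENNReal.coe_toReal, ← tsub_tsub, ← ENNReal.coe_sub,
    ENNReal.ofReal, ← ENNReal.coe_sub, ENNReal.coe_toReal, NNReal.coe_sub_def,
    NNReal.coe_sub, Real.coe_toNNReal _ (shockTime_nonneg h n), max_comm]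
  rw [← hw] at ht
  exact_mod_cast ht

lemma shockTime_le_of_entry_le {n : ℕ} {t : ℝ≥0} (h : D.entry m n ω ≤ t) :
    D.switchTime m ω ≤ t ∧ D.shockTime m n ω ≤ (t : ℝ) - (D.switchTime m ω).toReal := by
  have h1 : D.switchTime m ω ≤ t := le_self_add.trans h
  refine ⟨h1, ?_⟩
  obtain ⟨w, hw⟩ : ∃ w : ℝ≥0, (w : ℝ≥0∞) = D.switchTime m ω :=
    ⟨_, ENNReal.coe_toNNReal (ne_top_of_le_ne_top ENNReal.coe_ne_top h1)⟩
  rw [entry, ← hw, ENNReal.ofReal, ← ENNReal.coe_add, ENNReal.coe_le_coe] at h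
  have h2 : (w : ℝ) + (D.shockTime m n ω).toNNReal ≤ t := by exact_mod_cast h
  rw [← hw, ENNReal.coe_toReal]
  linarith [Real.le_coe_toNNReal (D.shockTime m n ω)]

lemma entry_le_iff (h : ∀ k, 0 ≤ D.noise (.shock m k) ω) {n : ℕ} {t : ℝ≥0} :
    D.entry m n ω ≤ t ↔ D.switchTime m ω ≤ t ∧
      D.shockTime m n ω ≤ (t : ℝ) - (D.switchTime m ω).toReal := by
  refine ⟨shockTime_le_of_entry_le, fun ⟨h1, h2⟩ => ?_⟩
  obtain ⟨w, hw⟩ : ∃ w : ℝ≥0, (w : ℝ≥0∞) = D.switchTime m ω :=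
    ⟨_, ENNReal.coe_toNNReal (ne_top_of_le_ne_top ENNReal.coe_ne_top h1)⟩
  rw [entry, ← hw, ENNReal.ofReal, ← ENNReal.coe_add, ENNReal.coe_le_coe, ← NNReal.coe_le_coe,
    NNReal.coe_add, Real.coe_toNNReal _ (shockTime_nonneg h n)]
  rw [← hw, ENNReal.coe_toReal] at h2
  linarith

lemma lt_switchTime_succ_iff {t : ℝ≥0} (h : D.switchTime m ω ≤ t) :
    (t : ℝ≥0∞) < D.switchTime (m + 1) ω ↔
      ENNReal.ofReal ((t : ℝ) - (D.switchTime m ω).toReal) < D.hold m ω := by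
  obtain ⟨w, hw⟩ : ∃ w : ℝ≥0, (w : ℝ≥0∞) = D.switchTime m ω :=
    ⟨_, ENNReal.coe_toNNReal (ne_top_of_le_ne_top ENNReal.coe_ne_top h)⟩
  rw [switchTime_succ, ← hw, ENNReal.coe_toReal, ENNReal.ofReal, ← NNReal.sub_def,
    ENNReal.coe_sub, ENNReal.sub_lt_iff_lt_left ENNReal.coe_ne_top (hw ▸ h)]

namespace Good

lemma exists_switch_interval (g : D.Good ω) (t : ℝ≥0) :
    ∃ m, D.switchTime m ω ≤ t ∧ (t : ℝ≥0∞) < D.switchTime (m + 1) ω := by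
  classical
  have hne : Nat.find (g.switch_unbounded t) ≠ 0 := by
    intro h0
    have := Nat.find_spec (g.switch_unbounded t)
    rw [h0, switchTime, Finset.range_zero, Finset.sum_empty] at this
    exact absurd this (by simp)
  obtain ⟨k, hk⟩ := Nat.exists_eq_succ_of_ne_zero hne
  refine ⟨k, not_lt.1 (Nat.find_min (g.switch_unbounded t) (by omega)), ?_⟩
  have := Nat.find_spec (g.switch_unbounded t)
  rwa [hk] at this

/-- The state at the time `u` is `(m, n)` exactly during the sojourn in `(m, n)`. -/
lemma state_eq_iff (hσ : ∀ i, (σ i).Admissible) (g : D.Good ω) {m n : ℕ} {u : ℝ≥0} :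
    (D.M u ω = m ∧ D.N (D.M u ω) (D.elapsed u ω) ω = n) ↔
      D.entry m n ω ≤ u ∧ D.age m n u ω < D.soj m n ω := by
  have hτ : ∀ k, 0 ≤ D.noise (.shock m k) ω := fun k => (g.shock_pos m k).le
  constructor
  · rintro ⟨hm, hn⟩
    obtain ⟨m', h1, h2⟩ := g.exists_switch_interval u
    obtain rfl : m' = m := (M_eq h1 h2).symm.trans hm
    have hv : 0 ≤ (u : ℝ) - (D.switchTime m' ω).toReal :=
      sub_nonneg.2 (ENNReal.toReal_le_coe_of_le_coe h1)
    obtain ⟨n', h3, h4⟩ := exists_shock_interval (g.shock_unbounded m') hv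
    rw [elapsed, hm, N_eq hτ h3 h4] at hn
    subst hn
    rw [age_of_switchTime_le hτ h1, max_eq_right (sub_nonneg.2 h3)]
    exact ⟨(entry_le_iff hτ).2 ⟨h1, h3⟩,
      g.lt_soj_of_lt_hold hσ h3 h4 ((lt_switchTime_succ_iff h1).1 h2)⟩
  · rintro ⟨h1, h2⟩
    obtain ⟨h3, h4⟩ := shockTime_le_of_entry_le h1
    rw [age_of_switchTime_le hτ h3, max_eq_right (sub_nonneg.2 h4)] at h2
    have h5 := (lt_soj_iff (sub_nonneg.2 h4)).1 h2
    have hM : D.M u ω = m := by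
      refine M_eq h3 ((lt_switchTime_succ_iff h3).2 ?_)
      refine lt_of_lt_of_le ?_ (le_hold hσ hτ ((sub_nonneg.2 h4).trans_lt h2))
      have := shockTime_nonneg hτ n
      rw [ENNReal.ofReal_lt_ofReal_iff_of_nonneg (by linarith)]
      linarith
    rw [elapsed, hM]
    exact ⟨rfl, N_eq hτ h4 (by rw [shockTime_succ]; linarith)⟩

/-- Completed periods are handled by `sum_contrib_after`, the current one by `sum_contrib_before`,
and later ones have age zero. Free cutoffs allow one finite sum to serve many times t
simultaneously. -/
lemma X_eq_sum (hσ : ∀ i, (σ i).Admissible) (g : D.Good ω) {t : ℝ≥0} {K₁ K₂ : ℕ}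
    (hK₁ : ∀ m, D.switchTime m ω ≤ t → m < K₁) (hK₂ : ∀ m n, D.entry m n ω ≤ t → n < K₂) :
    D.X t ω = ∑ m ∈ Finset.range K₁, ∑ n ∈ Finset.range K₂, D.inc m n t ω := by
  have hτ : ∀ m k, 0 ≤ D.noise (.shock m k) ω := fun m k => (g.shock_pos m k).le
  obtain ⟨m, h1, h2⟩ := g.exists_switch_interval t
  have hM := M_eq h1 h2
  have hv : ∀ k, D.switchTime k ω ≤ t → 0 ≤ (t : ℝ) - (D.switchTime k ω).toReal := fun k hk =>
    sub_nonneg.2 (ENNReal.toReal_le_coe_of_le_coe hk)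
  have hK : ∀ k, D.switchTime k ω ≤ t →
      ∀ n, D.shockTime k n ω ≤ (t : ℝ) - (D.switchTime k ω).toReal → n < K₂ := fun k hk n hn =>
    hK₂ k n ((entry_le_iff (hτ k)).2 ⟨hk, hn⟩)
  have hinc : ∀ k n, D.switchTime k ω ≤ t → D.inc k n t ω =
      D.contrib k n (max 0 ((t : ℝ) - (D.switchTime k ω).toReal - D.shockTime k n ω)) ω :=
    fun k n hk => by rw [inc, age_of_switchTime_le (hτ k) hk]
  have hsub : Finset.range (m + 1) ⊆ Finset.range K₁ := Finset.range_mono (hK₁ m h1)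
  rw [← Finset.sum_subset hsub, Finset.sum_range_succ, X, LL, JJ, elapsed, hM,
    Finset.sum_congr rfl (fun n _ => hinc m n h1),
    g.sum_contrib_before hσ (hv m h1) ((lt_switchTime_succ_iff h1).1 h2) (hK m h1),
    add_add_add_comm, ← Finset.sum_add_distrib]
  · refine congrArg₂ _ (Finset.sum_congr rfl fun k hk => ?_) rfl
    have hk' : k + 1 ≤ m := Finset.mem_range.1 hk
    have h3 : D.switchTime (k + 1) ω ≤ t := (switchTime_mono D ω hk').trans h1
    have h4 : D.switchTime k ω ≤ t := (switchTime_mono D ω (Nat.le_succ k)).trans h3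
    rw [Finset.sum_congr rfl (fun n _ => hinc k n h4)]
    refine (g.sum_contrib_after hσ (hv k h4)
      (not_lt.1 fun hc => absurd ((lt_switchTime_succ_iff h4).2 hc) (not_lt.2 h3)) (hK k h4)).symm
  · intro k _ hk
    have hk' : m + 1 ≤ k := by simpa using hk
    refine Finset.sum_eq_zero fun n _ => ?_
    rw [inc, age_of_le_entry, contrib_zero (g.shock_pos k n)]
    exact (h2.le.trans (switchTime_mono D ω hk')).trans le_self_add

end Good

end Driving
-- Observations as functions of the past of a state.
/-- The sources which determine the path up to the `n`-th shock of the period `m`. -/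
def past (m n : ℕ) : Set Source
  | .shock m' k => m' < m ∨ m' = m ∧ k < n
  | .clock m' => m' < m
  | .inner m' k => m' < m ∨ m' = m ∧ k < n
  | .outer m' _ => m' < m

section past

variable {m n m' k : ℕ}

lemma shock_mem_past : Source.shock m' k ∈ past m n ↔ m' < m ∨ m' = m ∧ k < n := Iff.rfl
lemma clock_mem_past : Source.clock m' ∈ past m n ↔ m' < m := Iff.rfl
lemma inner_mem_past : Source.inner m' k ∈ past m n ↔ m' < m ∨ m' = m ∧ k < n := Iff.rfl
lemma outer_mem_past : Source.outer m' k ∈ past m n ↔ m' < m := Iff.rfl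

end past

namespace Driving

variable {Ω : Type*} [MeasurableSpace Ω] {P : Measure Ω} {σ : Bool → Pattern} {i₀ : Bool}

section congr

variable {D : Driving P σ i₀} {m n : ℕ} {ω ω' : Ω} (hA : ∀ x ∈ past m n, D.noise x ω = D.noise x ω')
include hA

lemma N_congr {k : ℕ} (hk : k < m) (v : ℝ) : D.N k v ω = D.N k v ω' := by
  simp only [N, fun j => hA (.shock k j) (Or.inl hk)]

lemma hold_congr {k : ℕ} (hk : k < m) : D.hold k ω = D.hold k ω' := by
  simp only [hold, xi, N_congr hA hk, hA (.clock k) hk]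

lemma switchTime_congr {k : ℕ} (hk : k ≤ m) : D.switchTime k ω = D.switchTime k ω' :=
  Finset.sum_congr rfl fun _ hj => hold_congr hA ((Finset.mem_range.1 hj).trans_le hk)

lemma shockTime_congr {k : ℕ} (hk : k ≤ n) : D.shockTime m k ω = D.shockTime m k ω' :=
  Finset.sum_congr rfl fun j hj =>
    hA (.shock m j) (Or.inr ⟨rfl, (Finset.mem_range.1 hj).trans_le hk⟩)

lemma expo_congr {k : ℕ} (hk : k ≤ n) : D.expo m k ω = D.expo m k ω' :=
  Finset.sum_congr rfl fun j hj => by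
    rw [hA (.shock m j) (Or.inr ⟨rfl, (Finset.mem_range.1 hj).trans_le hk⟩)]

lemma entry_congr : D.entry m n ω = D.entry m n ω' := by
  rw [entry, entry, switchTime_congr hA le_rfl, shockTime_congr hA le_rfl]

lemma age_congr (t : ℝ≥0) : D.age m n t ω = D.age m n t ω' := by
  rw [age, age, entry_congr hA]

omit hA in
lemma sub_switchTime_lt (h : ∀ k, 0 ≤ D.noise (.shock m k) ω) {s : ℝ≥0}
    (hs : D.age m n s ω < D.soj m n ω) (hT : D.switchTime m ω ≤ s) :
    (s : ℝ) - (D.switchTime m ω).toReal < D.shockTime m n ω + D.soj m n ω := by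
  rw [age_of_switchTime_le h hT] at hs
  linarith [le_max_right 0 ((s : ℝ) - (D.switchTime m ω).toReal - D.shockTime m n ω)]

omit hA in
lemma lt_switchTime_succ (hσ : ∀ i, (σ i).Admissible) (h : ∀ k, 0 ≤ D.noise (.shock m k) ω)
    {s : ℝ≥0} (hs : D.age m n s ω < D.soj m n ω) :
    (s : ℝ≥0∞) < D.switchTime (m + 1) ω := by
  rcases lt_or_ge (s : ℝ≥0∞) (D.switchTime m ω) with hT | hT
  · exact hT.trans_le (switchTime_mono D ω (Nat.le_succ m))
  rw [lt_switchTime_succ_iff hT]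
  have h1 := (age_nonneg D m n s ω).trans_lt hs
  refine lt_of_lt_of_le ?_ (le_hold hσ h h1)
  rw [ENNReal.ofReal_lt_ofReal_iff (add_pos_of_nonneg_of_pos (shockTime_nonneg h n) h1)]
  exact sub_switchTime_lt h hs hT

/-- As long as the state `(m, n)` is not left, the observations are determined by the past of this
state. -/
lemma obs_congr (hσ : ∀ i, (σ i).Admissible) (h : ∀ k, 0 ≤ D.noise (.shock m k) ω)
    (h' : ∀ k, 0 ≤ D.noise (.shock m k) ω') {s u : ℝ≥0} (hu : u ≤ s)
    (hs : D.age m n s ω < D.soj m n ω) (hs' : D.age m n s ω' < D.soj m n ω') :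
    D.obs u ω = D.obs u ω' := by
  have hus : (u : ℝ≥0∞) ≤ s := by exact_mod_cast hu
  have hbd : ∀ η, (s : ℝ≥0∞) < D.switchTime (m + 1) η → ∀ k, D.switchTime k η ≤ u → k ≤ m := by
    intro η hη k hk
    by_contra! hcon
    exact absurd (hk.trans hus) (not_le.2 (hη.trans_le (switchTime_mono D η hcon)))
  have hb := hbd ω (lt_switchTime_succ hσ h hs)
  have hb' := hbd ω' (lt_switchTime_succ hσ h' hs')
  -- Only indices up to m can belong to the sets that define `M`, and those switching times are
  -- determined by the past.
  have hM : D.M u ω = D.M u ω' := by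
    refine congrArg sSup (Set.ext fun k => ⟨fun hk => ?_, fun hk => ?_⟩)
    · exact (switchTime_congr hA (hb k hk)).symm.trans_le hk
    · exact (switchTime_congr hA (hb' k hk)).trans_le hk
  have hmem : D.switchTime (D.M u ω) ω ≤ u :=
    Nat.sSup_mem (s := {k | D.switchTime k ω ≤ u}) ⟨0, by simp [switchTime]⟩ ⟨m, hb⟩
  have hMm := hb _ hmem
  have hT := switchTime_congr hA hMm
  have hel : D.elapsed u ω = D.elapsed u ω' := by rw [elapsed, elapsed, ← hM, hT]
  -- Either the current period is earlier than m, with all its sources in the past, or it is m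
  -- itself, where at most n shocks have occurred by time u.
  have hNn : ∀ v, v ≤ D.elapsed u ω → D.N (D.M u ω) v ω = D.N (D.M u ω) v ω' ∧
      ∀ j < D.N (D.M u ω) v ω, Source.inner (D.M u ω) j ∈ past m n := by
    intro v hv
    rcases hMm.lt_or_eq with hlt | heq
    · exact ⟨N_congr hA hlt v, fun j _ => Or.inl hlt⟩
    rw [elapsed] at hv
    rw [heq] at hT hmem hv ⊢
    have hb2 : ∀ η, (∀ k, 0 ≤ D.noise (.shock m k) η) → D.age m n s η < D.soj m n η →
        D.switchTime m η = D.switchTime m ω → ∀ k, D.shockTime m k η ≤ v → k ≤ n := by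
      intro η hη hsη hTη k hk
      have h1 := sub_switchTime_lt hη hsη (hTη.trans_le (hmem.trans hus))
      by_contra! hcon
      have h2 := shockTime_mono hη hcon
      simp only [Nat.succ_eq_add_one, shockTime_succ] at h2
      have h3 : D.soj m n η ≤ D.noise (.shock m n) η := min_le_left _ _
      have h4 : (u : ℝ) ≤ s := by exact_mod_cast hu
      rw [hTη] at h1
      linarith
    refine ⟨congrArg sSup (Set.ext fun k => ⟨fun hk => ?_, fun hk => ?_⟩), fun j hj => ?_⟩
    · exact (shockTime_congr hA (hb2 ω h hs rfl k hk)).symm.trans_le hk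
    · exact (shockTime_congr hA (hb2 ω' h' hs' hT.symm k hk)).trans_le hk
    · refine Or.inr ⟨rfl, hj.trans_le ?_⟩
      rw [N]
      -- For negative v no index qualifies and the supremum takes its default value 0.
      rcases Set.eq_empty_or_nonempty {k | D.shockTime m k ω ≤ v} with he | hne
      · change sSup {k | D.shockTime m k ω ≤ v} ≤ n
        rw [he]
        simp
      · exact csSup_le hne (hb2 ω h hs rfl)
  have h0 : 0 ≤ D.elapsed u ω := sub_nonneg.2 (ENNReal.toReal_le_coe_of_le_coe hmem)
  have hl : D.l (D.M u ω) (D.elapsed u ω) ω = D.l (D.M u ω) (D.elapsed u ω) ω' := by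
    refine intervalIntegral.integral_congr fun v hv => ?_
    rw [Set.uIcc_of_le h0] at hv
    simp only [(hNn v hv.2).1]
  have hj : D.jump (D.M u ω) (D.elapsed u ω) ω = D.jump (D.M u ω) (D.elapsed u ω) ω' := by
    obtain ⟨h1, h2⟩ := hNn _ le_rfl
    rw [jump, jump, ← h1]
    exact Finset.sum_congr rfl fun j hj => hA _ (h2 j (Finset.mem_range.1 hj))
  have hLL : D.LL u ω = D.LL u ω' := by
    rw [LL, LL, ← hM, ← hel, hl]
    refine congrArg₂ _ (Finset.sum_congr rfl fun k hk => ?_) rfl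
    have hk' := (Finset.mem_range.1 hk).trans_le hMm
    simp only [hold_congr hA hk', l, N_congr hA hk']
  have hJJ : D.JJ u ω = D.JJ u ω' := by
    rw [JJ, JJ, ← hM, ← hel, hj]
    refine congrArg₂ _ (Finset.sum_congr rfl fun k hk => ?_) rfl
    have hk' := (Finset.mem_range.1 hk).trans_le hMm
    rw [hold_congr hA hk', jump, jump, N_congr hA hk', hA (.outer k _) hk']
    refine congrArg₂ _ rfl (Finset.sum_congr rfl fun j _ => hA _ (Or.inl hk'))
  rw [obs, obs, X, X, hLL, hJJ, (hNn _ le_rfl).1, hM, hel]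

end congr

/-! ### The canonical driving family -/

lemma isProbabilityMeasure_sourceLaw (hσ : ∀ i, (σ i).Admissible) (s : Source) :
    IsProbabilityMeasure (sourceLaw σ i₀ s) := by
  cases s with
  | shock m n => exact isProbabilityMeasure_expMeasure ((hσ _).lam_pos n)
  | clock m => exact isProbabilityMeasure_expMeasure one_pos
  | inner m n => exact (hσ _).rLaw_prob n
  | outer m n => exact (hσ _).RLaw_prob n

/-- The driving family which consists of the coordinates on the space of all sequences. -/
def canonical (hσ : ∀ i, (σ i).Admissible) (i₀ : Bool) :
    Driving (Measure.infinitePi (sourceLaw σ i₀)) σ i₀ where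
  noise s w := w s
  measurable_noise s := measurable_pi_apply s
  law_noise s := by
    have := isProbabilityMeasure_sourceLaw hσ (i₀ := i₀)
    exact Measure.infinitePi_map_eval _ s
  indep_noise := by
    have := isProbabilityMeasure_sourceLaw hσ (i₀ := i₀)
    exact iIndepFun_infinitePi (X := fun s (x : ℝ) => x) fun s => measurable_id

variable (D : Driving P σ i₀)

/-- The σ-algebra generated by a set of sources. -/
@[reducible]
def sigma (T : Set Source) : MeasurableSpace Ω :=
  ⨆ s ∈ T, MeasurableSpace.comap (D.noise s) inferInstance

lemma sigma_mono {S T : Set Source} (h : S ⊆ T) : D.sigma S ≤ D.sigma T := biSup_mono h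

lemma sigma_le (T : Set Source) : D.sigma T ≤ (inferInstance : MeasurableSpace Ω) :=
  iSup₂_le fun s _ => (D.measurable_noise s).comap_le

lemma measurable_sigma_noise {T : Set Source} {s : Source} (hs : s ∈ T) :
    Measurable[D.sigma T] (D.noise s) := by
  rw [measurable_iff_comap_le]
  exact le_iSup₂_of_le s hs le_rfl

open Classical in
/-- The values of the sources from the set `T`, the others being replaced by zero. -/
def trunc (T : Set Source) (ω : Ω) : Source → ℝ := fun s => if s ∈ T then D.noise s ω else 0

lemma measurable_trunc (T : Set Source) : Measurable[D.sigma T] (D.trunc T) := by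
  refine @measurable_pi_lambda _ _ _ (D.sigma T) _ _ fun s => ?_
  by_cases hs : s ∈ T
  · simpa only [trunc, hs, if_true] using D.measurable_sigma_noise hs
  · simpa only [trunc, hs, if_false] using @measurable_const _ _ _ (D.sigma T) _

/-- The switching time is the same functional on the canonical space, evaluated at the coordinates
truncated to the past. Measurability of that functional and of the truncation then suffices. -/
lemma measurable_sigma_switchTime (hσ : ∀ i, (σ i).Admissible) (m n : ℕ) :
    Measurable[D.sigma (past m n)] (D.switchTime m) := by
  have h : D.switchTime m = fun ω => (canonical hσ i₀).switchTime m (D.trunc (past m n) ω) := by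
    funext ω
    exact switchTime_congr (D := canonical hσ i₀) (m := m) (n := n)
      (ω := fun s => D.noise s ω) (fun x hx => (if_pos hx).symm) le_rfl
  rw [h]
  exact ((canonical hσ i₀).measurable_switchTime m).comp (D.measurable_trunc _)

lemma measurable_sigma_shockTime (m n : ℕ) :
    Measurable[D.sigma (past m n)] (D.shockTime m n) := by
  refine @Finset.measurable_fun_sum _ _ _ _ _ _ (D.sigma _) _ _ fun k hk => ?_
  exact D.measurable_sigma_noise (Or.inr ⟨rfl, Finset.mem_range.1 hk⟩)

lemma measurable_sigma_expo (m n : ℕ) : Measurable[D.sigma (past m n)] (D.expo m n) := by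
  refine @Finset.measurable_fun_sum _ _ _ _ _ _ (D.sigma _) _ _ fun k hk => ?_
  exact (D.measurable_sigma_noise (Or.inr ⟨rfl, Finset.mem_range.1 hk⟩)).const_mul _

lemma measurable_sigma_entry (hσ : ∀ i, (σ i).Admissible) (m n : ℕ) :
    Measurable[D.sigma (past m n)] (D.entry m n) :=
  (D.measurable_sigma_switchTime hσ m n).add
    (ENNReal.measurable_ofReal.comp (D.measurable_sigma_shockTime m n))

lemma measurable_sigma_age (hσ : ∀ i, (σ i).Admissible) (m n : ℕ) (t : ℝ≥0) :
    Measurable[D.sigma (past m n)] (D.age m n t) := by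
  refine ENNReal.measurable_toReal.comp ?_
  exact (@measurable_const _ _ _ (D.sigma _) _).sub (D.measurable_sigma_entry hσ m n)

end Driving
/-! ### The exponential distribution -/

lemma expMeasure_Ioi {r : ℝ} (hr : 0 < r) {a : ℝ} (ha : 0 ≤ a) :
    expMeasure r (Set.Ioi a) = ENNReal.ofReal (Real.exp (-(r * a))) := by
  have := isProbabilityMeasure_expMeasure hr
  have h := cdf_expMeasure_eq hr a
  rw [cdf_eq_real, if_pos ha] at h
  rw [← ofReal_measureReal, ← Set.compl_Iic, probReal_compl_eq_one_sub measurableSet_Iic, h]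
  congr 1
  ring

lemma expMeasure_Ioc_eq {r : ℝ} (hr : 0 < r) {a b : ℝ} (ha : 0 ≤ a) (hab : a ≤ b) :
    expMeasure r (Set.Ioc a b) =
      ENNReal.ofReal (Real.exp (-(r * a)) - Real.exp (-(r * b))) := by
  have := isProbabilityMeasure_expMeasure hr
  rw [ENNReal.ofReal_sub _ (Real.exp_pos _).le,
    ← expMeasure_Ioi hr ha, ← expMeasure_Ioi hr (ha.trans hab),
    ← measure_sdiff (Set.Ioi_subset_Ioi hab) measurableSet_Ioi.nullMeasurableSet
      (measure_ne_top _ _), Set.Ioi_sdiff_Ioi]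

lemma expMeasure_singleton {r : ℝ} (a : ℝ) : expMeasure r {a} = 0 :=
  (withDensity_absolutelyContinuous _ _) Real.volume_singleton

lemma integral_exp_neg_mul {r : ℝ} (hr : 0 < r) (a b : ℝ) :
    ∫ y in a..b, Real.exp (-(r * y)) = (Real.exp (-(r * a)) - Real.exp (-(r * b))) / r := by
  rw [intervalIntegral.integral_eq_sub_of_hasDerivAt (f := fun y => -Real.exp (-(r * y)) / r)]
  · ring
  · intro y _
    have h : HasDerivAt (fun y : ℝ => -(r * y)) (-r) y := by
      simpa using ((hasDerivAt_id y).const_mul (-r))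
    have h' : -(Real.exp (-(r * y)) * -r) / r = Real.exp (-(r * y)) := by field_simp
    exact h' ▸ (h.exp.neg).div_const r
  · exact Continuous.intervalIntegrable (by fun_prop) _ _

/-- The compensator of an exponential time. -/
lemma expMeasure_Ioc {r : ℝ} (hr : 0 < r) {a b : ℝ} (ha : 0 ≤ a) (hab : a ≤ b) :
    expMeasure r (Set.Ioc a b) =
      ENNReal.ofReal r * ∫⁻ x, ENNReal.ofReal (min x b - min x a) ∂(expMeasure r) := by
  have := isProbabilityMeasure_expMeasure hr
  -- The difference of minima is the length of the part of (a, b] below x. Exchanging the integrals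
  -- leaves the integral of the tail exp(-ry) over (a, b].
  have h1 : ∀ x, ENNReal.ofReal (min x b - min x a) =
      ∫⁻ y in Set.Ioc a b, (Set.Ioi y).indicator (fun _ => 1) x := by
    intro x
    have h2 : ∀ y, (Set.Ioi y).indicator (fun _ => (1 : ℝ≥0∞)) x =
        (Set.Iio x).indicator (fun _ => 1) y := fun y => by
      simp [Set.indicator_apply]
    simp_rw [h2]
    rw [lintegral_indicator_const measurableSet_Iio, one_mul,
      Measure.restrict_apply measurableSet_Iio]
    rcases le_total x a with hx | hx
    · rw [min_eq_left hx, min_eq_left (hx.trans hab), sub_self, ENNReal.ofReal_zero]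
      rw [show Set.Iio x ∩ Set.Ioc a b = ∅ by
        ext y; simp only [Set.mem_inter_iff, Set.mem_Iio, Set.mem_Ioc, Set.mem_empty_iff_false,
          iff_false]; rintro ⟨h3, h4, -⟩; linarith, measure_empty]
    · rw [min_eq_right hx]
      rcases le_or_gt x b with hxb | hxb
      · rw [min_eq_left hxb, show Set.Iio x ∩ Set.Ioc a b = Set.Ioo a x by
          ext y; simp only [Set.mem_inter_iff, Set.mem_Iio, Set.mem_Ioc, Set.mem_Ioo]
          exact ⟨fun h => ⟨h.2.1, h.1⟩, fun h => ⟨h.2, h.1, h.2.le.trans hxb⟩⟩, Real.volume_Ioo]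
      · rw [min_eq_right hxb.le, Set.inter_eq_right.2 fun y hy => hy.2.trans_lt hxb,
          Real.volume_Ioc]
  simp_rw [h1]
  rw [lintegral_lintegral_swap]
  · have h3 : ∀ y ∈ Set.Ioc a b, ∫⁻ x, (Set.Ioi y).indicator (fun _ => 1) x ∂(expMeasure r) =
        ENNReal.ofReal (Real.exp (-(r * y))) := fun y hy => by
      rw [lintegral_indicator_const measurableSet_Ioi, one_mul,
        expMeasure_Ioi hr (ha.trans hy.1.le)]
    rw [setLIntegral_congr_fun measurableSet_Ioc h3, ← ofReal_integral_eq_lintegral_ofReal,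
      ← intervalIntegral.integral_of_le hab, integral_exp_neg_mul hr, ← ENNReal.ofReal_mul hr.le,
      mul_div_cancel₀ _ hr.ne', ← expMeasure_Ioc_eq hr ha hab]
    · exact (Continuous.intervalIntegrable (by fun_prop) a b).1
    · exact Filter.Eventually.of_forall fun _ => (Real.exp_pos _).le
  · refine Measurable.aemeasurable ?_
    have : MeasurableSet {q : ℝ × ℝ | q.2 < q.1} := measurableSet_lt measurable_snd measurable_fst
    exact (measurable_const (a := (1 : ℝ≥0∞))).indicator this

/-- The Laplace transform of the exponential distribution. -/
lemma lintegral_exp_expMeasure {r θ : ℝ} (hr : 0 < r) (hθ : 0 ≤ θ) :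
    ∫⁻ x, ENNReal.ofReal (Real.exp (-(θ * x))) ∂(expMeasure r) =
      ENNReal.ofReal (r / (r + θ)) := by
  have hrθ : 0 < r + θ := by linarith
  -- Tilting the density of rate r by exp(-θx) gives a multiple of the density of rate r + θ.
  have h : ∀ x, exponentialPDF r x * ENNReal.ofReal (Real.exp (-(θ * x))) =
      ENNReal.ofReal (r / (r + θ)) * exponentialPDF (r + θ) x := by
    intro x
    rcases lt_or_ge x 0 with hx | hx
    · rw [exponentialPDF_of_neg hx, exponentialPDF_of_neg hx, zero_mul, mul_zero]
    · rw [exponentialPDF_of_nonneg hx, exponentialPDF_of_nonneg hx,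
        ← ENNReal.ofReal_mul (by positivity), ← ENNReal.ofReal_mul (by positivity), mul_assoc,
        ← Real.exp_add, ← mul_assoc, div_mul_cancel₀ _ hrθ.ne']
      congr 3
      ring
  change ∫⁻ x, _ ∂(volume.withDensity (exponentialPDF r)) = _
  have hm : ∀ r, Measurable (exponentialPDF r) := fun r =>
    (measurable_exponentialPDFReal r).ennreal_ofReal
  rw [lintegral_withDensity_eq_lintegral_mul _ (hm r) (by fun_prop)]
  simp_rw [Pi.mul_apply, h]
  rw [lintegral_const_mul _ (hm _), lintegral_exponentialPDF_eq_one hrθ, mul_one]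

namespace Driving

variable {Ω : Type*} [MeasurableSpace Ω] {P : Measure Ω} {σ : Bool → Pattern} {i₀ : Bool}
variable (D : Driving P σ i₀)

/-! ### Independence -/

lemma sourceLaw_shock (m n : ℕ) :
    sourceLaw σ i₀ (.shock m n) = expMeasure ((σ (eps i₀ m)).lam n) := rfl

lemma sourceLaw_clock (m : ℕ) : sourceLaw σ i₀ (.clock m) = expMeasure 1 := rfl

section source

variable {β : Type*} [MeasurableSpace β] {s₀ : Source} {U : Ω → β}

lemma indep_source (s₀ : Source) :
    Indep (D.sigma {s₀}ᶜ) (MeasurableSpace.comap (D.noise s₀) inferInstance) P := by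
  refine indep_of_indep_of_le_right (indep_iSup_of_disjoint
    (fun s => (D.measurable_noise s).comap_le) ((iIndepFun_iff_iIndep _ _ _).1 D.indep_noise)
    (S := {s₀}ᶜ) (T := {s₀}) disjoint_compl_left) ?_
  exact le_iSup₂_of_le s₀ rfl le_rfl

lemma measure_inter_source {G : Set Ω} (hG : MeasurableSet[D.sigma {s₀}ᶜ] G) {B : Set ℝ}
    (hB : MeasurableSet B) :
    P (G ∩ D.noise s₀ ⁻¹' B) = P G * sourceLaw σ i₀ s₀ B := by
  rw [(Indep_iff _ _ _).1 (D.indep_source s₀) G _ hG ⟨B, hB, rfl⟩, ← D.law_noise s₀,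
    Measure.map_apply (D.measurable_noise s₀) hB]

lemma indepFun_source (hU : Measurable[D.sigma {s₀}ᶜ] U) : IndepFun U (D.noise s₀) P := by
  rw [IndepFun_iff_Indep]
  exact indep_of_indep_of_le_left (D.indep_source s₀) hU.comap_le

/-- Fubini for a source and a variable built from all the others: the source may be integrated out
first. -/
lemma lintegral_source [IsProbabilityMeasure P] (hU : Measurable[D.sigma {s₀}ᶜ] U) {F : β × ℝ → ℝ≥0∞} (hF : Measurable F) :
    ∫⁻ ω, F (U ω, D.noise s₀ ω) ∂P = ∫⁻ ω, ∫⁻ x, F (U ω, x) ∂(sourceLaw σ i₀ s₀) ∂P := by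
  have hU' : Measurable U := hU.mono (D.sigma_le _) le_rfl
  have hm := D.measurable_noise s₀
  have hl := D.law_noise s₀
  have : IsProbabilityMeasure (sourceLaw σ i₀ s₀) :=
    hl ▸ Measure.isProbabilityMeasure_map hm.aemeasurable
  rw [← lintegral_map (f := F) (g := fun ω => (U ω, D.noise s₀ ω)) hF (hU'.prodMk hm),
    (indepFun_iff_map_prod_eq_prod_map_map hU'.aemeasurable hm.aemeasurable).1
      (D.indepFun_source hU), hl, lintegral_prod _ hF.aemeasurable,
    lintegral_map hF.lintegral_prod_right' hU']

/-- The compensator of an exponential source, with boundaries which do not depend on it. -/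
lemma setIntegral_compensator [IsProbabilityMeasure P] {r : ℝ} (hr : 0 < r) (hs : sourceLaw σ i₀ s₀ = expMeasure r)
    {G : Set Ω} (hG : MeasurableSet[D.sigma {s₀}ᶜ] G) {A B : Ω → ℝ}
    (hA : Measurable[D.sigma {s₀}ᶜ] A) (hB : Measurable[D.sigma {s₀}ᶜ] B)
    (hAB : ∀ᵐ ω ∂P, 0 ≤ A ω ∧ A ω ≤ B ω) :
    ∫ ω in G, (Set.Ioc (A ω) (B ω)).indicator (fun _ => (1 : ℝ)) (D.noise s₀ ω) ∂P =
      r * ∫ ω in G, (min (D.noise s₀ ω) (B ω) - min (D.noise s₀ ω) (A ω)) ∂P := by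
  have hle := D.sigma_le {s₀}ᶜ
  have hm := D.measurable_noise s₀
  have hA' := hA.mono hle le_rfl
  have hB' := hB.mono hle le_rfl
  have hG' := hle _ hG
  have hg : Measurable[D.sigma {s₀}ᶜ] (G.indicator fun _ => (1 : ℝ≥0∞)) :=
    (@measurable_const _ _ _ (D.sigma _) _).indicator hG
  -- The indicator of G travels as a coordinate together with the boundaries, so that one
  -- application of Fubini covers the restriction to G.
  have hU : Measurable[D.sigma {s₀}ᶜ] fun ω => (G.indicator (fun _ => (1 : ℝ≥0∞)) ω, A ω, B ω) :=
    hg.prodMk (hA.prodMk hB)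
  have hI : MeasurableSet {q : (ℝ≥0∞ × ℝ × ℝ) × ℝ | q.2 ∈ Set.Ioc q.1.2.1 q.1.2.2} :=
    (measurableSet_lt (f := fun q : (ℝ≥0∞ × ℝ × ℝ) × ℝ => q.1.2.1) (by fun_prop)
      measurable_snd).inter
      (measurableSet_le (g := fun q : (ℝ≥0∞ × ℝ × ℝ) × ℝ => q.1.2.2) measurable_snd (by fun_prop))
  have hI' : MeasurableSet {ω | D.noise s₀ ω ∈ Set.Ioc (A ω) (B ω)} :=
    (measurableSet_lt hA' hm).inter (measurableSet_le hm hB')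
  have hF1 : Measurable fun q : (ℝ≥0∞ × ℝ × ℝ) × ℝ =>
      q.1.1 * (Set.Ioc q.1.2.1 q.1.2.2).indicator (fun _ => (1 : ℝ≥0∞)) q.2 :=
    (by fun_prop : Measurable fun q : (ℝ≥0∞ × ℝ × ℝ) × ℝ => q.1.1).mul
      ((measurable_const (a := (1 : ℝ≥0∞))).indicator hI)
  have hF2 : Measurable fun q : (ℝ≥0∞ × ℝ × ℝ) × ℝ =>
      q.1.1 * ENNReal.ofReal (min q.2 q.1.2.2 - min q.2 q.1.2.1) := by fun_prop
  have key : ∫⁻ ω, G.indicator (fun _ => (1 : ℝ≥0∞)) ω *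
        (Set.Ioc (A ω) (B ω)).indicator (fun _ => (1 : ℝ≥0∞)) (D.noise s₀ ω) ∂P =
      ENNReal.ofReal r * ∫⁻ ω, G.indicator (fun _ => (1 : ℝ≥0∞)) ω *
        ENNReal.ofReal (min (D.noise s₀ ω) (B ω) - min (D.noise s₀ ω) (A ω)) ∂P := by
    rw [D.lintegral_source hU hF1, D.lintegral_source hU hF2, ← lintegral_const_mul']
    · refine lintegral_congr_ae ?_
      filter_upwards [hAB] with ω hω
      rw [hs, lintegral_const_mul _ (measurable_const.indicator measurableSet_Ioc),
        lintegral_const_mul _ (by fun_prop), lintegral_indicator_const measurableSet_Ioc,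
        one_mul, expMeasure_Ioc hr hω.1 hω.2, mul_left_comm]
    · exact ENNReal.ofReal_ne_top
  have hind : ∀ f : Ω → ℝ≥0∞, ∫⁻ ω, G.indicator (fun _ => (1 : ℝ≥0∞)) ω * f ω ∂P =
      ∫⁻ ω in G, f ω ∂P := fun f => by
    rw [← lintegral_indicator hG']
    refine lintegral_congr fun ω => ?_
    by_cases h : ω ∈ G <;> simp [h]
  rw [hind, hind] at key
  have h0 : ∀ᵐ ω ∂P.restrict G, 0 ≤ min (D.noise s₀ ω) (B ω) - min (D.noise s₀ ω) (A ω) := by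
    filter_upwards [ae_restrict_of_ae hAB] with ω hω
    exact sub_nonneg.2 (min_le_min_left _ hω.2)
  have h1 : ∀ᵐ ω ∂P.restrict G,
      0 ≤ (Set.Ioc (A ω) (B ω)).indicator (fun _ => (1 : ℝ)) (D.noise s₀ ω) :=
    Filter.Eventually.of_forall fun ω => Set.indicator_nonneg (fun _ _ => zero_le_one) _
  have h2 : ∀ ω, ENNReal.ofReal ((Set.Ioc (A ω) (B ω)).indicator (fun _ => (1 : ℝ))
      (D.noise s₀ ω)) = (Set.Ioc (A ω) (B ω)).indicator (fun _ => (1 : ℝ≥0∞)) (D.noise s₀ ω) :=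
    fun ω => by by_cases h : D.noise s₀ ω ∈ Set.Ioc (A ω) (B ω) <;> simp [h]
  rw [integral_eq_lintegral_of_nonneg_ae h0 (by fun_prop),
    integral_eq_lintegral_of_nonneg_ae h1]
  · simp_rw [h2]
    rw [key, ENNReal.toReal_mul, ENNReal.toReal_ofReal hr.le]
  · exact ((measurable_const (a := (1 : ℝ))).indicator hI').aestronglyMeasurable

/-- Comparing this with `setIntegral_compensator` yields a closed formula for expected occupation
times, in `integral_dur_eq`. -/
lemma integral_indicator_Ioc [IsProbabilityMeasure P] {r : ℝ} (hr : 0 < r)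
    (hs : sourceLaw σ i₀ s₀ = expMeasure r) {A B : Ω → ℝ} (hA : Measurable[D.sigma {s₀}ᶜ] A)
    (hB : Measurable[D.sigma {s₀}ᶜ] B) (hAB : ∀ᵐ ω ∂P, 0 ≤ A ω ∧ A ω ≤ B ω) :
    ∫ ω, (Set.Ioc (A ω) (B ω)).indicator (fun _ => (1 : ℝ)) (D.noise s₀ ω) ∂P =
      ∫ ω, (Real.exp (-(r * A ω)) - Real.exp (-(r * B ω))) ∂P := by
  have hle := D.sigma_le {s₀}ᶜ
  have hm := D.measurable_noise s₀
  have hA' := hA.mono hle le_rfl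
  have hB' := hB.mono hle le_rfl
  have hI : MeasurableSet {q : (ℝ × ℝ) × ℝ | q.2 ∈ Set.Ioc q.1.1 q.1.2} :=
    (measurableSet_lt (f := fun q : (ℝ × ℝ) × ℝ => q.1.1) (by fun_prop) measurable_snd).inter
      (measurableSet_le (g := fun q : (ℝ × ℝ) × ℝ => q.1.2) measurable_snd (by fun_prop))
  have hI' : MeasurableSet {ω | D.noise s₀ ω ∈ Set.Ioc (A ω) (B ω)} :=
    (measurableSet_lt hA' hm).inter (measurableSet_le hm hB')
  have hF : Measurable fun q : (ℝ × ℝ) × ℝ =>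
      (Set.Ioc q.1.1 q.1.2).indicator (fun _ => (1 : ℝ≥0∞)) q.2 :=
    (measurable_const (a := (1 : ℝ≥0∞))).indicator hI
  have key := D.lintegral_source (hA.prodMk hB) hF
  have h2 : ∀ ω, ENNReal.ofReal ((Set.Ioc (A ω) (B ω)).indicator (fun _ => (1 : ℝ))
      (D.noise s₀ ω)) = (Set.Ioc (A ω) (B ω)).indicator (fun _ => (1 : ℝ≥0∞)) (D.noise s₀ ω) :=
    fun ω => by by_cases h : D.noise s₀ ω ∈ Set.Ioc (A ω) (B ω) <;> simp [h]
  rw [integral_eq_lintegral_of_nonneg_ae, integral_eq_lintegral_of_nonneg_ae]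
  · simp_rw [h2]
    rw [key]
    refine congrArg _ (lintegral_congr_ae ?_)
    filter_upwards [hAB] with ω hω
    rw [lintegral_indicator_const measurableSet_Ioc, one_mul, hs, expMeasure_Ioc_eq hr hω.1 hω.2]
  · filter_upwards [hAB] with ω hω
    exact sub_nonneg.2 (Real.exp_le_exp.2 (neg_le_neg (mul_le_mul_of_nonneg_left hω.2 hr.le)))
  · fun_prop
  · exact Filter.Eventually.of_forall fun ω => Set.indicator_nonneg (fun _ _ => zero_le_one) _
  · exact ((measurable_const (a := (1 : ℝ))).indicator hI').aestronglyMeasurable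

lemma integrable_source (hint : Integrable (fun x : ℝ => x) (sourceLaw σ i₀ s₀)) :
    Integrable (D.noise s₀) P := by
  rw [← D.law_noise s₀] at hint
  exact hint.comp_measurable (D.measurable_noise s₀)

lemma integral_source {f : ℝ → ℝ} (hf : Measurable f) :
    ∫ ω, f (D.noise s₀ ω) ∂P = ∫ x, f x ∂(sourceLaw σ i₀ s₀) := by
  rw [← D.law_noise s₀, integral_map (D.measurable_noise s₀).aemeasurable
    hf.aestronglyMeasurable]

lemma integral_source_mul {f : ℝ → ℝ} (hf : Measurable f) {U : Ω → ℝ}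
    (hU : Measurable[D.sigma {s₀}ᶜ] U) :
    ∫ ω, f (D.noise s₀ ω) * U ω ∂P = (∫ x, f x ∂(sourceLaw σ i₀ s₀)) * ∫ ω, U ω ∂P := by
  rw [← D.integral_source hf]
  exact ((D.indepFun_source hU).symm.comp hf measurable_id).integral_fun_mul_eq_mul_integral
    (hf.comp (D.measurable_noise s₀)).aestronglyMeasurable
    (hU.mono (D.sigma_le _) le_rfl).aestronglyMeasurable

lemma setIntegral_source_mul {f : ℝ → ℝ} (hf : Measurable f) {G : Set Ω}
    (hG : MeasurableSet[D.sigma {s₀}ᶜ] G) {U : Ω → ℝ} (hU : Measurable[D.sigma {s₀}ᶜ] U) :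
    ∫ ω in G, f (D.noise s₀ ω) * U ω ∂P =
      (∫ x, f x ∂(sourceLaw σ i₀ s₀)) * ∫ ω in G, U ω ∂P := by
  have hle := D.sigma_le {s₀}ᶜ
  rw [← integral_indicator (hle _ hG), ← integral_indicator (hle _ hG),
    ← D.integral_source_mul hf (hU.indicator hG)]
  refine integral_congr_ae (Filter.Eventually.of_forall fun ω => ?_)
  by_cases hω : ω ∈ G <;> simp [hω]

end source

end Driving
-- Laplace transforms and almost sure divergence.
lemma integral_exp_expMeasure {r θ : ℝ} (hr : 0 < r) (hθ : 0 ≤ θ) :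
    ∫ x, Real.exp (-(θ * x)) ∂(expMeasure r) = r / (r + θ) := by
  rw [integral_eq_lintegral_of_nonneg_ae (Filter.Eventually.of_forall fun x => (Real.exp_pos _).le)
    (by fun_prop), lintegral_exp_expMeasure hr hθ, ENNReal.toReal_ofReal (by positivity)]

lemma expMeasure_ae_pos {r : ℝ} (hr : 0 < r) : ∀ᵐ x ∂(expMeasure r), 0 < x := by
  have := isProbabilityMeasure_expMeasure hr
  rw [ae_iff]
  simp only [not_lt]
  have h := prob_compl_eq_one_sub (μ := expMeasure r) (s := Set.Ioi 0) measurableSet_Ioi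
  rw [expMeasure_Ioi hr le_rfl, Set.compl_Ioi] at h
  simpa [Set.Iic] using h

/-- The product is the inverse of ∏ (1 + 1/λ_k), which is at least ∑ 1/λ_k and therefore diverges.
-/
lemma prod_div_add_one_tendsto_zero {lam : ℕ → ℝ} (hpos : ∀ n, 0 < lam n)
    (h : ¬ Summable fun n => (lam n)⁻¹) :
    Filter.Tendsto (fun n => ∏ k ∈ Finset.range n, lam k / (lam k + 1)) Filter.atTop (nhds 0) := by
  have hS := (not_summable_iff_tendsto_nat_atTop_of_nonneg fun n => (inv_pos.2 (hpos n)).le).1 h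
  refine squeeze_zero' (Filter.Eventually.of_forall fun n => Finset.prod_nonneg fun k _ => ?_)
    (Filter.eventually_atTop.2 ⟨1, fun n hn => ?_⟩) hS.inv_tendsto_atTop
  · have := hpos k
    positivity
  · have h1 : ∀ n, ∑ k ∈ Finset.range n, (lam k)⁻¹ ≤ ∏ k ∈ Finset.range n, (1 + (lam k)⁻¹) ∧
        1 ≤ ∏ k ∈ Finset.range n, (1 + (lam k)⁻¹) := by
      intro n
      induction n with
      | zero => simp
      | succ n ih =>
        have := inv_pos.2 (hpos n)
        rw [Finset.sum_range_succ, Finset.prod_range_succ]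
        constructor <;> nlinarith [ih.1, ih.2]
    have h2 : ∏ k ∈ Finset.range n, lam k / (lam k + 1) =
        (∏ k ∈ Finset.range n, (1 + (lam k)⁻¹))⁻¹ := by
      rw [← Finset.prod_inv_distrib]
      refine Finset.prod_congr rfl fun k _ => ?_
      have := hpos k
      field_simp
    rw [h2]
    exact inv_anti₀ (Finset.sum_pos (fun k _ => inv_pos.2 (hpos k))
      ⟨0, Finset.mem_range.2 hn⟩) (h1 n).1

/-- A sequence whose Laplace transforms tend to zero is almost surely unbounded. -/
lemma ae_unbounded {Ω : Type*} [MeasurableSpace Ω] {P : Measure Ω} [IsFiniteMeasure P]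
    {S : ℕ → Ω → ℝ} (hm : ∀ n, Measurable (S n)) (h0 : ∀ᵐ ω ∂P, ∀ n, 0 ≤ S n ω)
    (h : Filter.Tendsto (fun n => ∫ ω, Real.exp (-S n ω) ∂P) Filter.atTop (nhds 0)) :
    ∀ᵐ ω ∂P, ∀ C : ℝ, ∃ n, C < S n ω := by
  have hC : ∀ C : ℕ, ∀ᵐ ω ∂P, ∃ n, (C : ℝ) < S n ω := by
    intro C
    set B := {ω | ∀ n, S n ω ≤ C}
    have hB : MeasurableSet B := by
      rw [show B = ⋂ n, {ω | S n ω ≤ C} by ext; simp [B]]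
      exact MeasurableSet.iInter fun n => measurableSet_le (hm n) measurable_const
    have hint : ∀ n, Integrable (fun ω => Real.exp (-S n ω)) P := fun n => by
      refine Integrable.of_bound (by fun_prop) 1 ?_
      filter_upwards [h0] with ω hω
      rw [Real.norm_eq_abs, abs_of_pos (Real.exp_pos _), Real.exp_le_one_iff]
      linarith [hω n]
    -- A Markov inequality: on the event that the sequence stays below C, every exp(-S_n) is at
    -- least exp(-C).
    have hle : ∀ n, P.real B * Real.exp (-C) ≤ ∫ ω, Real.exp (-S n ω) ∂P := fun n => by
      calc P.real B * Real.exp (-C) = ∫ _ in B, Real.exp (-C) ∂P := by simp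
        _ ≤ ∫ ω in B, Real.exp (-S n ω) ∂P :=
          setIntegral_mono_on (integrableOn_const (by finiteness)) (hint n).integrableOn hB
            fun ω hω => Real.exp_le_exp.2 (neg_le_neg (hω n))
        _ ≤ _ := setIntegral_le_integral (hint n)
          (Filter.Eventually.of_forall fun ω => (Real.exp_pos _).le)
    have h1 : P.real B * Real.exp (-C) ≤ 0 := ge_of_tendsto' h hle
    have h2 : P.real B = 0 := le_antisymm (by
      by_contra! hcon
      exact absurd h1 (not_le.2 (mul_pos hcon (Real.exp_pos _)))) measureReal_nonneg
    rw [measureReal_eq_zero_iff] at h2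
    rw [ae_iff]
    simpa [B] using h2
  filter_upwards [ae_all_iff.2 hC] with ω hω C
  obtain ⟨c, hc⟩ := exists_nat_ge C
  obtain ⟨n, hn⟩ := hω c
  exact ⟨n, hc.trans_lt hn⟩

namespace Driving

variable {Ω : Type*} [MeasurableSpace Ω] {P : Measure Ω} {σ : Bool → Pattern} {i₀ : Bool}
variable (D : Driving P σ i₀)

/-! ### Measurability with respect to the sources -/

lemma past_subset_compl_shock (m n : ℕ) : past m n ⊆ {Source.shock m n}ᶜ := by
  rintro s hs rfl
  rw [shock_mem_past] at hs
  omega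

lemma past_subset_compl_clock (m n : ℕ) : past m n ⊆ {Source.clock m}ᶜ := by
  rintro s hs rfl
  rw [clock_mem_past] at hs
  omega

lemma past_subset_compl_inner (m n : ℕ) : past m n ⊆ {Source.inner m n}ᶜ := by
  rintro s hs rfl
  rw [inner_mem_past] at hs
  omega

lemma past_subset_compl_outer (m n : ℕ) : past m n ⊆ {Source.outer m n}ᶜ := by
  rintro s hs rfl
  rw [outer_mem_past] at hs
  omega

lemma past_subset_past {m n m' n' : ℕ} (h : m < m' ∨ m = m' ∧ n ≤ n') : past m n ⊆ past m' n' := by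
  rintro (⟨k, j⟩ | ⟨k⟩ | ⟨k, j⟩ | ⟨k, j⟩) hs
  · rw [shock_mem_past] at *; omega
  · rw [clock_mem_past] at *; omega
  · rw [inner_mem_past] at *; omega
  · rw [outer_mem_past] at *; omega

section sigma

variable {D} {m n : ℕ} {T : Set Source}

lemma measurable_sigma_zeta (hT : past m n ⊆ T) (hc : .clock m ∈ T) :
    Measurable[D.sigma T] (D.zeta m n) :=
  ((D.measurable_sigma_noise hc).sub
    ((D.measurable_sigma_expo m n).mono (D.sigma_mono hT) le_rfl)).div_const _

lemma measurable_sigma_soj (hT : past m n ⊆ T) (hc : .clock m ∈ T) (hs : .shock m n ∈ T) :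
    Measurable[D.sigma T] (D.soj m n) :=
  (D.measurable_sigma_noise hs).min
    ((@measurable_const _ _ _ (D.sigma T) _).max (measurable_sigma_zeta hT hc))

end sigma

/-! ### Discounted times -/

lemma ae_shock_pos (hσ : ∀ i, (σ i).Admissible) : ∀ᵐ ω ∂P, ∀ m k, 0 < D.noise (.shock m k) ω := by
  refine ae_all_iff.2 fun m => ae_all_iff.2 fun k => ?_
  have h := expMeasure_ae_pos ((hσ (eps i₀ m)).lam_pos k)
  rw [← sourceLaw_shock, ← D.law_noise] at h
  exact ae_of_ae_map (D.measurable_noise _).aemeasurable h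

lemma ae_clock_pos : ∀ᵐ ω ∂P, ∀ m, 0 < D.noise (.clock m) ω := by
  refine ae_all_iff.2 fun m => ?_
  have h := expMeasure_ae_pos one_pos
  rw [← sourceLaw_clock (σ := σ) (i₀ := i₀) m, ← D.law_noise] at h
  exact ae_of_ae_map (D.measurable_noise _).aemeasurable h

/-- The clock is independent of the shocks and its law has no atoms. -/
lemma ae_no_tie [IsProbabilityMeasure P] : ∀ᵐ ω ∂P, ∀ m n, D.noise (.clock m) ω ≠ D.expo m n ω := by
  refine ae_all_iff.2 fun m => ae_all_iff.2 fun n => ?_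
  have hU := (D.measurable_sigma_expo m n).mono (D.sigma_mono (past_subset_compl_clock m n)) le_rfl
  have hE : MeasurableSet {q : ℝ × ℝ | q.2 = q.1} :=
    measurableSet_eq_fun measurable_snd measurable_fst
  have h := D.lintegral_source hU ((measurable_const (a := (1 : ℝ≥0∞))).indicator hE)
  have h0 : ∀ u : ℝ, ∫⁻ x, {q : ℝ × ℝ | q.2 = q.1}.indicator (fun _ => (1 : ℝ≥0∞)) (u, x)
      ∂(sourceLaw σ i₀ (.clock m)) = 0 := fun u => by
    have h1 : ∀ x, {q : ℝ × ℝ | q.2 = q.1}.indicator (fun _ => (1 : ℝ≥0∞)) (u, x) =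
        ({u} : Set ℝ).indicator (fun _ => 1) x := fun x => by simp [Set.indicator_apply]
    simp_rw [h1]
    rw [lintegral_indicator_const (measurableSet_singleton u), one_mul]
    exact expMeasure_singleton u
  simp_rw [h0, lintegral_zero] at h
  have hE' : MeasurableSet {ω | D.noise (.clock m) ω = D.expo m n ω} :=
    measurableSet_eq_fun (D.measurable_noise _) (hU.mono (D.sigma_le _) le_rfl)
  have h2 : P {ω | D.noise (.clock m) ω = D.expo m n ω} = 0 := by
    rw [← one_mul (P _), ← lintegral_indicator_const hE', ← h]
    refine lintegral_congr fun ω => ?_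
    simp [Set.indicator_apply]
  rw [ae_iff]
  simpa using h2

/-- The discount factor for the first sojourns of the first `m` periods. -/
def discount (θ : ℝ) (m : ℕ) (ω : Ω) : ℝ := Real.exp (-(θ * ∑ k ∈ Finset.range m, D.soj k 0 ω))

lemma discount_pos (θ : ℝ) (m : ℕ) (ω : Ω) : 0 < D.discount θ m ω := Real.exp_pos _

lemma measurable_sigma_discount (θ : ℝ) (m n : ℕ) :
    Measurable[D.sigma (past m n)] (D.discount θ m) := by
  refine Real.measurable_exp.comp (Measurable.neg (Measurable.const_mul ?_ _))
  refine @Finset.measurable_fun_sum _ _ _ _ _ _ (D.sigma _) _ _ fun k hk => ?_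
  have hk' := Finset.mem_range.1 hk
  exact measurable_sigma_soj (past_subset_past (Or.inl hk')) (clock_mem_past.2 hk')
    (shock_mem_past.2 (Or.inl hk'))

/-- Each shock time is independent of the earlier shocks and of the earlier periods, so induction on
n splits off one Laplace transform at a time. The case θ = 0, a = 1 excludes explosion of shocks; a
= μ + θ serves the occupation times. -/
lemma integral_discount_mul (hσ : ∀ i, (σ i).Admissible) (θ : ℝ) (m : ℕ) {a : ℕ → ℝ}
    (ha : ∀ k, 0 ≤ a k) (n : ℕ) :
    ∫ ω, Real.exp (-∑ k ∈ Finset.range n, a k * D.noise (.shock m k) ω) * D.discount θ m ω ∂P =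
      (∏ k ∈ Finset.range n, (D.pat m).lam k / ((D.pat m).lam k + a k)) *
        ∫ ω, D.discount θ m ω ∂P := by
  induction n with
  | zero => simp
  | succ n ih =>
    have hU : Measurable[D.sigma {Source.shock m n}ᶜ] fun ω =>
        Real.exp (-∑ k ∈ Finset.range n, a k * D.noise (.shock m k) ω) * D.discount θ m ω := by
      refine Measurable.mono ?_ (D.sigma_mono (past_subset_compl_shock m n)) le_rfl
      refine Measurable.mul (Real.measurable_exp.comp (Measurable.neg ?_))
        (D.measurable_sigma_discount θ m n)
      refine @Finset.measurable_fun_sum _ _ _ _ _ _ (D.sigma _) _ _ fun k hk => ?_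
      exact (D.measurable_sigma_noise (Or.inr ⟨rfl, Finset.mem_range.1 hk⟩)).const_mul _
    have h := D.integral_source_mul (f := fun x => Real.exp (-(a n * x))) (by fun_prop) hU
    rw [ih, sourceLaw_shock, integral_exp_expMeasure ((hσ _).lam_pos n) (ha n), ← mul_assoc] at h
    rw [Finset.prod_range_succ, mul_comm (∏ k ∈ _, _), ← h]
    refine integral_congr_ae (Filter.Eventually.of_forall fun ω => ?_)
    simp only [Finset.sum_range_succ, neg_add, Real.exp_add]
    ring

lemma soj_zero_nonneg (m : ℕ) {ω : Ω} (h : ∀ m k, 0 < D.noise (.shock m k) ω) :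
    0 ≤ ∑ k ∈ Finset.range m, D.soj k 0 ω :=
  Finset.sum_nonneg fun k _ => soj_nonneg (fun j => (h k j).le) 0

lemma ae_discount_le_one (hσ : ∀ i, (σ i).Admissible) {θ : ℝ} (hθ : 0 ≤ θ) (m : ℕ) :
    ∀ᵐ ω ∂P, D.discount θ m ω ≤ 1 := by
  filter_upwards [D.ae_shock_pos hσ] with ω h
  rw [discount, Real.exp_le_one_iff, neg_nonpos]
  exact mul_nonneg hθ (D.soj_zero_nonneg m h)

lemma measurable_discount (θ : ℝ) (m : ℕ) : Measurable (D.discount θ m) :=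
  (D.measurable_sigma_discount θ m 0).mono (D.sigma_le _) le_rfl

lemma integrable_discount [IsProbabilityMeasure P] (hσ : ∀ i, (σ i).Admissible) {θ : ℝ}
    (hθ : 0 ≤ θ) (m : ℕ) :
    Integrable (D.discount θ m) P := by
  refine Integrable.of_bound (D.measurable_discount θ m).aestronglyMeasurable 1 ?_
  filter_upwards [D.ae_discount_le_one hσ hθ m] with ω h
  rwa [Real.norm_eq_abs, abs_of_pos (D.discount_pos θ m ω)]

/-- The first sojourn of a period is the minimum of two independent exponential times of rates λ_0
and μ_0, and one minus the product of θ/(λ_0 + θ) and θ/(μ_0 + θ) bounds its Laplace transform. -/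
lemma integral_discount_succ_le [IsProbabilityMeasure P] (hσ : ∀ i, (σ i).Admissible) {θ : ℝ}
    (hθ : 0 < θ) (m : ℕ) :
    ∫ ω, D.discount θ (m + 1) ω ∂P ≤
      (1 - θ / ((D.pat m).lam 0 + θ) * (θ / ((D.pat m).mu 0 + θ))) *
        ∫ ω, D.discount θ m ω ∂P := by
  have hl := (hσ (eps i₀ m)).lam_pos 0
  have hμ := (hσ (eps i₀ m)).mu_pos 0
  set μ := (D.pat m).mu 0
  set f : ℝ → ℝ := fun x => 1 - Real.exp (-(θ * x)) with hf
  set g : ℝ → ℝ := fun x => 1 - Real.exp (-(θ / μ * x)) with hg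
  have hfm : Measurable f := by fun_prop
  have hgm : Measurable g := by fun_prop
  have hθμ : 0 < θ / μ := div_pos hθ hμ
  have hE : ∀ {r a : ℝ}, 0 < r → 0 ≤ a →
      ∫ x, (1 - Real.exp (-(a * x))) ∂(expMeasure r) = 1 - r / (r + a) := by
    intro r a hr ha
    have := isProbabilityMeasure_expMeasure hr
    have hi : Integrable (fun x => Real.exp (-(a * x))) (expMeasure r) := by
      refine Integrable.of_bound (by fun_prop) 1 ?_
      filter_upwards [expMeasure_ae_pos hr] with x hx
      rw [Real.norm_eq_abs, abs_of_pos (Real.exp_pos _), Real.exp_le_one_iff]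
      nlinarith
    rw [integral_sub (integrable_const _) hi, integral_exp_expMeasure hr ha]
    simp
  have hD := D.integrable_discount hσ hθ.le m
  have h1 : ∫ ω, f (D.noise (.shock m 0) ω) * D.discount θ m ω ∂P =
      (1 - (D.pat m).lam 0 / ((D.pat m).lam 0 + θ)) * ∫ ω, D.discount θ m ω ∂P := by
    rw [D.integral_source_mul hfm ((D.measurable_sigma_discount θ m 0).mono
      (D.sigma_mono (past_subset_compl_shock m 0)) le_rfl), sourceLaw_shock, hE hl hθ.le]
  have hU : Measurable[D.sigma {Source.clock m}ᶜ] fun ω =>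
      f (D.noise (.shock m 0) ω) * D.discount θ m ω := by
    refine Measurable.mul (hfm.comp (D.measurable_sigma_noise (by simp))) ?_
    exact (D.measurable_sigma_discount θ m 0).mono
      (D.sigma_mono (past_subset_compl_clock m 0)) le_rfl
  have h2 := D.integral_source_mul hgm hU
  rw [sourceLaw_clock, hE one_pos hθμ.le, h1] at h2
  have hpt : ∀ᵐ ω ∂P, D.discount θ (m + 1) ω ≤ D.discount θ m ω -
      g (D.noise (.clock m) ω) * (f (D.noise (.shock m 0) ω) * D.discount θ m ω) ∧
      0 ≤ f (D.noise (.shock m 0) ω) ∧ f (D.noise (.shock m 0) ω) ≤ 1 ∧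
      0 ≤ g (D.noise (.clock m) ω) ∧ g (D.noise (.clock m) ω) ≤ 1 := by
    filter_upwards [D.ae_shock_pos hσ, D.ae_clock_pos] with ω hτ he
    have hx := hτ m 0
    have hy := he m
    have hfx : Real.exp (-(θ * D.noise (.shock m 0) ω)) ≤ 1 :=
      Real.exp_le_one_iff.2 (by nlinarith)
    have hgy : Real.exp (-(θ / μ * D.noise (.clock m) ω)) ≤ 1 :=
      Real.exp_le_one_iff.2 (by nlinarith)
    have hfx' := Real.exp_pos (-(θ * D.noise (.shock m 0) ω))
    have hgy' := Real.exp_pos (-(θ / μ * D.noise (.clock m) ω))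
    refine ⟨?_, by simp only [hf]; linarith, by simp only [hf]; linarith,
      by simp only [hg]; linarith, by simp only [hg]; linarith⟩
    have hs : D.soj m 0 ω = min (D.noise (.shock m 0) ω) (D.noise (.clock m) ω / μ) := by
      rw [soj, zeta, expo_zero, sub_zero, max_eq_right (div_pos hy hμ).le]
    have hsucc : D.discount θ (m + 1) ω =
        Real.exp (-(θ * D.soj m 0 ω)) * D.discount θ m ω := by
      rw [discount, discount, Finset.sum_range_succ, ← Real.exp_add]
      congr 1
      ring
    have hdp := D.discount_pos θ m ω
    -- The exponential of minus a minimum is the larger of two numbers a, b in [0, 1], hence at most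
    -- 1 - (1 - a)(1 - b).
    have hmax : Real.exp (-(θ * D.soj m 0 ω)) ≤
        1 - g (D.noise (.clock m) ω) * f (D.noise (.shock m 0) ω) := by
      simp only [hf, hg]
      rw [hs]
      rcases min_choice (D.noise (.shock m 0) ω) (D.noise (.clock m) ω / μ) with h | h
      · rw [h]
        nlinarith
      · rw [h, mul_div_assoc', ← div_mul_eq_mul_div]
        nlinarith
    rw [hsucc]
    nlinarith
  have hint : Integrable (fun ω => g (D.noise (.clock m) ω) *
      (f (D.noise (.shock m 0) ω) * D.discount θ m ω)) P := by
    refine hD.mono ?_ ?_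
    · exact ((hgm.comp (D.measurable_noise _)).mul ((hfm.comp (D.measurable_noise _)).mul
        (D.measurable_discount θ m))).aestronglyMeasurable
    · filter_upwards [hpt] with ω h
      obtain ⟨-, h1, h2, h3, h4⟩ := h
      rw [← mul_assoc, norm_mul, Real.norm_eq_abs, abs_of_nonneg (mul_nonneg h3 h1)]
      exact mul_le_of_le_one_left (norm_nonneg _) (mul_le_one₀ h4 h1 h2)
  calc ∫ ω, D.discount θ (m + 1) ω ∂P
      ≤ ∫ ω, (D.discount θ m ω - g (D.noise (.clock m) ω) *
        (f (D.noise (.shock m 0) ω) * D.discount θ m ω)) ∂P :=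
        integral_mono_ae (D.integrable_discount hσ hθ.le _) (hD.sub hint) (hpt.mono fun _ h => h.1)
    _ = _ := by
      rw [integral_sub hD hint, h2]
      change 0 < (D.pat m).lam 0 at hl
      change 0 < μ at hμ
      field_simp
      ring

/-- There are only two patterns, so the larger of the two contraction factors works for all periods.
-/
lemma exists_integral_discount_le [IsProbabilityMeasure P] (hσ : ∀ i, (σ i).Admissible) {θ : ℝ}
    (hθ : 0 < θ) :
    ∃ ρ : ℝ, 0 ≤ ρ ∧ ρ < 1 ∧ ∀ m, ∫ ω, D.discount θ m ω ∂P ≤ ρ ^ m := by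
  set q : Bool → ℝ := fun i => 1 - θ / ((σ i).lam 0 + θ) * (θ / ((σ i).mu 0 + θ)) with hq
  have hq1 : ∀ i, 0 ≤ q i ∧ q i < 1 := fun i => by
    have h1 := (hσ i).lam_pos 0
    have h2 := (hσ i).mu_pos 0
    have h3 : θ / ((σ i).lam 0 + θ) ≤ 1 := (div_le_one (by linarith)).2 (by linarith)
    have h4 : θ / ((σ i).mu 0 + θ) ≤ 1 := (div_le_one (by linarith)).2 (by linarith)
    have h5 : 0 < θ / ((σ i).lam 0 + θ) := by positivity
    have h6 : 0 < θ / ((σ i).mu 0 + θ) := by positivity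
    simp only [hq]
    constructor <;> nlinarith
  have hle : ∀ i, q i ≤ max (q true) (q false) := by
    rintro (_ | _)
    exacts [le_max_right _ _, le_max_left _ _]
  refine ⟨max (q true) (q false), (hq1 true).1.trans (le_max_left _ _),
    max_lt (hq1 _).2 (hq1 _).2, fun m => ?_⟩
  induction m with
  | zero => simp [discount]
  | succ m ih =>
    refine (D.integral_discount_succ_le hσ hθ m).trans ?_
    rw [pow_succ']
    exact mul_le_mul (hle (eps i₀ m)) ih (integral_nonneg fun ω => (Real.exp_pos _).le)
      ((hq1 true).1.trans (le_max_left _ _))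

/-- Each period lasts at least as long as the sojourn in its first state. These sojourns bound the
switching times below by sums with tractable Laplace transforms. -/
lemma le_switchTime (hσ : ∀ i, (σ i).Admissible) (m : ℕ) {ω : Ω}
    (h : ∀ m k, 0 < D.noise (.shock m k) ω) :
    ENNReal.ofReal (∑ k ∈ Finset.range m, D.soj k 0 ω) ≤ D.switchTime m ω := by
  have hτ : ∀ m k, 0 ≤ D.noise (.shock m k) ω := fun m k => (h m k).le
  rw [ENNReal.ofReal_sum_of_nonneg fun k _ => soj_nonneg (hτ k) 0]
  refine Finset.sum_le_sum fun k _ => ?_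
  rcases (soj_nonneg (hτ k) 0).eq_or_lt with h0 | h0
  · rw [← h0, ENNReal.ofReal_zero]
    exact zero_le
  · simpa using le_hold hσ (hτ k) h0

lemma ae_good [IsProbabilityMeasure P] (hσ : ∀ i, (σ i).Admissible) : ∀ᵐ ω ∂P, D.Good ω := by
  have h1 : ∀ᵐ ω ∂P, ∀ m, ∀ C : ℝ, ∃ n, C < D.shockTime m n ω := by
    refine ae_all_iff.2 fun m => ae_unbounded
      (fun n => (D.measurable_sigma_shockTime m n).mono (D.sigma_le _) le_rfl) ?_ ?_
    · filter_upwards [D.ae_shock_pos hσ] with ω h n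
      exact shockTime_nonneg (fun k => (h m k).le) n
    · have h2 := D.integral_discount_mul (P := P) hσ 0 m (a := fun _ => 1) (fun _ => zero_le_one)
      simp only [discount, zero_mul, neg_zero, Real.exp_zero, mul_one, one_mul, integral_const,
        probReal_univ, smul_eq_mul] at h2
      simp only [shockTime, h2]
      exact prod_div_add_one_tendsto_zero (hσ _).lam_pos (hσ _).nonexplosive
  -- Geometric decay of the Laplace transforms makes the sums of first sojourns unbounded, so the
  -- switchings cannot accumulate.
  have h2 : ∀ᵐ ω ∂P, ∀ C : ℝ, ∃ m, C < ∑ k ∈ Finset.range m, D.soj k 0 ω := by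
    refine ae_unbounded (fun m => ?_) ?_ ?_
    · exact Finset.measurable_fun_sum _ fun k _ =>
        (measurable_sigma_soj (Set.subset_univ _) (Set.mem_univ _) (Set.mem_univ _)).mono
          (D.sigma_le _) le_rfl
    · filter_upwards [D.ae_shock_pos hσ] with ω h m
      exact D.soj_zero_nonneg m h
    · obtain ⟨ρ, h0, h1, hle⟩ := D.exists_integral_discount_le (P := P) hσ one_pos
      simp only [discount, one_mul] at hle
      exact squeeze_zero (fun m => integral_nonneg fun ω => (Real.exp_pos _).le) hle
        (tendsto_pow_atTop_nhds_zero_of_lt_one h0 h1)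
  filter_upwards [D.ae_shock_pos hσ, D.ae_clock_pos, D.ae_no_tie, h1, h2] with ω h3 h4 h5 h6 h7
  refine ⟨h3, h4, h5, h6, fun C => ?_⟩
  obtain ⟨m, hm⟩ := h7 C
  refine ⟨m, lt_of_lt_of_le ?_ (D.le_switchTime hσ m h3)⟩
  rw [ENNReal.ofReal, ENNReal.coe_lt_coe]
  exact NNReal.coe_lt_coe.1 (hm.trans_le (Real.le_coe_toNNReal _))

end Driving
namespace Driving

variable {Ω : Type*} [MeasurableSpace Ω] {P : Measure Ω} {σ : Bool → Pattern} {i₀ : Bool}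
variable (D : Driving P σ i₀)

/-! ### The observed events -/

open Classical in
/-- The past of the state `(m, n)`, continued in such a way that this state, if it is entered before
the time `s`, is not left before the time `s`. -/
def frozen (m n : ℕ) (s : ℝ≥0) (ω : Ω) : Source → ℝ := fun x =>
  -- The margin 1 keeps both the clock and the shock strictly beyond the age at time s; every value
  -- used here depends on the past alone.
  if x = .clock m then D.expo m n ω + (D.pat m).mu n * D.age m n s ω + 1
  else if x = .shock m n then D.age m n s ω + 1 else D.trunc (past m n) ω x

lemma measurable_sigma_frozen (hσ : ∀ i, (σ i).Admissible) (m n : ℕ) (s : ℝ≥0) :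
    Measurable[D.sigma (past m n)] (D.frozen m n s) := by
  have ha := D.measurable_sigma_age hσ m n s
  refine @measurable_pi_lambda _ _ _ (D.sigma _) _ _ fun x => ?_
  by_cases h1 : x = .clock m
  · simp only [frozen, h1, if_true]
    exact ((D.measurable_sigma_expo m n).add (ha.const_mul _)).add_const _
  by_cases h2 : x = .shock m n
  · simp only [frozen, h2, if_true, reduceCtorEq, if_false]
    exact ha.add_const _
  · simp only [frozen, h1, h2, if_false]
    exact (measurable_pi_apply x).comp (D.measurable_trunc (past m n))

/-- The true and the frozen paths share the past and neither has left the state by time s, so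
`obs_congr` applies. The right-hand side is measurable with respect to the past. -/
lemma obs_eq_frozen (hσ : ∀ i, (σ i).Admissible) {m n : ℕ} {s u : ℝ≥0} (hu : u ≤ s) {ω : Ω}
    (g : D.Good ω) (hs : D.age m n s ω < D.soj m n ω) :
    D.obs u ω = (canonical hσ i₀).obs u (D.frozen m n s ω) := by
  have hpast : ∀ x ∈ past m n, D.noise x ω = D.frozen m n s ω x := by
    intro x hx
    have h1 : x ≠ .clock m := past_subset_compl_clock m n hx
    have h2 : x ≠ .shock m n := past_subset_compl_shock m n hx
    simp only [frozen, h1, h2, if_false, trunc, hx, if_true]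
  have h0 := D.age_nonneg m n s ω
  have hage : (canonical hσ i₀).age m n s (D.frozen m n s ω) = D.age m n s ω :=
    (age_congr (D := canonical hσ i₀) (ω := fun x => D.noise x ω) hpast s).symm
  have hexpo : (canonical hσ i₀).expo m n (D.frozen m n s ω) = D.expo m n ω :=
    (expo_congr (D := canonical hσ i₀) (ω := fun x => D.noise x ω) hpast le_rfl).symm
  refine obs_congr (D := canonical hσ i₀) (ω := fun x => D.noise x ω) (ω' := D.frozen m n s ω)
    hpast hσ
    (fun k => (g.shock_pos m k).le) (fun k => ?_) hu hs ?_
  · change 0 ≤ D.frozen m n s ω (.shock m k)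
    by_cases h2 : k = n
    · simp only [frozen, h2, if_true, reduceCtorEq, if_false]
      linarith
    · simp only [frozen, Source.shock.injEq, true_and, h2, reduceCtorEq, if_false, trunc]
      split_ifs
      exacts [(g.shock_pos m k).le, le_rfl]
  · rw [hage, lt_soj_iff h0, lt_zeta_iff hσ, hexpo]
    constructor
    · change _ < D.frozen m n s ω (.shock m n)
      simp [frozen]
    · change _ < D.frozen m n s ω (.clock m)
      simp [frozen, pat]

/-- The events which are determined by the past of the state `(m, n)` as long as this state is not
left before the time `s`. -/
@[reducible]
def pastEvents (m n : ℕ) (s : ℝ≥0) : MeasurableSpace Ω where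
  MeasurableSet' F := ∃ G, MeasurableSet[D.sigma (past m n)] G ∧
    ∀ ω, D.Good ω → D.age m n s ω < D.soj m n ω → (ω ∈ F ↔ ω ∈ G)
  measurableSet_empty := ⟨∅, @MeasurableSet.empty _ (D.sigma _), fun _ _ _ => Iff.rfl⟩
  measurableSet_compl := by
    rintro F ⟨G, hG, h⟩
    exact ⟨Gᶜ, hG.compl, fun ω g hs => not_congr (h ω g hs)⟩
  measurableSet_iUnion := by
    intro F hF
    choose G hG h using hF
    refine ⟨⋃ i, G i, MeasurableSet.iUnion hG, fun ω g hs => ?_⟩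
    simp only [Set.mem_iUnion, h _ ω g hs]

/-- Since `pastEvents` is a σ-algebra, it suffices to treat one observation time at once; there
`obs_eq_frozen` supplies the past event. -/
lemma filtration_le_pastEvents (hσ : ∀ i, (σ i).Admissible) (m n : ℕ) (s : ℝ≥0) :
    D.filtration s ≤ D.pastEvents m n s := by
  refine iSup₂_le fun u hu => ?_
  rintro _ ⟨B, hB, rfl⟩
  refine ⟨{ω | (canonical hσ i₀).obs u (D.frozen m n s ω) ∈ B}, ?_, fun ω g hs => ?_⟩
  · exact ((canonical hσ i₀).measurable_obs u).comp (D.measurable_sigma_frozen hσ m n s) hB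
  · change D.obs u ω ∈ B ↔ (canonical hσ i₀).obs u (D.frozen m n s ω) ∈ B
    rw [D.obs_eq_frozen hσ hu g hs]

/-! ### The compensator of one state -/

open Classical in
/-- The indicator of the shock which ends the sojourn in the state `(m, n)` up to `t`. -/
def shockInd (m n : ℕ) (t : ℝ≥0) (ω : Ω) : ℝ :=
  if D.noise (.shock m n) ω ≤ min (D.age m n t ω) (max 0 (D.zeta m n ω)) then 1 else 0

open Classical in
/-- The indicator of the switching which ends the sojourn in the state `(m, n)` up to `t`. -/
def switchInd (m n : ℕ) (t : ℝ≥0) (ω : Ω) : ℝ :=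
  if 0 < D.zeta m n ω ∧ D.zeta m n ω ≤ min (D.age m n t ω) (D.noise (.shock m n) ω) then 1 else 0

lemma inc_eq (m n : ℕ) (t : ℝ≥0) (ω : Ω) :
    D.inc m n t ω = (D.pat m).c n * D.dur m n t ω +
      D.noise (.inner m n) ω * D.shockInd m n t ω +
      D.noise (.outer m n) ω * D.switchInd m n t ω := rfl

section sigma

variable {D} {m n : ℕ} {T : Set Source} (hσ : ∀ i, (σ i).Admissible)
  (hT : past m n ⊆ T) (hc : .clock m ∈ T) (hs : .shock m n ∈ T) (t : ℝ≥0)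
include hσ hT hc hs

lemma measurable_sigma_dur : Measurable[D.sigma T] (D.dur m n t) :=
  ((D.measurable_sigma_age hσ m n t).mono (D.sigma_mono hT) le_rfl).min
    (measurable_sigma_soj hT hc hs)

lemma measurable_sigma_shockInd : Measurable[D.sigma T] (D.shockInd m n t) := by
  refine Measurable.ite ?_ (@measurable_const _ _ _ (D.sigma T) _)
    (@measurable_const _ _ _ (D.sigma T) _)
  exact measurableSet_le (D.measurable_sigma_noise hs)
    (((D.measurable_sigma_age hσ m n t).mono (D.sigma_mono hT) le_rfl).min
      ((@measurable_const _ _ _ (D.sigma T) _).max (measurable_sigma_zeta hT hc)))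

lemma measurable_sigma_switchInd : Measurable[D.sigma T] (D.switchInd m n t) := by
  refine Measurable.ite ?_ (@measurable_const _ _ _ (D.sigma T) _)
    (@measurable_const _ _ _ (D.sigma T) _)
  have hz := measurable_sigma_zeta (D := D) hT hc
  exact (measurableSet_lt (@measurable_const _ _ _ (D.sigma T) _) hz).inter
    (measurableSet_le hz (((D.measurable_sigma_age hσ m n t).mono (D.sigma_mono hT) le_rfl).min
      (D.measurable_sigma_noise hs)))

end sigma

lemma measurable_dur (hσ : ∀ i, (σ i).Admissible) (m n : ℕ) (t : ℝ≥0) :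
    Measurable (D.dur m n t) :=
  (measurable_sigma_dur hσ (Set.subset_univ _) (Set.mem_univ _) (Set.mem_univ _) t).mono
    (D.sigma_le _) le_rfl

lemma measurable_shockInd (hσ : ∀ i, (σ i).Admissible) (m n : ℕ) (t : ℝ≥0) :
    Measurable (D.shockInd m n t) :=
  (measurable_sigma_shockInd hσ (Set.subset_univ _) (Set.mem_univ _) (Set.mem_univ _) t).mono
    (D.sigma_le _) le_rfl

lemma measurable_switchInd (hσ : ∀ i, (σ i).Admissible) (m n : ℕ) (t : ℝ≥0) :
    Measurable (D.switchInd m n t) :=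
  (measurable_sigma_switchInd hσ (Set.subset_univ _) (Set.mem_univ _) (Set.mem_univ _) t).mono
    (D.sigma_le _) le_rfl

lemma shockInd_mem (m n : ℕ) (t : ℝ≥0) (ω : Ω) :
    0 ≤ D.shockInd m n t ω ∧ D.shockInd m n t ω ≤ 1 := by
  rw [shockInd]; split_ifs <;> norm_num

lemma switchInd_mem (m n : ℕ) (t : ℝ≥0) (ω : Ω) :
    0 ≤ D.switchInd m n t ω ∧ D.switchInd m n t ω ≤ 1 := by
  rw [switchInd]; split_ifs <;> norm_num

variable {D}

/-- Both interval endpoints are free of `shock m n`, which is what `setIntegral_compensator`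
requires. -/
lemma shockInd_sub {m n : ℕ} {s t : ℝ≥0} (hst : s ≤ t) (ω : Ω) :
    D.shockInd m n t ω - D.shockInd m n s ω =
      (Set.Ioc (min (D.age m n s ω) (max 0 (D.zeta m n ω)))
        (min (D.age m n t ω) (max 0 (D.zeta m n ω)))).indicator (fun _ => 1)
          (D.noise (.shock m n) ω) := by
  rw [shockInd, shockInd, Set.indicator_apply]
  have h : min (D.age m n s ω) (max 0 (D.zeta m n ω)) ≤ min (D.age m n t ω) (max 0 (D.zeta m n ω)) :=
    min_le_min_right _ (age_mono D m n ω hst)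
  generalize min (D.age m n s ω) (max 0 (D.zeta m n ω)) = A at *
  generalize min (D.age m n t ω) (max 0 (D.zeta m n ω)) = B at *
  simp only [Set.mem_Ioc]
  split_ifs <;> grind

/-- The counterpart for switchings: on the scale of accumulated intensity, the time spent becomes a
difference of minima of the clock with boundaries that do not involve it. -/
lemma mu_mul_dur (hσ : ∀ i, (σ i).Admissible) (m n : ℕ) (t : ℝ≥0) {ω : Ω}
    (h : 0 ≤ D.noise (.shock m n) ω) :
    (D.pat m).mu n * D.dur m n t ω =
      min (D.noise (.clock m) ω)
        (D.expo m n ω + (D.pat m).mu n * min (D.age m n t ω) (D.noise (.shock m n) ω)) -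
      min (D.noise (.clock m) ω) (D.expo m n ω) := by
  have hμ : 0 < (D.pat m).mu n := (hσ _).mu_pos n
  have hy : 0 ≤ min (D.age m n t ω) (D.noise (.shock m n) ω) := le_min (D.age_nonneg m n t ω) h
  have he : D.noise (.clock m) ω = D.expo m n ω + (D.pat m).mu n * D.zeta m n ω := by
    rw [zeta, mul_div_cancel₀ _ hμ.ne', add_sub_cancel]
  rw [dur, soj, ← min_assoc, he]
  set y := min (D.age m n t ω) (D.noise (.shock m n) ω)
  -- For nonpositive `zeta` the clock rings no later than the formal entrance and both sides vanish.
  rcases le_total (D.zeta m n ω) 0 with hz | hz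
  · rw [max_eq_left hz, min_eq_right hy, min_eq_left (by nlinarith), min_eq_left (by nlinarith)]
    ring
  · rw [max_eq_right hz, min_eq_right (a := _ + _) (b := D.expo m n ω) (by nlinarith),
      min_add_add_left, ← mul_min_of_nonneg _ _ hμ.le, min_comm y]
    ring

lemma switchInd_sub (hσ : ∀ i, (σ i).Admissible) {m n : ℕ} {s t : ℝ≥0} (hst : s ≤ t) {ω : Ω}
    (h : 0 ≤ D.noise (.shock m n) ω) :
    D.switchInd m n t ω - D.switchInd m n s ω =
      (Set.Ioc
        (D.expo m n ω + (D.pat m).mu n * min (D.age m n s ω) (D.noise (.shock m n) ω))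
        (D.expo m n ω + (D.pat m).mu n * min (D.age m n t ω) (D.noise (.shock m n) ω))).indicator
          (fun _ => 1) (D.noise (.clock m) ω) := by
  have hμ : 0 < (D.pat m).mu n := (hσ _).mu_pos n
  have hy : 0 ≤ min (D.age m n s ω) (D.noise (.shock m n) ω) := le_min (D.age_nonneg m n s ω) h
  have h' : min (D.age m n s ω) (D.noise (.shock m n) ω) ≤
    min (D.age m n t ω) (D.noise (.shock m n) ω) := min_le_min_right _ (age_mono D m n ω hst)
  have he : D.noise (.clock m) ω = D.expo m n ω + (D.pat m).mu n * D.zeta m n ω := by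
    rw [zeta, mul_div_cancel₀ _ hμ.ne', add_sub_cancel]
  rw [switchInd, switchInd, Set.indicator_apply, he]
  simp only [Set.mem_Ioc, add_lt_add_iff_left, add_le_add_iff_left, mul_lt_mul_iff_right₀ hμ,
    mul_le_mul_iff_right₀ hμ]
  generalize min (D.age m n s ω) (D.noise (.shock m n) ω) = A at *
  generalize min (D.age m n t ω) (D.noise (.shock m n) ω) = B at *
  split_ifs <;> grind

end Driving
namespace Driving

variable {Ω : Type*} [MeasurableSpace Ω] {P : Measure Ω} {σ : Bool → Pattern} {i₀ : Bool}
variable (D : Driving P σ i₀) [IsProbabilityMeasure P] (hσ : ∀ i, (σ i).Admissible)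
include hσ

lemma setIntegral_shockInd_sub (m n : ℕ) {s t : ℝ≥0} (hst : s ≤ t) {G : Set Ω}
    (hG : MeasurableSet[D.sigma (past m n)] G) :
    ∫ ω in G, (D.shockInd m n t ω - D.shockInd m n s ω) ∂P =
      (D.pat m).lam n * ∫ ω in G, (D.dur m n t ω - D.dur m n s ω) ∂P := by
  have hle := D.sigma_mono (past_subset_compl_shock m n)
  have hm : ∀ u, Measurable[D.sigma {Source.shock m n}ᶜ] fun ω =>
      min (D.age m n u ω) (max 0 (D.zeta m n ω)) := fun u =>
    ((D.measurable_sigma_age hσ m n u).mono hle le_rfl).min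
      ((@measurable_const _ _ _ (D.sigma _) _).max
        (measurable_sigma_zeta (past_subset_compl_shock m n) (by simp)))
  have hd : ∀ u ω, D.dur m n u ω =
      min (D.noise (.shock m n) ω) (min (D.age m n u ω) (max 0 (D.zeta m n ω))) := fun u ω => by
    rw [dur, soj, min_left_comm]
  simp_rw [shockInd_sub hst, hd]
  refine D.setIntegral_compensator ((hσ _).lam_pos n) (sourceLaw_shock m n) (hle _ hG) (hm s) (hm t)
    (Filter.Eventually.of_forall fun ω => ⟨le_min (D.age_nonneg m n s ω) (le_max_left _ _), ?_⟩)
  exact min_le_min_right _ (age_mono D m n ω hst)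

lemma setIntegral_switchInd_sub (m n : ℕ) {s t : ℝ≥0} (hst : s ≤ t) {G : Set Ω}
    (hG : MeasurableSet[D.sigma (past m n)] G) :
    ∫ ω in G, (D.switchInd m n t ω - D.switchInd m n s ω) ∂P =
      (D.pat m).mu n * ∫ ω in G, (D.dur m n t ω - D.dur m n s ω) ∂P := by
  have hle := D.sigma_mono (past_subset_compl_clock m n)
  set B : ℝ≥0 → Ω → ℝ := fun u ω =>
    D.expo m n ω + (D.pat m).mu n * min (D.age m n u ω) (D.noise (.shock m n) ω) with hB
  have hm : ∀ u, Measurable[D.sigma {Source.clock m}ᶜ] (B u) := fun u =>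
    ((D.measurable_sigma_expo m n).mono hle le_rfl).add
      ((((D.measurable_sigma_age hσ m n u).mono hle le_rfl).min
        (D.measurable_sigma_noise (by simp))).const_mul _)
  have hμ : 0 < (D.pat m).mu n := (hσ _).mu_pos n
  have h := D.setIntegral_compensator one_pos (sourceLaw_clock m) (hle _ hG) (hm s) (hm t) (by
    filter_upwards [D.ae_shock_pos hσ] with ω hω
    have h1 := expo_nonneg hσ (fun k => (hω m k).le) n
    have h2 : 0 ≤ min (D.age m n s ω) (D.noise (.shock m n) ω) :=
      le_min (D.age_nonneg m n s ω) (hω m n).le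
    have h3 : min (D.age m n s ω) (D.noise (.shock m n) ω) ≤
      min (D.age m n t ω) (D.noise (.shock m n) ω) := min_le_min_right _ (age_mono D m n ω hst)
    exact ⟨by positivity, by simp only [hB]; gcongr⟩)
  rw [one_mul] at h
  rw [← integral_const_mul]
  refine Eq.trans ?_ (h.trans ?_)
  · refine integral_congr_ae (ae_restrict_of_ae ?_)
    filter_upwards [D.ae_shock_pos hσ] with ω hω
    exact switchInd_sub hσ hst (hω m n).le
  · refine integral_congr_ae (ae_restrict_of_ae ?_)
    filter_upwards [D.ae_shock_pos hσ] with ω hω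
    rw [mul_sub, mu_mul_dur hσ m n t (hω m n).le, mu_mul_dur hσ m n s (hω m n).le,
      sub_sub_sub_cancel_right]

lemma integrable_dur (m n : ℕ) (t : ℝ≥0) : Integrable (D.dur m n t) P := by
  refine Integrable.of_bound (D.measurable_dur hσ m n t).aestronglyMeasurable t ?_
  filter_upwards [D.ae_shock_pos hσ] with ω hω
  have h : 0 ≤ D.dur m n t ω :=
    le_min (D.age_nonneg m n t ω) (soj_nonneg (fun k => (hω m k).le) n)
  rw [Real.norm_eq_abs, abs_of_nonneg h]
  exact (min_le_left _ _).trans (D.age_le m n t ω)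

omit [IsProbabilityMeasure P] in
lemma integrable_inner (m n : ℕ) : Integrable (D.noise (.inner m n)) P :=
  D.integrable_source ((hσ (eps i₀ m)).rLaw_integrable n)

omit [IsProbabilityMeasure P] in
lemma integrable_outer (m n : ℕ) : Integrable (D.noise (.outer m n)) P :=
  D.integrable_source ((hσ (eps i₀ m)).RLaw_integrable n)

omit [IsProbabilityMeasure P] in
lemma integrable_inner_mul (m n : ℕ) (t : ℝ≥0) :
    Integrable (fun ω => D.noise (.inner m n) ω * D.shockInd m n t ω) P := by
  refine (D.integrable_inner hσ m n).mul_bdd (c := 1)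
    (D.measurable_shockInd hσ m n t).aestronglyMeasurable
    (Filter.Eventually.of_forall fun ω => ?_)
  have h := D.shockInd_mem m n t ω
  rw [Real.norm_eq_abs, abs_of_nonneg h.1]
  exact h.2

omit [IsProbabilityMeasure P] in
lemma integrable_outer_mul (m n : ℕ) (t : ℝ≥0) :
    Integrable (fun ω => D.noise (.outer m n) ω * D.switchInd m n t ω) P := by
  refine (D.integrable_outer hσ m n).mul_bdd (c := 1)
    (D.measurable_switchInd hσ m n t).aestronglyMeasurable
    (Filter.Eventually.of_forall fun ω => ?_)
  have h := D.switchInd_mem m n t ω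
  rw [Real.norm_eq_abs, abs_of_nonneg h.1]
  exact h.2

lemma integrable_inc (m n : ℕ) (t : ℝ≥0) : Integrable (D.inc m n t) P :=
  (((D.integrable_dur hσ m n t).const_mul _).add (D.integrable_inner_mul hσ m n t)).add
    (D.integrable_outer_mul hσ m n t)

/-- The amplitudes are independent of G and of the indicators, so they may be replaced by their
means. The compensators then turn the indicators into λ_n and μ_n times the occupation time, and the
coefficients add up to Δ(n). -/
lemma setIntegral_inc_sub_of_past (m n : ℕ) {s t : ℝ≥0} (hst : s ≤ t) {G : Set Ω}
    (hG : MeasurableSet[D.sigma (past m n)] G) :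
    ∫ ω in G, (D.inc m n t ω - D.inc m n s ω) ∂P =
      (D.pat m).Delta n * ∫ ω in G, (D.dur m n t ω - D.dur m n s ω) ∂P := by
  have hin : ∫ ω in G, D.noise (.inner m n) ω * (D.shockInd m n t ω - D.shockInd m n s ω) ∂P =
      (D.pat m).rMean n * ∫ ω in G, (D.shockInd m n t ω - D.shockInd m n s ω) ∂P := by
    refine D.setIntegral_source_mul measurable_id
      (D.sigma_mono (past_subset_compl_inner m n) _ hG) (Measurable.sub ?_ ?_) <;>
    exact measurable_sigma_shockInd hσ (past_subset_compl_inner m n) (by simp) (by simp) _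
  have hout : ∫ ω in G, D.noise (.outer m n) ω * (D.switchInd m n t ω - D.switchInd m n s ω) ∂P =
      (D.pat m).RMean n * ∫ ω in G, (D.switchInd m n t ω - D.switchInd m n s ω) ∂P := by
    refine D.setIntegral_source_mul measurable_id
      (D.sigma_mono (past_subset_compl_outer m n) _ hG) (Measurable.sub ?_ ?_) <;>
    exact measurable_sigma_switchInd hσ (past_subset_compl_outer m n) (by simp) (by simp) _
  rw [D.setIntegral_shockInd_sub hσ m n hst hG] at hin
  rw [D.setIntegral_switchInd_sub hσ m n hst hG] at hout
  have he : ∀ ω, D.inc m n t ω - D.inc m n s ω =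
      (D.pat m).c n * (D.dur m n t ω - D.dur m n s ω) +
      D.noise (.inner m n) ω * (D.shockInd m n t ω - D.shockInd m n s ω) +
      D.noise (.outer m n) ω * (D.switchInd m n t ω - D.switchInd m n s ω) := fun ω => by
    rw [inc_eq, inc_eq]
    ring
  have h1 : IntegrableOn (fun ω => (D.pat m).c n * (D.dur m n t ω - D.dur m n s ω)) G P :=
    (((D.integrable_dur hσ m n t).sub (D.integrable_dur hσ m n s)).const_mul _).integrableOn
  have h2 : IntegrableOn (fun ω =>
      D.noise (.inner m n) ω * (D.shockInd m n t ω - D.shockInd m n s ω)) G P := by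
    simp_rw [mul_sub]
    exact ((D.integrable_inner_mul hσ m n t).sub (D.integrable_inner_mul hσ m n s)).integrableOn
  have h3 : IntegrableOn (fun ω =>
      D.noise (.outer m n) ω * (D.switchInd m n t ω - D.switchInd m n s ω)) G P := by
    simp_rw [mul_sub]
    exact ((D.integrable_outer_mul hσ m n t).sub (D.integrable_outer_mul hσ m n s)).integrableOn
  simp_rw [he]
  have h12 : IntegrableOn (fun ω => (D.pat m).c n * (D.dur m n t ω - D.dur m n s ω) +
      D.noise (.inner m n) ω * (D.shockInd m n t ω - D.shockInd m n s ω)) G P := h1.add h2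
  rw [integral_add h12 h3, integral_add h1 h2, hin, hout, integral_const_mul,
    Pattern.Delta]
  ring

/-- The compensator of the contribution of one state. -/
lemma setIntegral_inc_sub (m n : ℕ) {s t : ℝ≥0} (hst : s ≤ t) {F : Set Ω}
    (hF : MeasurableSet[D.filtration s] F) :
    ∫ ω in F, (D.inc m n t ω - D.inc m n s ω) ∂P =
      (D.pat m).Delta n * ∫ ω in F, (D.dur m n t ω - D.dur m n s ω) ∂P := by
  obtain ⟨G, hG, hFG⟩ := D.filtration_le_pastEvents hσ m n s F hF
  -- F and G agree on paths that have not left the state by time s, and on the others the integrands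
  -- below vanish, so F may be replaced by G.
  have key : ∀ f : Ω → ℝ, (∀ ω, D.Good ω → D.soj m n ω ≤ D.age m n s ω → f ω = 0) →
      ∫ ω in F, f ω ∂P = ∫ ω in G, f ω ∂P := by
    intro f hf
    rw [← integral_indicator (D.filtration.le s F hF), ← integral_indicator (D.sigma_le _ G hG)]
    refine integral_congr_ae ?_
    filter_upwards [D.ae_good hσ] with ω g
    rcases lt_or_ge (D.age m n s ω) (D.soj m n ω) with h | h
    · by_cases hG' : ω ∈ G
      · rw [Set.indicator_of_mem hG', Set.indicator_of_mem ((hFG ω g h).2 hG')]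
      · rw [Set.indicator_of_notMem hG', Set.indicator_of_notMem (mt (hFG ω g h).1 hG')]
    · rw [Set.indicator_apply_eq_zero.2 fun _ => hf ω g h,
        Set.indicator_apply_eq_zero.2 fun _ => hf ω g h]
  rw [key, key, D.setIntegral_inc_sub_of_past hσ m n hst hG]
  · intro ω _ h
    rw [dur, dur, min_eq_right h, min_eq_right (h.trans (age_mono D m n ω hst)), sub_self]
  · intro ω _ h
    rw [inc, inc, contrib_of_soj_le h (age_mono D m n ω hst), sub_self]

/-- The same compensation from time 0, with absolute values of the amplitudes in place of the
amplitudes. -/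
lemma integral_abs_inc_le (m n : ℕ) (t : ℝ≥0) :
    ∫ ω, |D.inc m n t ω| ∂P ≤ (|(D.pat m).c n| + (D.pat m).lam n * (D.pat m).rAbs n +
      (D.pat m).mu n * (D.pat m).RAbs n) * ∫ ω, D.dur m n t ω ∂P := by
  have hd : ∀ ω, D.dur m n 0 ω = min 0 (D.soj m n ω) ∧ D.age m n 0 ω = 0 := fun ω => by
    rw [dur, age_of_le_entry (by simp)]
    exact ⟨rfl, rfl⟩
  have h0 : ∀ᵐ ω ∂P, D.dur m n 0 ω = 0 ∧ D.shockInd m n 0 ω = 0 ∧ D.switchInd m n 0 ω = 0 := by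
    filter_upwards [D.ae_shock_pos hσ] with ω hω
    refine ⟨?_, if_neg ?_, if_neg ?_⟩
    · rw [(hd ω).1, min_eq_left (soj_nonneg (fun k => (hω m k).le) n)]
    · rw [(hd ω).2]
      exact fun h => absurd (h.trans (min_le_left _ _)) (not_le.2 (hω m n))
    · rw [(hd ω).2]
      exact fun h => absurd (h.2.trans (min_le_left _ _)) (not_le.2 h.1)
  have hdur : ∫ ω, (D.dur m n t ω - D.dur m n 0 ω) ∂P = ∫ ω, D.dur m n t ω ∂P :=
    integral_congr_ae (h0.mono fun ω h => by simp only [h.1, sub_zero])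
  have hsh : ∫ ω, D.shockInd m n t ω ∂P = (D.pat m).lam n * ∫ ω, D.dur m n t ω ∂P := by
    have h := D.setIntegral_shockInd_sub hσ m n (zero_le : (0 : ℝ≥0) ≤ t)
      (@MeasurableSet.univ _ (D.sigma _))
    simp only [Measure.restrict_univ] at h
    rw [← hdur, ← h]
    exact integral_congr_ae (h0.mono fun ω h => by simp only [h.2.1, sub_zero])
  have hsw : ∫ ω, D.switchInd m n t ω ∂P = (D.pat m).mu n * ∫ ω, D.dur m n t ω ∂P := by
    have h := D.setIntegral_switchInd_sub hσ m n (zero_le : (0 : ℝ≥0) ≤ t)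
      (@MeasurableSet.univ _ (D.sigma _))
    simp only [Measure.restrict_univ] at h
    rw [← hdur, ← h]
    exact integral_congr_ae (h0.mono fun ω h => by simp only [h.2.2, sub_zero])
  have hin : ∫ ω, |D.noise (.inner m n) ω| * D.shockInd m n t ω ∂P =
      (D.pat m).rAbs n * ∫ ω, D.shockInd m n t ω ∂P :=
    D.integral_source_mul measurable_id.abs
      (measurable_sigma_shockInd hσ (past_subset_compl_inner m n) (by simp) (by simp) t)
  have hout : ∫ ω, |D.noise (.outer m n) ω| * D.switchInd m n t ω ∂P =
      (D.pat m).RAbs n * ∫ ω, D.switchInd m n t ω ∂P :=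
    D.integral_source_mul measurable_id.abs
      (measurable_sigma_switchInd hσ (past_subset_compl_outer m n) (by simp) (by simp) t)
  have i1 := (D.integrable_dur hσ m n t).const_mul |(D.pat m).c n|
  have i2 : Integrable (fun ω => |D.noise (.inner m n) ω| * D.shockInd m n t ω) P := by
    refine (D.integrable_inner_mul hσ m n t).abs.congr (Filter.Eventually.of_forall fun ω => ?_)
    simp only [abs_mul, abs_of_nonneg (D.shockInd_mem m n t ω).1]
  have i3 : Integrable (fun ω => |D.noise (.outer m n) ω| * D.switchInd m n t ω) P := by
    refine (D.integrable_outer_mul hσ m n t).abs.congr (Filter.Eventually.of_forall fun ω => ?_)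
    simp only [abs_mul, abs_of_nonneg (D.switchInd_mem m n t ω).1]
  have i12 : Integrable (fun ω => |(D.pat m).c n| * D.dur m n t ω +
      |D.noise (.inner m n) ω| * D.shockInd m n t ω) P := i1.add i2
  calc ∫ ω, |D.inc m n t ω| ∂P
      ≤ ∫ ω, (|(D.pat m).c n| * D.dur m n t ω + |D.noise (.inner m n) ω| * D.shockInd m n t ω +
          |D.noise (.outer m n) ω| * D.switchInd m n t ω) ∂P := by
        refine integral_mono_ae (D.integrable_inc hσ m n t).abs (i12.add i3) ?_
        filter_upwards [D.ae_shock_pos hσ] with ω hω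
        have h : 0 ≤ D.dur m n t ω :=
          le_min (D.age_nonneg m n t ω) (soj_nonneg (fun k => (hω m k).le) n)
        refine (abs_add_three _ _ _).trans (le_of_eq ?_)
        have h1 := abs_of_nonneg (D.shockInd_mem m n t ω).1
        have h2 := abs_of_nonneg (D.switchInd_mem m n t ω).1
        have h3 := abs_of_nonneg h
        rw [shockInd] at h1
        rw [switchInd] at h2
        rw [dur] at h3
        simp only [abs_mul, h1, h2, h3]
        rfl
    _ = _ := by
        rw [integral_add i12 i3, integral_add i1 i2, integral_const_mul, hin, hout, hsh, hsw]
        ring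

end Driving
-- Expected occupation times and integrability under (C).
-- In integral form, exp(-μu) = exp(θu) exp(-(μ+θ)u) ≤ exp(θx) exp(-(μ+θ)u) for u ≤ y ≤ x, and the
-- domain [0, y] is enlarged to [0, z].
lemma one_sub_exp_div_le {μ θ x y z : ℝ} (hμ : 0 < μ) (hθ : 0 < θ) (hy : 0 ≤ y) (hyx : y ≤ x)
    (hyz : y ≤ z) :
    (1 - Real.exp (-(μ * y))) / μ ≤
      Real.exp (θ * x) * ((1 - Real.exp (-((μ + θ) * z))) / (μ + θ)) := by
  have h1 : (1 - Real.exp (-(μ * y))) / μ ≤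
      Real.exp (θ * y) * ((1 - Real.exp (-((μ + θ) * y))) / (μ + θ)) := by
    have h2 : Real.exp (θ * y) * Real.exp (-((μ + θ) * y)) = Real.exp (-(μ * y)) := by
      rw [← Real.exp_add]
      congr 1
      ring
    rw [← mul_div_assoc, mul_sub, mul_one, h2, div_le_div_iff₀ hμ (by linarith)]
    nlinarith [Real.add_one_le_exp (θ * y), Real.add_one_le_exp (-(μ * y))]
  refine h1.trans (mul_le_mul (Real.exp_le_exp.2 (by gcongr)) ?_ ?_ (Real.exp_pos _).le)
  · gcongr
  · refine div_nonneg ?_ (by linarith)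
    rw [sub_nonneg, Real.exp_le_one_iff, neg_nonpos]
    positivity

namespace Driving

variable {Ω : Type*} [MeasurableSpace Ω] {P : Measure Ω} {σ : Bool → Pattern} {i₀ : Bool}
variable (D : Driving P σ i₀) [IsProbabilityMeasure P]

/-- The clock is integrated out: the compensator expresses μ_n E dur as the probability that the
clock falls between two boundaries independent of it. -/
lemma integral_dur_eq (hσ : ∀ i, (σ i).Admissible) (m n : ℕ) (t : ℝ≥0) :
    ∫ ω, D.dur m n t ω ∂P = ∫ ω, Real.exp (-D.expo m n ω) *
      ((1 - Real.exp (-((D.pat m).mu n * min (D.age m n t ω) (D.noise (.shock m n) ω)))) /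
        (D.pat m).mu n) ∂P := by
  have hle := D.sigma_mono (past_subset_compl_clock m n)
  have hμ : 0 < (D.pat m).mu n := (hσ _).mu_pos n
  set B : Ω → ℝ := fun ω =>
    D.expo m n ω + (D.pat m).mu n * min (D.age m n t ω) (D.noise (.shock m n) ω) with hB
  have hA : Measurable[D.sigma {Source.clock m}ᶜ] (D.expo m n) :=
    (D.measurable_sigma_expo m n).mono hle le_rfl
  have hBm : Measurable[D.sigma {Source.clock m}ᶜ] B := hA.add
    ((((D.measurable_sigma_age hσ m n t).mono hle le_rfl).min
      (D.measurable_sigma_noise (by simp))).const_mul _)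
  have hAB : ∀ᵐ ω ∂P, 0 ≤ D.expo m n ω ∧ D.expo m n ω ≤ B ω := by
    filter_upwards [D.ae_shock_pos hσ] with ω hω
    refine ⟨expo_nonneg hσ (fun k => (hω m k).le) n, le_add_of_nonneg_right ?_⟩
    exact mul_nonneg hμ.le (le_min (D.age_nonneg m n t ω) (hω m n).le)
  have h := D.setIntegral_compensator one_pos (sourceLaw_clock m)
    (@MeasurableSet.univ _ (D.sigma _)) hA hBm hAB
  have h' := D.integral_indicator_Ioc one_pos (sourceLaw_clock m) hA hBm hAB
  simp only [Measure.restrict_univ, one_mul] at h h'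
  rw [h'] at h
  have h2 : ∫ ω, (min (D.noise (.clock m) ω) (B ω) - min (D.noise (.clock m) ω) (D.expo m n ω)) ∂P =
      (D.pat m).mu n * ∫ ω, D.dur m n t ω ∂P := by
    rw [← integral_const_mul]
    refine integral_congr_ae ?_
    filter_upwards [D.ae_shock_pos hσ] with ω hω
    rw [mu_mul_dur hσ m n t (hω m n).le]
  rw [h2] at h
  rw [← mul_right_inj' hμ.ne', ← h, ← integral_const_mul]
  refine integral_congr_ae (Filter.Eventually.of_forall fun ω => ?_)
  simp only [hB, neg_add, Real.exp_add]
  field_simp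

/-- The discounted weight of the `n`-th state. -/
def weight (p : Pattern) (θ : ℝ) (n : ℕ) : ℝ :=
  (∏ k ∈ Finset.range n, p.lam k / (p.lam k + p.mu k + θ)) / (p.lam n + p.mu n + θ)

/-- If a state is entered before t, then exp(θ(t - entrance time)) ≥ 1. Inserting this factor
removes t from the integrand and leaves exponentials of independent shock times, whose expectations
multiply. -/
lemma integral_dur_le (hσ : ∀ i, (σ i).Admissible) {θ : ℝ} (hθ : 0 < θ) (m n : ℕ) (t : ℝ≥0) :
    ∫ ω, D.dur m n t ω ∂P ≤
      Real.exp (θ * t) * (weight (D.pat m) θ n * ∫ ω, D.discount θ m ω ∂P) := by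
  have hμ : 0 < (D.pat m).mu n := (hσ _).mu_pos n
  have hμ' : ∀ k, 0 < (D.pat m).mu k := (hσ _).mu_pos
  have hl : 0 < (D.pat m).lam n := (hσ _).lam_pos n
  set E : ℕ → Ω → ℝ := fun j ω =>
    Real.exp (-∑ k ∈ Finset.range j, ((D.pat m).mu k + θ) * D.noise (.shock m k) ω) *
      D.discount θ m ω with hE
  have hEm : ∀ j, Measurable (E j) := fun j => by
    refine Measurable.mul (Real.measurable_exp.comp (Measurable.neg ?_)) (D.measurable_discount θ m)
    exact Finset.measurable_fun_sum _ fun k _ => (D.measurable_noise _).const_mul _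
  have hEi : ∀ j, Integrable (E j) P := fun j => by
    refine (D.integrable_discount hσ hθ.le m).mono (hEm j).aestronglyMeasurable ?_
    filter_upwards [D.ae_shock_pos hσ] with ω hω
    rw [norm_mul]
    refine mul_le_of_le_one_left (norm_nonneg _) ?_
    rw [Real.norm_eq_abs, abs_of_pos (Real.exp_pos _), Real.exp_le_one_iff, neg_nonpos]
    exact Finset.sum_nonneg fun k _ => mul_nonneg (add_pos (hμ' k) hθ).le (hω m k).le
  have hEint := D.integral_discount_mul (P := P) hσ θ m
    (a := fun k => (D.pat m).mu k + θ) (fun k => (add_pos (hμ' k) hθ).le)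
  rw [D.integral_dur_eq hσ]
  -- The difference of consecutive `E` carries the factor 1 - exp(-(μ_n + θ) τ_n) from
  -- `one_sub_exp_div_le`, where τ_n is the n-th shock time.
  calc _ ≤ ∫ ω, Real.exp (θ * t) / ((D.pat m).mu n + θ) * (E n ω - E (n + 1) ω) ∂P := by
        refine integral_mono_of_nonneg ?_ (((hEi n).sub (hEi (n + 1))).const_mul _) ?_
        · filter_upwards [D.ae_shock_pos hσ] with ω hω
          refine mul_nonneg (Real.exp_pos _).le (div_nonneg ?_ hμ.le)
          rw [sub_nonneg, Real.exp_le_one_iff, neg_nonpos]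
          exact mul_nonneg hμ.le (le_min (D.age_nonneg m n t ω) (hω m n).le)
        · filter_upwards [D.ae_shock_pos hσ] with ω hω
          have hτ : ∀ k, 0 ≤ D.noise (.shock m k) ω := fun k => (hω m k).le
          have hsucc : E n ω - E (n + 1) ω = E n ω *
              (1 - Real.exp (-(((D.pat m).mu n + θ) * D.noise (.shock m n) ω))) := by
            simp only [hE, Finset.sum_range_succ, neg_add, Real.exp_add]
            ring
          have h1 : 0 ≤ 1 - Real.exp (-(((D.pat m).mu n + θ) * D.noise (.shock m n) ω)) := by
            rw [sub_nonneg, Real.exp_le_one_iff, neg_nonpos]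
            exact mul_nonneg (by linarith) (hτ n)
          have hEp : 0 < E n ω := mul_pos (Real.exp_pos _) (D.discount_pos θ m ω)
          rw [hsucc]
          rcases le_or_gt (t : ℝ≥0∞) (D.entry m n ω) with hent | hent
          · rw [age_of_le_entry hent, min_eq_left (hτ n)]
            simp only [mul_zero, neg_zero, Real.exp_zero, sub_self, zero_div]
            positivity
          · obtain ⟨h2, h3⟩ := shockTime_le_of_entry_le hent.le
            have h4 := D.le_switchTime hσ m hω
            rw [ENNReal.ofReal_le_iff_le_toReal (ne_top_of_le_ne_top ENNReal.coe_ne_top h2)] at h4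
            -- The sum of first sojourns stands in for the switching time, because its discount has
            -- an expectation of geometric decay.
            have hage : D.age m n t ω ≤
                t - ∑ k ∈ Finset.range m, D.soj k 0 ω - D.shockTime m n ω := by
              rw [age_of_switchTime_le hτ h2, max_eq_right (by linarith)]
              linarith
            have h5 := one_sub_exp_div_le (μ := (D.pat m).mu n) (θ := θ)
              (x := t - ∑ k ∈ Finset.range m, D.soj k 0 ω - D.shockTime m n ω)
              (y := min (D.age m n t ω) (D.noise (.shock m n) ω))
              (z := D.noise (.shock m n) ω) hμ hθ
              (le_min (D.age_nonneg m n t ω) (hτ n)) ((min_le_left _ _).trans hage) (min_le_right _ _)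
            refine (mul_le_mul_of_nonneg_left h5 (Real.exp_pos _).le).trans (le_of_eq ?_)
            have h6 : Real.exp (-D.expo m n ω) *
                Real.exp (θ * (t - ∑ k ∈ Finset.range m, D.soj k 0 ω - D.shockTime m n ω)) =
                Real.exp (θ * t) * E n ω := by
              simp only [hE, discount, ← Real.exp_add]
              congr 1
              simp only [add_mul, Finset.sum_add_distrib, ← Finset.mul_sum]
              rw [← expo, ← shockTime]
              ring
            rw [← mul_assoc, h6]
            ring
    _ = _ := by
        rw [integral_const_mul, integral_sub (hEi _) (hEi _), hEint, hEint,
          Finset.prod_range_succ, weight]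
        simp only [← add_assoc]
        field_simp
        ring

/-- Factor by factor, |ν_k - ν_0| ≤ λ_k + μ_k + θ once θ ≥ ν_0 and 0 < ν_k ≤ λ_k + μ_k. Both choices
of ν in (C) meet these bounds. -/
lemma weight_le (p : Pattern) (hp : p.Admissible) {nu : ℕ → ℝ} (h0 : ∀ n, 0 < nu n)
    (hnu : ∀ n, nu n ≤ p.lam n + p.mu n) (hinj : Function.Injective nu) {θ : ℝ}
    (hθ : nu 0 ≤ θ) (n : ℕ) :
    weight p θ n ≤ p.Lam n * |kappa nu n 0| / (p.lam 0 + p.mu 0 + θ) := by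
  have hpos : ∀ k, 0 < p.lam k + p.mu k + θ := fun k => by
    linarith [hp.lam_pos k, hp.mu_pos k, h0 0]
  have hw : weight p θ n = p.Lam n * ((∏ k ∈ (Finset.range (n + 1)).erase 0,
      (p.lam k + p.mu k + θ)⁻¹) / (p.lam 0 + p.mu 0 + θ)) := by
    have h1 : ∏ k ∈ Finset.range (n + 1), (p.lam k + p.mu k + θ)⁻¹ =
        (p.lam 0 + p.mu 0 + θ)⁻¹ * ∏ k ∈ (Finset.range (n + 1)).erase 0,
          (p.lam k + p.mu k + θ)⁻¹ := (Finset.mul_prod_erase _ _ (by simp)).symm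
    rw [weight, Pattern.Lam, div_eq_inv_mul (∏ k ∈ (Finset.range (n + 1)).erase 0, _), ← h1,
      Finset.prod_range_succ, Finset.prod_div_distrib, Finset.prod_inv_distrib]
    simp only [div_eq_mul_inv, mul_assoc]
  rw [hw, mul_div_assoc]
  have hL : 0 ≤ p.Lam n := Finset.prod_nonneg fun k _ => (hp.lam_pos k).le
  refine mul_le_mul_of_nonneg_left (div_le_div_of_nonneg_right ?_ (hpos 0).le) hL
  rw [kappa, Finset.abs_prod]
  refine Finset.prod_le_prod (fun k _ => (inv_pos.2 (hpos k)).le) fun k hk => ?_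
  rw [abs_inv]
  have hne : nu k - nu 0 ≠ 0 := sub_ne_zero.2 fun h => (Finset.mem_erase.1 hk).1 (hinj h)
  refine inv_anti₀ (abs_pos.2 hne) (abs_le.2 ⟨?_, ?_⟩) <;>
    linarith [h0 k, h0 0, hnu k, hpos k]

lemma weight_nonneg (p : Pattern) (hp : p.Admissible) {θ : ℝ} (hθ : 0 < θ) (n : ℕ) :
    0 ≤ weight p θ n := by
  have h := hp.lam_pos
  have h' := hp.mu_pos
  exact div_nonneg (Finset.prod_nonneg fun k _ => div_nonneg (h k).le
    (by linarith [h k, h' k])) (by linarith [h n, h' n])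

/-- The total rate of variation of `X` in the `n`-th state. -/
def rate (p : Pattern) (n : ℕ) : ℝ := |p.c n| + p.lam n * p.rAbs n + p.mu n * p.RAbs n

lemma rate_nonneg (p : Pattern) (hp : p.Admissible) (n : ℕ) : 0 ≤ rate p n := by
  have h1 : 0 ≤ p.rAbs n := integral_nonneg fun _ => abs_nonneg _
  have h2 : 0 ≤ p.RAbs n := integral_nonneg fun _ => abs_nonneg _
  have := hp.lam_pos n
  have := hp.mu_pos n
  rw [rate]
  positivity

lemma summable_rate_mul_weight (p : Pattern) (hp : p.Admissible) (hC : p.Converges) {θ : ℝ}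
    (hθ : p.lam 0 + p.mu 0 ≤ θ) : Summable fun n => rate p n * weight p θ n := by
  have hl := hp.lam_pos
  have hμ := hp.mu_pos
  have key : ∀ nu : ℕ → ℝ, (∀ n, 0 < nu n) → (∀ n, nu n ≤ p.lam n + p.mu n) →
      p.ConvergesWith nu → Summable fun n => rate p n * weight p θ n := by
    intro nu h0 hnu ⟨hinj, hsum⟩
    have h1 : Summable fun n => rate p n * p.Lam n * |kappa nu n 0| := by
      have h2 := (hsum 0).comp_injective (i := fun n : ℕ => (⟨n, Nat.zero_le n⟩ : {n // 0 ≤ n}))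
        fun a b h => by simpa using h
      exact h2
    refine Summable.of_nonneg_of_le (fun n => mul_nonneg (rate_nonneg p hp n)
      (weight_nonneg p hp (by linarith [hl 0, hμ 0]) n)) (fun n => ?_)
      (h1.div_const (p.lam 0 + p.mu 0 + θ))
    rw [mul_assoc, mul_div_assoc]
    exact mul_le_mul_of_nonneg_left (weight_le p hp h0 hnu hinj ((hnu 0).trans hθ) n)
      (rate_nonneg p hp n)
  rcases hC with h | h
  · exact key _ (fun n => add_pos (hl n) (hμ n)) (fun n => le_rfl) h
  · exact key _ hμ (fun n => by linarith [hl n]) h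

lemma summable_integral_abs_inc (hσ : ∀ i, (σ i).Admissible) (hC : ∀ i, (σ i).Converges)
    (t : ℝ≥0) : Summable fun p : ℕ × ℕ => ∫ ω, |D.inc p.1 p.2 t ω| ∂P := by
  -- The sum over both patterns exceeds λ_0 + μ_0 for each, so one θ serves all periods; `W`
  -- likewise dominates both patterns.
  set θ := ((σ true).lam 0 + (σ true).mu 0) + ((σ false).lam 0 + (σ false).mu 0) with hθd
  have hpos : ∀ i, 0 < (σ i).lam 0 + (σ i).mu 0 := fun i =>
    add_pos ((hσ i).lam_pos 0) ((hσ i).mu_pos 0)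
  have hθ : 0 < θ := add_pos (hpos _) (hpos _)
  have hle : ∀ i, (σ i).lam 0 + (σ i).mu 0 ≤ θ := by
    rintro (_ | _) <;> linarith [hpos true, hpos false]
  obtain ⟨ρ, h0, h1, hρ⟩ := D.exists_integral_discount_le (P := P) hσ hθ
  set W : ℕ → ℝ := fun n =>
    rate (σ true) n * weight (σ true) θ n + rate (σ false) n * weight (σ false) θ n with hW
  have hnn : ∀ i n, 0 ≤ rate (σ i) n * weight (σ i) θ n := fun i n =>
    mul_nonneg (rate_nonneg _ (hσ i) n) (weight_nonneg _ (hσ i) hθ n)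
  have hWs : Summable W := (summable_rate_mul_weight _ (hσ true) (hC true) (hle true)).add
    (summable_rate_mul_weight _ (hσ false) (hC false) (hle false))
  have hWle : ∀ i n, rate (σ i) n * weight (σ i) θ n ≤ W n := by
    rintro (_ | _) n <;> simp only [hW] <;> linarith [hnn true n, hnn false n]
  have hs := ((summable_geometric_of_lt_one h0 h1).mul_of_nonneg hWs (fun m => pow_nonneg h0 m)
    (fun n => (hnn true n).trans (hWle true n))).mul_left (Real.exp (θ * t))
  refine Summable.of_nonneg_of_le (fun p => integral_nonneg fun ω => abs_nonneg _) (fun p => ?_) hs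
  obtain ⟨m, n⟩ := p
  calc ∫ ω, |D.inc m n t ω| ∂P ≤ rate (D.pat m) n * ∫ ω, D.dur m n t ω ∂P :=
        D.integral_abs_inc_le hσ m n t
    _ ≤ rate (D.pat m) n * (Real.exp (θ * t) * (weight (D.pat m) θ n * ρ ^ m)) := by
        refine mul_le_mul_of_nonneg_left ((D.integral_dur_le hσ hθ m n t).trans ?_)
          (rate_nonneg _ (hσ _) n)
        exact mul_le_mul_of_nonneg_left (mul_le_mul_of_nonneg_left (hρ m)
          (weight_nonneg _ (hσ _) hθ n)) (Real.exp_pos _).le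
    _ = Real.exp (θ * t) * (ρ ^ m * (rate (D.pat m) n * weight (D.pat m) θ n)) := by ring
    _ ≤ _ := mul_le_mul_of_nonneg_left (mul_le_mul_of_nonneg_left (hWle _ n) (pow_nonneg h0 m))
        (Real.exp_pos _).le

/-! ### Sufficiency -/

omit [IsProbabilityMeasure P] in
lemma Good.exists_bounds {D : Driving P σ i₀} {ω : Ω} (g : D.Good ω) (t : ℝ≥0) :
    ∃ K₁ K₂ : ℕ, (∀ m, D.switchTime m ω ≤ t → m < K₁) ∧ ∀ m n, D.entry m n ω ≤ t → n < K₂ := by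
  obtain ⟨K₁, hK₁⟩ := g.switch_unbounded t
  have h1 : ∀ m, D.switchTime m ω ≤ t → m < K₁ := fun m hm => by
    by_contra! hcon
    exact absurd ((switchTime_mono D ω hcon).trans hm) (not_le.2 hK₁)
  choose k hk using fun m => g.shock_unbounded m t
  refine ⟨K₁, ∑ m ∈ Finset.range K₁, k m, h1, fun m n hmn => ?_⟩
  obtain ⟨h2, h3⟩ := shockTime_le_of_entry_le hmn
  have h4 : n < k m := by
    by_contra! hcon
    have h5 := shockTime_mono (fun j => (g.shock_pos m j).le) hcon
    simp only at h5
    linarith [hk m, (ENNReal.toReal_nonneg : 0 ≤ (D.switchTime m ω).toReal)]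
  exact h4.trans_le (Finset.single_le_sum (f := k) (fun _ _ => Nat.zero_le _)
    (Finset.mem_range.2 (h1 m h2)))

omit [IsProbabilityMeasure P] in
lemma Good.inc_eq_zero {D : Driving P σ i₀} {ω : Ω} (g : D.Good ω) {m n : ℕ} {t : ℝ≥0}
    (h : (t : ℝ≥0∞) ≤ D.entry m n ω) : D.inc m n t ω = 0 := by
  rw [inc, age_of_le_entry h, contrib_zero (g.shock_pos m n)]

omit [IsProbabilityMeasure P] in
lemma Good.hasSum_inc (hσ : ∀ i, (σ i).Admissible) {D : Driving P σ i₀} {ω : Ω} (g : D.Good ω)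
    (t : ℝ≥0) : HasSum (fun p : ℕ × ℕ => D.inc p.1 p.2 t ω) (D.X t ω) := by
  obtain ⟨K₁, K₂, h1, h2⟩ := g.exists_bounds t
  rw [g.X_eq_sum hσ h1 h2, ← Finset.sum_product']
  refine hasSum_sum_of_ne_finset_zero fun p hp => g.inc_eq_zero (le_of_not_ge fun hle => hp ?_)
  exact Finset.mem_product.2 ⟨Finset.mem_range.2 (h1 _ (shockTime_le_of_entry_le hle).1),
    Finset.mem_range.2 (h2 _ _ hle)⟩

omit [IsProbabilityMeasure P] in
lemma measurable_X (t : ℝ≥0) : Measurable (D.X t) := (D.measurable_LL t).add (D.measurable_JJ t)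

omit [IsProbabilityMeasure P] in
lemma measurable_filtration_obs {s t : ℝ≥0} (hst : s ≤ t) :
    Measurable[D.filtration t] (D.obs s) := by
  rw [measurable_iff_comap_le]
  exact le_iSup₂_of_le (f := fun j (_ : j ≤ t) => MeasurableSpace.comap (D.obs j) inferInstance)
    s hst le_rfl

omit [IsProbabilityMeasure P] in
lemma stronglyAdapted_X : StronglyAdapted D.filtration D.X := fun _ =>
  (measurable_snd.snd.comp (D.measurable_filtration_obs le_rfl)).stronglyMeasurable

lemma hasSum_setIntegral_inc (hσ : ∀ i, (σ i).Admissible) (hC : ∀ i, (σ i).Converges) (t : ℝ≥0)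
    (F : Set Ω) :
    HasSum (fun p : ℕ × ℕ => ∫ ω in F, D.inc p.1 p.2 t ω ∂P) (∫ ω in F, D.X t ω ∂P) := by
  have hi : ∀ p : ℕ × ℕ, Integrable (D.inc p.1 p.2 t) P := fun p => D.integrable_inc hσ p.1 p.2 t
  have h := hasSum_integral_of_summable_integral_norm (μ := P.restrict F)
    (F := fun p : ℕ × ℕ => D.inc p.1 p.2 t) (fun p => (hi p).integrableOn) (by
      refine Summable.of_nonneg_of_le (fun p => integral_nonneg fun ω => norm_nonneg _) (fun p => ?_)
        (D.summable_integral_abs_inc hσ hC t)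
      exact setIntegral_le_integral (hi p).abs (Filter.Eventually.of_forall fun _ => abs_nonneg _))
  have he : ∫ ω in F, D.X t ω ∂P = ∫ ω in F, ∑' p : ℕ × ℕ, D.inc p.1 p.2 t ω ∂P := by
    refine integral_congr_ae (ae_restrict_of_ae ?_)
    filter_upwards [D.ae_good hσ] with ω g
    exact (g.hasSum_inc hσ t).tsum_eq.symm
  rw [he]
  exact h

lemma integrable_X (hσ : ∀ i, (σ i).Admissible) (hC : ∀ i, (σ i).Converges) (t : ℝ≥0) :
    Integrable (D.X t) P := by
  have hi : ∀ p : ℕ × ℕ, Integrable (D.inc p.1 p.2 t) P := fun p => D.integrable_inc hσ p.1 p.2 t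
  refine ⟨(D.measurable_X t).aestronglyMeasurable, ?_⟩
  calc ∫⁻ ω, ‖D.X t ω‖ₑ ∂P ≤ ∫⁻ ω, ∑' p : ℕ × ℕ, ‖D.inc p.1 p.2 t ω‖ₑ ∂P := by
        refine lintegral_mono_ae ?_
        filter_upwards [D.ae_good hσ] with ω g
        rw [← (g.hasSum_inc hσ t).tsum_eq]
        exact enorm_tsum_le_tsum_enorm
    _ = ∑' p : ℕ × ℕ, ENNReal.ofReal (∫ ω, |D.inc p.1 p.2 t ω| ∂P) := by
        rw [lintegral_tsum fun p => (hi p).aestronglyMeasurable.enorm]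
        refine tsum_congr fun p => ?_
        rw [ofReal_integral_eq_lintegral_ofReal (hi p).abs
          (Filter.Eventually.of_forall fun _ => abs_nonneg _)]
        simp only [Real.enorm_eq_ofReal_abs]
    _ < ⊤ := by
        rw [← ENNReal.ofReal_tsum_of_nonneg (fun p => integral_nonneg fun _ => abs_nonneg _)
          (D.summable_integral_abs_inc hσ hC t)]
        exact ENNReal.ofReal_lt_top

/-- On an event F of the filtration at s, each contribution has the same integral at s and at t, and
absolute summability allows these equalities to be added. -/
theorem martingale_of_Delta_eq_zero (hσ : ∀ i, (σ i).Admissible) (hC : ∀ i, (σ i).Converges)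
    (hΔ : ∀ i n, (σ i).Delta n = 0) : Martingale D.X D.filtration P := by
  refine ⟨D.stronglyAdapted_X, fun s t hst => ?_⟩
  refine (ae_eq_condExp_of_forall_setIntegral_eq (D.filtration.le s) (D.integrable_X hσ hC t)
    (fun F _ _ => (D.integrable_X hσ hC s).integrableOn) (fun F hF _ => ?_)
    (D.stronglyAdapted_X s).aestronglyMeasurable).symm
  refine (D.hasSum_setIntegral_inc hσ hC s F).unique ?_
  refine (D.hasSum_setIntegral_inc hσ hC t F).congr_fun fun p => ?_
  have h := D.setIntegral_inc_sub hσ p.1 p.2 hst hF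
  rw [pat, hΔ, zero_mul, integral_sub (D.integrable_inc hσ _ _ t).integrableOn
    (D.integrable_inc hσ _ _ s).integrableOn] at h
  linarith

end Driving
open Filter Topology

namespace Driving

variable {Ω : Type*} [MeasurableSpace Ω] {P : Measure Ω} {σ : Bool → Pattern} {i₀ : Bool}
  {D : Driving P σ i₀} {m n : ℕ} {ω : Ω}

/-! ### Right continuity -/

lemma continuous_age (D : Driving P σ i₀) (m n : ℕ) (ω : Ω) :
    Continuous fun u => D.age m n u ω := by
  rcases eq_or_ne (D.entry m n ω) ⊤ with h | h
  · have : (fun u => D.age m n u ω) = fun _ => 0 :=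
      funext fun u => age_of_le_entry (h ▸ le_top)
    rw [this]
    exact continuous_const
  · lift D.entry m n ω to ℝ≥0 using h with e he
    have : (fun u => D.age m n u ω) = fun u : ℝ≥0 => ((u - e : ℝ≥0) : ℝ) := funext fun u => by
      rw [age, ← he, ← ENNReal.coe_sub, ENNReal.coe_toReal]
    rw [this]
    fun_prop

lemma tendsto_ite_of_right_closed {w : ℝ≥0} {p : ℝ≥0 → Prop} [∀ u, Decidable (p u)]
    (h : ∀ᶠ u in 𝓝[≥] w, (p u ↔ p w)) :
    Tendsto (fun u => if p u then (1 : ℝ) else 0) (𝓝[≥] w) (𝓝 (if p w then 1 else 0)) := by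
  refine tendsto_const_nhds.congr' ?_
  filter_upwards [h] with u hu
  simp only [hu]

/-- The age is continuous and nondecreasing: a threshold reached at w remains reached, and one not
reached is not reached shortly afterwards. -/
lemma eventually_le_min_age_iff (D : Driving P σ i₀) (m n : ℕ) (w : ℝ≥0) (ω : Ω) (x y : ℝ) :
    ∀ᶠ u in 𝓝[≥] w, (x ≤ min (D.age m n u ω) y ↔ x ≤ min (D.age m n w ω) y) := by
  have hc : ContinuousAt (fun u => D.age m n u ω) w := (continuous_age D m n ω).continuousAt
  rcases le_or_gt x (D.age m n w ω) with h | h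
  · filter_upwards [self_mem_nhdsWithin] with u hu
    have h2 : D.age m n w ω ≤ D.age m n u ω := age_mono D m n ω hu
    simp only [le_min_iff, h, h.trans h2]
  · filter_upwards [mem_nhdsWithin_of_mem_nhds (hc.eventually_lt_const h)] with u hu
    simp only [le_min_iff, not_le.2 h, not_le.2 hu]

lemma tendsto_inc (D : Driving P σ i₀) (m n : ℕ) (w : ℝ≥0) (ω : Ω) :
    Tendsto (fun u => D.inc m n u ω) (𝓝[≥] w) (𝓝 (D.inc m n w ω)) := by
  have hc : Tendsto (fun u => D.age m n u ω) (𝓝[≥] w) (𝓝 (D.age m n w ω)) :=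
    (continuous_age D m n ω).continuousAt.mono_left nhdsWithin_le_nhds
  refine (((hc.min tendsto_const_nhds).const_mul _).add
    ((tendsto_ite_of_right_closed ?_).const_mul _)).add
    ((tendsto_ite_of_right_closed ?_).const_mul _)
  · exact eventually_le_min_age_iff D m n w ω _ _
  · filter_upwards [eventually_le_min_age_iff D m n w ω (D.zeta m n ω) (D.noise (.shock m n) ω)]
      with u hu
    simp only [hu]

lemma Good.tendsto_X (hσ : ∀ i, (σ i).Admissible) (g : D.Good ω) (w : ℝ≥0) :
    Tendsto (fun u => D.X u ω) (𝓝[≥] w) (𝓝 (D.X w ω)) := by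
  -- Bounds at time w + 1 are valid for all u ≤ w + 1, so near w the process is one fixed finite sum
  -- of right-continuous terms.
  obtain ⟨K₁, K₂, h1, h2⟩ := g.exists_bounds (w + 1)
  have key : ∀ u ≤ w + 1, D.X u ω = ∑ m ∈ Finset.range K₁, ∑ n ∈ Finset.range K₂, D.inc m n u ω := by
    intro u hu
    have hu' : (u : ℝ≥0∞) ≤ ((w + 1 : ℝ≥0) : ℝ≥0∞) := by exact_mod_cast hu
    exact g.X_eq_sum hσ (fun m hm => h1 m (hm.trans hu')) fun m n hm => h2 m n (hm.trans hu')
  rw [key w (by simp)]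
  refine (tendsto_finsetSum _ fun m _ => tendsto_finsetSum _ fun n _ =>
    D.tendsto_inc m n w ω).congr' ?_
  filter_upwards [mem_nhdsWithin_of_mem_nhds (Iic_mem_nhds (lt_add_one w))] with u hu
  exact (key u hu).symm

/-! ### One sojourn -/

/-- The event that the state at the time `u` is `(m, n)`. -/
def stateSet (D : Driving P σ i₀) (m n : ℕ) (u : ℝ≥0) : Set Ω :=
  {ω | D.M u ω = m ∧ D.N (D.M u ω) (D.elapsed u ω) ω = n}

lemma measurableSet_stateSet (D : Driving P σ i₀) (m n : ℕ) {u v : ℝ≥0} (huv : u ≤ v) :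
    MeasurableSet[D.filtration v] (D.stateSet m n u) :=
  D.measurable_filtration_obs huv ((measurable_fst (measurableSet_singleton m)).inter
    (measurable_snd.fst (measurableSet_singleton n)) :
      MeasurableSet {q : ℕ × ℕ × ℝ | q.1 = m ∧ q.2.1 = n})

lemma Good.mem_stateSet_iff (hσ : ∀ i, (σ i).Admissible) (g : D.Good ω) {u : ℝ≥0} :
    ω ∈ D.stateSet m n u ↔ D.entry m n ω ≤ u ∧ D.age m n u ω < D.soj m n ω :=
  g.state_eq_iff hσ

lemma age_of_entry_le {s t : ℝ≥0} (h : D.entry m n ω ≤ s) (hst : s ≤ t) :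
    D.age m n t ω = D.age m n s ω + (t - s) := by
  lift D.entry m n ω to ℝ≥0 using ne_top_of_le_ne_top ENNReal.coe_ne_top h with e he
  have hs : e ≤ s := by exact_mod_cast h
  rw [age, age, ← he, ← ENNReal.coe_sub, ← ENNReal.coe_sub, ENNReal.coe_toReal, ENNReal.coe_toReal,
    NNReal.coe_sub hs, NNReal.coe_sub (hs.trans hst)]
  ring

/-- The moment of exit from the state occupied at the time `s`, stopped at `t`. -/
def exit (D : Driving P σ i₀) (m n : ℕ) (s t : ℝ≥0) (ω : Ω) : ℝ≥0 :=
  min (s + (D.soj m n ω - D.age m n s ω).toNNReal) t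

lemma Good.mem_stateSet_iff_lt_exit (hσ : ∀ i, (σ i).Admissible) (g : D.Good ω) {s t u : ℝ≥0}
    (hs : ω ∈ D.stateSet m n s) (hsu : s ≤ u) (hut : u < t) :
    ω ∈ D.stateSet m n u ↔ u < D.exit m n s t ω := by
  obtain ⟨h1, h2⟩ := (g.mem_stateSet_iff hσ).1 hs
  have h3 : D.entry m n ω ≤ u := h1.trans (by exact_mod_cast hsu)
  rw [g.mem_stateSet_iff hσ, and_iff_right h3, age_of_entry_le h1 hsu, exit, lt_min_iff,
    and_iff_left hut, ← NNReal.coe_lt_coe, NNReal.coe_add,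
    Real.coe_toNNReal _ (sub_nonneg.2 h2.le)]
  constructor <;> intro <;> linarith

/-- Between s and the exit only the state occupied at s contributes; after its exit its own
contribution is constant, so t may replace the exit on the right. -/
lemma Good.X_exit (hσ : ∀ i, (σ i).Admissible) (g : D.Good ω) {s t : ℝ≥0}
    (hs : ω ∈ D.stateSet m n s) (hst : s ≤ t) :
    D.X (D.exit m n s t ω) ω - D.X s ω = D.inc m n t ω - D.inc m n s ω := by
  obtain ⟨h1, h2⟩ := (g.mem_stateSet_iff hσ).1 hs
  set w := D.exit m n s t ω with hw
  have hsw : s ≤ w := le_min le_self_add hst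
  have hwt : w ≤ t := min_le_right _ _
  have hmn : D.inc m n w ω = D.inc m n t ω := by
    rcases le_total (s + (D.soj m n ω - D.age m n s ω).toNNReal) t with h | h
    · have hw' : w = s + (D.soj m n ω - D.age m n s ω).toNNReal := min_eq_left h
      have h3 : D.age m n w ω = D.soj m n ω := by
        rw [age_of_entry_le h1 hsw, hw', NNReal.coe_add, Real.coe_toNNReal _ (sub_nonneg.2 h2.le)]
        ring
      exact (contrib_of_soj_le h3.ge (age_mono D m n ω hwt)).symm
    · rw [hw, exit, min_eq_right h]
  rw [← hmn]
  refine ((g.hasSum_inc hσ w).sub (g.hasSum_inc hσ s)).unique ?_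
  refine hasSum_single (m, n) fun q hq => sub_eq_zero.2 ?_
  obtain ⟨m', n'⟩ := q
  have hne : ∀ u, ω ∈ D.stateSet m n u → ω ∉ D.stateSet m' n' u := fun u h h' =>
    hq (Prod.ext (h'.1.symm.trans h.1) (h'.2.symm.trans h.2))
  rcases le_or_gt (D.soj m' n' ω) (D.age m' n' s ω) with h3 | h3
  · exact contrib_of_soj_le h3 (age_mono D m' n' ω hsw)
  -- A different state that is not over by s has not begun by s; beginning before the exit would
  -- make two states occupied at once.
  have h4 : (s : ℝ≥0∞) < D.entry m' n' ω := by
    by_contra! h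
    exact hne s hs ((g.mem_stateSet_iff hσ).2 ⟨h, h3⟩)
  rcases le_or_gt (w : ℝ≥0∞) (D.entry m' n' ω) with h5 | h5
  · rw [g.inc_eq_zero h5, g.inc_eq_zero h4.le]
  have h6 := ne_top_of_lt h5
  obtain ⟨u, hu⟩ : ∃ u : ℝ≥0, (u : ℝ≥0∞) = D.entry m' n' ω := ⟨_, ENNReal.coe_toNNReal h6⟩
  rw [← hu, ENNReal.coe_lt_coe] at h4 h5
  refine absurd ((g.mem_stateSet_iff hσ).2 ⟨hu.ge, ?_⟩)
    (hne u ((g.mem_stateSet_iff_lt_exit hσ hs h4.le (h5.trans_le hwt)).2 h5))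
  rw [age_of_le_entry hu.le]
  exact (D.age_nonneg m' n' s ω).trans_lt h3

/-! ### Optional stopping at the moment of exit -/

/-- The points of a uniform grid on `[s, t]`. -/
def gridPoint (s t : ℝ≥0) (K j : ℕ) : ℝ≥0 := s + (t - s) * (j / (K + 1))

lemma gridPoint_mono (s t : ℝ≥0) (K : ℕ) : Monotone (gridPoint s t K) := fun i j h => by
  have : (i : ℝ≥0) ≤ j := by exact_mod_cast h
  unfold gridPoint
  gcongr

@[simp] lemma gridPoint_zero (s t : ℝ≥0) (K : ℕ) : gridPoint s t K 0 = s := by simp [gridPoint]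

lemma gridPoint_last {s t : ℝ≥0} (hst : s ≤ t) (K : ℕ) : gridPoint s t K (K + 1) = t := by
  rw [gridPoint, Nat.cast_add_one, div_self (by positivity), mul_one, add_tsub_cancel_of_le hst]

lemma gridPoint_succ (s t : ℝ≥0) (K j : ℕ) :
    gridPoint s t K (j + 1) = gridPoint s t K j + (t - s) * (1 / (K + 1)) := by
  rw [gridPoint, gridPoint, Nat.cast_add_one, add_div, mul_add, add_assoc]

lemma gridPoint_lt {s t : ℝ≥0} (hst : s < t) {K j : ℕ} (hj : j < K + 1) : gridPoint s t K j < t := by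
  have h : (t - s) * (1 / ((K : ℝ≥0) + 1)) > 0 := mul_pos (tsub_pos_of_lt hst) (by positivity)
  calc gridPoint s t K j < gridPoint s t K (j + 1) := by
        rw [gridPoint_succ]; exact lt_add_of_pos_right _ h
    _ ≤ t := (gridPoint_mono s t K hj).trans_eq (gridPoint_last hst.le K)

lemma exists_gridExit (D : Driving P σ i₀) (m n : ℕ) (s t : ℝ≥0) (K : ℕ) (ω : Ω) :
    ∃ j, K + 1 ≤ j ∨ ω ∉ D.stateSet m n (gridPoint s t K j) := ⟨K + 1, Or.inl le_rfl⟩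

open Classical in
/-- The first point of the grid at which the state is not `(m, n)`, or the last point. -/
def gridExit (D : Driving P σ i₀) (m n : ℕ) (s t : ℝ≥0) (K : ℕ) (ω : Ω) : ℝ≥0 :=
  gridPoint s t K (Nat.find (D.exists_gridExit m n s t K ω))

lemma gridExit_le_iff (D : Driving P σ i₀) (m n : ℕ) (s t : ℝ≥0) (K : ℕ) (ω : Ω) (u : ℝ≥0) :
    D.gridExit m n s t K ω ≤ u ↔
      ∃ j, gridPoint s t K j ≤ u ∧ (K + 1 ≤ j ∨ ω ∉ D.stateSet m n (gridPoint s t K j)) := by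
  classical
  refine ⟨fun h => ⟨_, h, Nat.find_spec (D.exists_gridExit m n s t K ω)⟩, fun ⟨j, h1, h2⟩ => ?_⟩
  exact (gridPoint_mono s t K (Nat.find_min' _ h2)).trans h1

/-- The event up to u is determined by observations at grid points not exceeding u, for every path.
Grid times have countably many values, which suits optional stopping, and they decrease to the exit
as far as right continuity needs: from above. -/
lemma isStoppingTime_gridExit (D : Driving P σ i₀) (m n : ℕ) (s t : ℝ≥0) (K : ℕ) :
    IsStoppingTime D.filtration fun ω => (D.gridExit m n s t K ω : WithTop ℝ≥0) := by
  intro u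
  simp only [WithTop.coe_le_coe, gridExit_le_iff, Set.ofPred_exists]
  refine MeasurableSet.iUnion fun j => ?_
  by_cases h1 : gridPoint s t K j ≤ u
  · by_cases h2 : K + 1 ≤ j
    · simp [h1, h2]
    · simp only [h1, h2, true_and, false_or]
      exact (D.measurableSet_stateSet m n h1).compl
  · simp [h1]

lemma gridExit_le (D : Driving P σ i₀) (m n : ℕ) {s t : ℝ≥0} (hst : s ≤ t) (K : ℕ) (ω : Ω) :
    D.gridExit m n s t K ω ≤ t :=
  (D.gridExit_le_iff m n s t K ω t).2 ⟨K + 1, (gridPoint_last hst K).le, Or.inl le_rfl⟩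

lemma gridExit_of_notMem {s t : ℝ≥0} (hs : ω ∉ D.stateSet m n s) (K : ℕ) :
    D.gridExit m n s t K ω = s := by
  classical
  rw [gridExit, (Nat.find_eq_zero (D.exists_gridExit m n s t K ω)).2 (Or.inr (by simpa using hs)),
    gridPoint_zero]

lemma Good.exit_le_gridExit (hσ : ∀ i, (σ i).Admissible) (g : D.Good ω) {s t : ℝ≥0} (hst : s ≤ t)
    (hs : ω ∈ D.stateSet m n s) (K : ℕ) : D.exit m n s t ω ≤ D.gridExit m n s t K ω := by
  classical
  rcases Nat.find_spec (D.exists_gridExit m n s t K ω) with h | h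
  · exact (min_le_right _ _).trans ((gridPoint_last hst K).ge.trans (gridPoint_mono s t K h))
  · by_contra! hlt
    refine h ((g.mem_stateSet_iff_lt_exit hσ hs ?_ (hlt.trans_le (min_le_right _ _))).2 hlt)
    exact (gridPoint_zero s t K).ge.trans (gridPoint_mono s t K (Nat.zero_le _))

lemma Good.gridExit_le_exit_add (hσ : ∀ i, (σ i).Admissible) (g : D.Good ω) {s t : ℝ≥0}
    (hst : s < t) (hs : ω ∈ D.stateSet m n s) (K : ℕ) :
    D.gridExit m n s t K ω ≤ D.exit m n s t ω + (t - s) * (1 / (K + 1)) := by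
  classical
  have h0 : Nat.find (D.exists_gridExit m n s t K ω) ≠ 0 := fun h => by
    rcases (Nat.find_eq_zero (D.exists_gridExit m n s t K ω)).1 h with h | h
    · omega
    · exact h (by simpa using hs)
  obtain ⟨j, hj⟩ := Nat.exists_eq_succ_of_ne_zero h0
  have h1 := Nat.find_min (D.exists_gridExit m n s t K ω) (hj ▸ Nat.lt_succ_self j)
  rw [not_or, not_not, not_le] at h1
  rw [gridExit, hj, Nat.succ_eq_add_one, gridPoint_succ]
  gcongr
  refine ((g.mem_stateSet_iff_lt_exit hσ hs ?_ (gridPoint_lt hst h1.1)).1 h1.2).le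
  exact (gridPoint_zero s t K).ge.trans (gridPoint_mono s t K (Nat.zero_le _))

lemma Good.tendsto_gridExit (hσ : ∀ i, (σ i).Admissible) (g : D.Good ω) {s t : ℝ≥0}
    (hst : s < t) (hs : ω ∈ D.stateSet m n s) :
    Tendsto (fun K => D.gridExit m n s t K ω) atTop (𝓝[≥] (D.exit m n s t ω)) := by
  refine tendsto_nhdsWithin_iff.2 ⟨?_, Eventually.of_forall fun K =>
    g.exit_le_gridExit hσ hst.le hs K⟩
  refine tendsto_of_tendsto_of_tendsto_of_le_of_le tendsto_const_nhds ?_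
    (fun K => g.exit_le_gridExit hσ hst.le hs K) (fun K => g.gridExit_le_exit_add hσ hst hs K)
  have h : Tendsto (fun K : ℕ => (1 : ℝ≥0) / (K + 1)) atTop (𝓝 0) :=
    NNReal.tendsto_coe.1 (by simpa using tendsto_one_div_add_atTop_nhds_zero_nat (𝕜 := ℝ))
  simpa using (h.const_mul (t - s)).const_add (D.exit m n s t ω)

lemma Good.tendsto_X_gridExit (hσ : ∀ i, (σ i).Admissible) (g : D.Good ω) {s t : ℝ≥0}
    (hst : s < t) :
    Tendsto (fun K => D.X (D.gridExit m n s t K ω) ω) atTop (𝓝 (D.X s ω +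
      (D.stateSet m n s).indicator (fun ω => D.inc m n t ω - D.inc m n s ω) ω)) := by
  by_cases hs : ω ∈ D.stateSet m n s
  · rw [Set.indicator_of_mem hs, ← g.X_exit hσ hs hst.le, add_sub_cancel]
    exact (g.tendsto_X hσ _).comp (g.tendsto_gridExit hσ hst hs)
  · simp only [gridExit_of_notMem hs, Set.indicator_of_notMem hs, add_zero]
    exact tendsto_const_nhds

variable [IsProbabilityMeasure P]

lemma integral_X_eq (hM : Martingale D.X D.filtration P) {s t : ℝ≥0} (hst : s ≤ t) :
    ∫ ω, D.X s ω ∂P = ∫ ω, D.X t ω ∂P := by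
  simpa using hM.setIntegral_eq hst (s := Set.univ) MeasurableSet.univ

/-- Optional stopping at the grid exits gives the mean of X(s). In the limit the stopped value is
X(s) plus the increment of the single state, whose mean must then be zero. -/
lemma setIntegral_stateSet_inc_sub (hσ : ∀ i, (σ i).Admissible)
    (hM : Martingale D.X D.filtration P) (m n : ℕ) {s t : ℝ≥0} (hst : s < t) :
    ∫ ω in D.stateSet m n s, (D.inc m n t ω - D.inc m n s ω) ∂P = 0 := by
  have hA : MeasurableSet (D.stateSet m n s) :=
    D.filtration.le s _ (D.measurableSet_stateSet m n le_rfl)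
  have hst' := fun K => D.isStoppingTime_gridExit m n s t K
  have hcond : ∀ K, P[D.X t | (hst' K).measurableSpace] =ᵐ[P]
      fun ω => D.X (D.gridExit m n s t K ω) ω := fun K => by
    refine (hM.stoppedValue_ae_eq_condExp_of_le_const_of_countable_range (hst' K) (n := t)
      (fun ω => by exact_mod_cast D.gridExit_le m n hst.le K ω) ?_).symm
    refine (Set.countable_range fun j => ((gridPoint s t K j : ℝ≥0) : WithTop ℝ≥0)).mono ?_
    rintro _ ⟨ω, rfl⟩
    exact ⟨_, rfl⟩
  have hle : ∀ K, (hst' K).measurableSpace ≤ (inferInstance : MeasurableSpace Ω) := fun K =>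
    (hst' K).measurableSpace_le
  -- The stopped values are conditional expectations of the single integrable variable X(t), hence
  -- uniformly integrable, and almost sure convergence becomes convergence in L¹.
  have hui : UniformIntegrable (fun K ω => D.X (D.gridExit m n s t K ω) ω) 1 P :=
    ((hM.integrable t).uniformIntegrable_condExp hle).ae_eq hcond
  have hinc : Integrable ((D.stateSet m n s).indicator
      fun ω => D.inc m n t ω - D.inc m n s ω) P :=
    ((D.integrable_inc hσ m n t).sub (D.integrable_inc hσ m n s)).indicator hA
  have hlim := (hM.integrable s).add hinc
  have hL1 := tendsto_Lp_finite_of_tendsto_ae le_rfl ENNReal.one_ne_top hui.1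
    (memLp_one_iff_integrable.2 hlim) hui.2.1 (by
      filter_upwards [D.ae_good hσ] with ω g
      exact g.tendsto_X_gridExit hσ hst)
  have hint := tendsto_integral_of_L1' _ hlim.1 (Eventually.of_forall fun K =>
    (integrable_condExp (m := (hst' K).measurableSpace)).congr (hcond K)) hL1
  have hconst : ∀ K, ∫ ω, D.X (D.gridExit m n s t K ω) ω ∂P = ∫ ω, D.X s ω ∂P := fun K => by
    rw [integral_X_eq hM hst.le, ← integral_congr_ae (hcond K), integral_condExp (hle K)]
  simp only [hconst] at hint
  have h := tendsto_nhds_unique tendsto_const_nhds hint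
  simp only [Pi.add_apply] at h
  rw [integral_add (hM.integrable s) hinc, integral_indicator hA] at h
  linarith

lemma Delta_eq_zero_of_measure_ne_zero (hσ : ∀ i, (σ i).Admissible)
    (hM : Martingale D.X D.filtration P) {m n : ℕ} {s : ℝ≥0} (h : P (D.stateSet m n s) ≠ 0) :
    (D.pat m).Delta n = 0 := by
  have hlt : s < s + 1 := lt_add_one s
  have hF := D.measurableSet_stateSet m n (le_refl s)
  have h1 := D.setIntegral_inc_sub hσ m n hlt.le hF
  rw [setIntegral_stateSet_inc_sub hσ hM m n hlt] at h1
  refine (mul_eq_zero.1 h1.symm).resolve_right (ne_of_gt ?_)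
  -- A state occupied at s has a strictly positive remaining sojourn, so its occupation time grows
  -- during [s, s + 1].
  have hpos : ∀ᵐ ω ∂P, ω ∈ D.stateSet m n s → 0 < D.dur m n (s + 1) ω - D.dur m n s ω := by
    filter_upwards [D.ae_good hσ] with ω g hω
    obtain ⟨h2, h3⟩ := (g.mem_stateSet_iff hσ).1 hω
    rw [sub_pos, dur, dur, min_eq_left h3.le, age_of_entry_le h2 hlt.le]
    exact lt_min (by simp) h3
  have hA : MeasurableSet (D.stateSet m n s) := D.filtration.le s _ hF
  rw [setIntegral_pos_iff_support_of_nonneg_ae]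
  · refine lt_of_lt_of_le (pos_iff_ne_zero.2 h) (measure_mono_ae ?_)
    filter_upwards [hpos] with ω h2 h3
    exact ⟨(h2 h3).ne', h3⟩
  · rw [EventuallyLE, ae_restrict_iff' hA]
    filter_upwards [hpos] with ω h2 h3 using (h2 h3).le
  · exact ((D.integrable_dur hσ m n _).sub (D.integrable_dur hσ m n _)).integrableOn

/-! ### Every state is visited -/

lemma measure_switchTime_lt_top_ne_zero (hσ : ∀ i, (σ i).Admissible) (D : Driving P σ i₀) (m : ℕ) :
    P {ω | D.switchTime m ω < ⊤} ≠ 0 := by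
  induction m with
  | zero => simp [switchTime]
  | succ m ih =>
    have hμ := (hσ (eps i₀ m)).mu_pos 0
    have hG : MeasurableSet[D.sigma (past m 0)] {ω | D.switchTime m ω < ⊤} :=
      (D.measurable_sigma_switchTime hσ m 0) measurableSet_Iio
    have hH : MeasurableSet[D.sigma {Source.clock m}ᶜ]
        ({ω | D.switchTime m ω < ⊤} ∩ D.noise (.shock m 0) ⁻¹' Set.Ioi 1) :=
      (D.sigma_mono (past_subset_compl_clock m 0) _ hG).inter
        ((D.measurable_sigma_noise (by simp)) measurableSet_Ioi)
    -- A first shock later than 1 and a clock at most μ_0 force a switching in the first state by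
    -- age 1; by independence this has positive probability.
    have hne : P (({ω | D.switchTime m ω < ⊤} ∩ D.noise (.shock m 0) ⁻¹' Set.Ioi 1) ∩
        D.noise (.clock m) ⁻¹' Set.Ioc 0 ((σ (eps i₀ m)).mu 0)) ≠ 0 := by
      rw [D.measure_inter_source hH measurableSet_Ioc,
        D.measure_inter_source (D.sigma_mono (past_subset_compl_shock m 0) _ hG) measurableSet_Ioi,
        sourceLaw_shock, sourceLaw_clock, expMeasure_Ioi ((hσ _).lam_pos 0) zero_le_one,
        expMeasure_Ioc_eq one_pos le_rfl hμ.le]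
      refine mul_ne_zero (mul_ne_zero ih ?_) ?_
      · exact (ENNReal.ofReal_pos.2 (Real.exp_pos _)).ne'
      · refine (ENNReal.ofReal_pos.2 ?_).ne'
        simpa using hμ
    refine fun h0 => hne (measure_mono_null_ae ?_ h0)
    filter_upwards [D.ae_good hσ] with ω g hω
    obtain ⟨⟨h1, h2⟩, h3, h4⟩ := hω
    have hz : D.zeta m 0 ω = D.noise (.clock m) ω / (σ (eps i₀ m)).mu 0 := by
      rw [zeta, expo_zero, sub_zero]
    have hz1 : D.zeta m 0 ω ≤ 1 := hz ▸ (div_le_one hμ).2 h4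
    have hhold := hold_eq hσ (fun k => (g.shock_pos m k).le) (n := 0) (hz ▸ div_pos h3 hμ)
      (hz1.trans (le_of_lt h2))
    change D.switchTime (m + 1) ω < ⊤
    rw [switchTime_succ, hhold]
    exact ENNReal.add_lt_top.2 ⟨h1, ENNReal.ofReal_lt_top⟩

/-- Some constant C bounds `expo` on a nonnull event with finite switching time, and the independent
clock exceeds C with positive probability. -/
lemma measure_visited_ne_zero (hσ : ∀ i, (σ i).Admissible) (D : Driving P σ i₀) (m n : ℕ) :
    P {ω | D.switchTime m ω < ⊤ ∧ D.expo m n ω < D.noise (.clock m) ω} ≠ 0 := by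
  obtain ⟨C, hC⟩ : ∃ C : ℕ, P ({ω | D.switchTime m ω < ⊤} ∩ D.expo m n ⁻¹' Set.Iic (C : ℝ)) ≠ 0 := by
    by_contra! hcon
    refine measure_switchTime_lt_top_ne_zero hσ D m (measure_mono_null (fun ω hω => ?_)
      (measure_iUnion_null hcon))
    exact Set.mem_iUnion.2 ⟨⌈D.expo m n ω⌉₊, hω, Nat.le_ceil (D.expo m n ω)⟩
  have hG : MeasurableSet[D.sigma {Source.clock m}ᶜ]
      ({ω | D.switchTime m ω < ⊤} ∩ D.expo m n ⁻¹' Set.Iic (C : ℝ)) :=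
    D.sigma_mono (past_subset_compl_clock m n) _
      (((D.measurable_sigma_switchTime hσ m n) measurableSet_Iio).inter
        ((D.measurable_sigma_expo m n) measurableSet_Iic))
  have h := D.measure_inter_source hG (measurableSet_Ioi (a := (C : ℝ)))
  rw [sourceLaw_clock, expMeasure_Ioi one_pos C.cast_nonneg] at h
  refine fun h0 => mul_ne_zero hC (ENNReal.ofReal_pos.2 (Real.exp_pos _)).ne'
    (h ▸ measure_mono_null ?_ h0)
  rintro ω ⟨⟨h1, h2⟩, h3⟩
  exact ⟨h1, lt_of_le_of_lt h2 h3⟩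

/-- A visited state is occupied during a nondegenerate time interval, which meets a countable dense
set of times; were the state occupied with probability zero at each of these, it would almost surely
never be visited. -/
lemma exists_measure_stateSet_ne_zero (hσ : ∀ i, (σ i).Admissible) (D : Driving P σ i₀) (m n : ℕ) :
    ∃ s, P (D.stateSet m n s) ≠ 0 := by
  by_contra! hcon
  refine measure_visited_ne_zero hσ D m n (measure_mono_null_ae ?_
    (measure_iUnion_null fun j => hcon (TopologicalSpace.denseSeq ℝ≥0 j)))
  filter_upwards [D.ae_good hσ] with ω g hω
  obtain ⟨h1, h2⟩ := hω
  have hsoj : 0 < D.soj m n ω :=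
    (lt_soj_iff le_rfl).2 ⟨g.shock_pos m n, (zeta_pos_iff hσ).2 h2⟩
  obtain ⟨e, he⟩ : ∃ e : ℝ≥0, (e : ℝ≥0∞) = D.entry m n ω :=
    ⟨_, ENNReal.coe_toNNReal (ENNReal.add_lt_top.2 ⟨h1, ENNReal.ofReal_lt_top⟩).ne⟩
  obtain ⟨_, ⟨j, rfl⟩, hj1, hj2⟩ := (TopologicalSpace.denseRange_denseSeq ℝ≥0).exists_between
    (lt_add_of_pos_right e (Real.toNNReal_pos.2 hsoj))
  refine Set.mem_iUnion.2 ⟨j, (g.mem_stateSet_iff hσ).2 ⟨?_, ?_⟩⟩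
  · rw [← he]
    exact_mod_cast hj1.le
  · rw [age_of_entry_le he.ge hj1.le, age_of_le_entry he.le, zero_add, sub_lt_iff_lt_add']
    have h3 := NNReal.coe_lt_coe.2 hj2
    rwa [NNReal.coe_add, Real.coe_toNNReal _ hsoj.le] at h3

theorem Delta_eq_zero_of_martingale (hσ : ∀ i, (σ i).Admissible) (D : Driving P σ i₀)
    (hM : Martingale D.X D.filtration P) (i : Bool) (n : ℕ) : (σ i).Delta n = 0 := by
  -- The states alternate, so period 0 or period 1 is governed by the pattern i.
  obtain ⟨m, rfl⟩ : ∃ m, eps i₀ m = i := by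
    by_cases h : i₀ = i
    · exact ⟨0, by simpa [eps] using h⟩
    · exact ⟨1, by revert h; cases i₀ <;> cases i <;> simp [eps]⟩
  obtain ⟨s, hs⟩ := exists_measure_stateSet_ne_zero hσ D m n
  exact Delta_eq_zero_of_measure_ne_zero hσ hM hs

end Driving

end

end PiecewiseLinear

theorem mainTheorem7 {Ω : Type*} [MeasurableSpace Ω] (P : Measure Ω) [IsProbabilityMeasure P]
    (σ : Bool → PiecewiseLinear.Pattern) (hσ : ∀ i, (σ i).Admissible)
    (i₀ : Bool) (D : PiecewiseLinear.Driving P σ i₀) :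
    ((∀ i, (σ i).Converges) →
      (Martingale D.X D.filtration P ↔ ∀ i n, (σ i).Delta n = 0)) ∧
    (Martingale D.X D.filtration P → ∀ i n, (σ i).Delta n = 0) :=
  ⟨fun hC => ⟨fun hM => D.Delta_eq_zero_of_martingale hσ hM,
      fun hΔ => D.martingale_of_Delta_eq_zero hσ hC hΔ⟩,
    fun hM => D.Delta_eq_zero_of_martingale hσ hM⟩
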